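/- Let $n\ge 3$, let $\rho_0>0$ and $C_0$ be constants, and write $\omega_{n-1}$ for the volume of the unit sphere in $\mathbb R^n$. There are constants $C>0$ and $\delta>0$, depending only on $n,\rho_0,C_0$, such that the following holds. Let $(M_j,g_j,k_j)$, $j\in\mathbb N$, be smooth initial data sets on $M_j=\mathbb R^n$, or on $M_j=\mathbb R^n\setminus B_0(r_j)$ with $0<r_j\le\rho_0$, with the following properties. * They are spherically symmetric: $g=g_{11}(r)\,dr^2+\rho(r)^2g_{S^{n-1}}$ and $k_{ab}=n_an_bk_n(r)+(g_{ab}-n_an_b)k_t(r)$, where $r=|x|$ and $n$ is the unit normal to the coordinate spheres. * They are uniformly asymptotically flat: for $|x|>\rho_0$, $|\partial^\beta(g_{ab}-\delta_{ab})|\le C_0|x|^{-(n-2+|\beta|)}$ for $|\beta|\le2$, $|\partial^\beta k_{ab}|\le C_0|x|^{-(n-1+|\beta|)}$ for $|\beta|\le1$, $|R_g|\le C_0|x|^{-(n+1)}$ and $|\mathrm{Tr}_gk|\le C_0|x|^{-n}$. * They satisfy the dominant energy condition $\mu\ge|J|_g$, where $16\pi\mu=R_g+(\mathrm{Tr}_gk)^2-|k|_g^2$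 and $8\pi J=\mathrm{div}_g(k-(\mathrm{Tr}_gk)g)$. * No sphere $|x|=r$ in the interior of $M_j$ is an apparent horizon ($\theta_+=0$ or $\theta_-=0$, where $\theta_\pm=H\pm\mathrm{Tr}_\Sigma k$), and the boundary, if nonempty, is an apparent horizon. Let $m_j=\sqrt{E_j^2-|P_j|^2}$ be the ADM masses. Let $f_j$ be a smooth spherically symmetric solution, on the interior of $M_j$, of the Jang equation $$\Big(g^{ab}-\frac{f^af^b}{1+|\nabla f|_g^2}\Big)\Big(\frac{\nabla_{ab}f}{\sqrt{1+|\nabla f|_g^2}}-k_{ab}\Big)=0$$ with $f_j\to0$ at infinity and, if $\partial M_j\ne\emptyset$, with $f_j\to+\infty$ at $\partial M_j$ and $\theta_+=0$ there, or $f_j\to-\infty$ at $\partial M_j$ and $\theta_-=0$ there. Let $\bar g_j=g_j+df_j^2$ be the Jang metric, and let $u_j>0$ be a smooth spherically symmetric solution, on the interior of $M_j$, of $$\Delta_{\bar g_j}u_j-\tfrac{n-2}{4(n-1)}R_{\bar g_j}u_j=0,\qquad u_j=1+\frac{\alpha_j}{|x|^{n-2}}+O_2\big(|x|^{1-n}\big)\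 \text{ as }|x|\to\infty,$$ with $u_j\to0$ at $\partial M_j$ (along the cylindrical end of $\bar g_j$) if $\partial M_j\neq\emptyset$. Then, for each $j$, the interior of $M_j$ with the metric $\tilde g_j=u_j^{4/(n-2)}\bar g_j$ is isometric to Euclidean space $\mathbb R^n$ if $\partial M_j=\emptyset$ (with the centre of symmetry going to the origin), and to $\mathbb R^n\setminus\{0\}$ otherwise. Under suitable such isometries, through which $u_j$ is regarded as a function on $\mathbb R^n$ or $\mathbb R^n\setminus\{0\}$, the following hold. 1. For every $\tilde A_0>0$ and every $j$ with $m_j<\delta$ and $m_j<\tilde A_0^{-2}$, $$\|\log u_j\|_{C^{0,\frac12}(\Omega_{\tilde A_0,\tilde A_j},\,g_{\mathbb E})}\le\frac{C\,m_j^{1/4}}{\sqrt{\tilde A_0}},\qquad \tilde A_j=\frac1{\sqrt{m_j}},$$ where $\Omega_{A,A'}$ is the closed Euclidean annulus bounded by the origin-centred spheres of areas $A<A'$ (all of the exterior of the inner sphere if $A'=\infty$, that is, if $m_j=0$), and the $C^{0,1/2}$ norm is the supremum norm plus the Hölder seminorm of exponent $\tfrac12$. 2. If $m_j\to0$, then for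 every $\tilde A_0>0$ the functions $u_j$ tend to $1$ uniformly on $\{y\in\mathbb R^n:\omega_{n-1}|y|^{n-1}\ge\tilde A_0\}$. -/

import Mathlib

open scoped ContDiff ENNReal NNReal Topology
open Filter MeasureTheory Set

namespace SphericalData

noncomputable section

/-- Euclidean space `ℝⁿ`; all manifolds below are given in one global chart, a subset of `ℝⁿ`. -/
abbrev E (n : ℕ) := EuclideanSpace ℝ (Fin n)

/-- A field of `n × n` matrices: the components of a 2-tensor in the Cartesian chart. -/
abbrev TensorField (n : ℕ) := E n → Matrix (Fin n) (Fin n) ℝ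

variable {n : ℕ}

/-! ### Tensor calculus in the Cartesian chart -/

/-- The coordinate partial derivative `∂ᵢ F`. -/
def pd (i : Fin n) (F : E n → ℝ) (x : E n) : ℝ :=
  fderiv ℝ F x (EuclideanSpace.single i 1)

/-- The iterated partial derivative `∂^β F`, where `β` lists the indices to differentiate in. -/
def iterPd (β : List (Fin n)) (F : E n → ℝ) : E n → ℝ :=
  β.foldr pd F

/-- Christoffel symbol `Γˡᵢⱼ` of the metric `g`. -/
def christoffel (g : TensorField n) (l i j : Fin n) (x : E n) : ℝ :=
  (1 / 2) * ∑ a, (g x)⁻¹ l a *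
    (pd i (fun y => g y a j) x + pd j (fun y => g y a i) x - pd a (fun y => g y i j) x)

/-- Ricci curvature `Rᵢⱼ`. -/
def ricci (g : TensorField n) (i j : Fin n) (x : E n) : ℝ :=
  ∑ l, (pd l (christoffel g l i j) x - pd j (christoffel g l i l) x
    + ∑ a, (christoffel g l l a x * christoffel g a i j x
      - christoffel g l j a x * christoffel g a i l x))

/-- Scalar curvature `R_g`. -/
def scalarCurvature (g : TensorField n) (x : E n) : ℝ :=
  ∑ i, ∑ j, (g x)⁻¹ i j * ricci g i j x

/-- Covariant Hessian `∇ᵢⱼ f`. -/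
def hessian (g : TensorField n) (f : E n → ℝ) (i j : Fin n) (x : E n) : ℝ :=
  pd i (pd j f) x - ∑ l, christoffel g l i j x * pd l f x

/-- Laplace–Beltrami operator `Δ_g f`. -/
def laplacian (g : TensorField n) (f : E n → ℝ) (x : E n) : ℝ :=
  ∑ i, ∑ j, (g x)⁻¹ i j * hessian g f i j x

/-- The gradient vector `fᵃ = gᵃᵇ ∂_b f`. -/
def gradient (g : TensorField n) (f : E n → ℝ) (a : Fin n) (x : E n) : ℝ :=
  ∑ b, (g x)⁻¹ a b * pd b f x

/-- `|∇f|²_g`. -/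
def gradNormSq (g : TensorField n) (f : E n → ℝ) (x : E n) : ℝ :=
  ∑ a, gradient g f a x * pd a f x

/-- The trace `Tr_g k`. -/
def trace (g k : TensorField n) (x : E n) : ℝ :=
  ∑ i, ∑ j, (g x)⁻¹ i j * k x i j

/-- `|k|²_g`. -/
def normSq (g k : TensorField n) (x : E n) : ℝ :=
  ∑ i, ∑ j, ∑ a, ∑ b, (g x)⁻¹ i a * (g x)⁻¹ j b * k x i j * k x a b

/-- The divergence `∇_i Xⁱ` of a vector field. -/
def divVector (g : TensorField n) (X : Fin n → E n → ℝ) (x : E n) : ℝ :=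
  ∑ i, (pd i (X i) x + ∑ a, christoffel g i i a x * X a x)

/-- The divergence `gⁱˡ ∇_l Tᵢⱼ` of a symmetric 2-tensor. -/
def divTensor (g T : TensorField n) (j : Fin n) (x : E n) : ℝ :=
  ∑ i, ∑ l, (g x)⁻¹ i l * (pd l (fun y => T y i j) x
    - ∑ a, christoffel g a l i x * T x a j - ∑ a, christoffel g a l j x * T x i a)

/-! ### The constraint equations and null expansions -/

/-- Energy density `μ`, from `16πμ = R_g + (Tr_g k)² - |k|²_g`. -/
def energyDensity (g k : TensorField n) (x : E n) : ℝ :=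
  (scalarCurvature g x + trace g k x ^ 2 - normSq g k x) / (16 * Real.pi)

/-- Momentum density `J`, from `8πJ = div_g (k - (Tr_g k) g)`. -/
def momentumDensity (g k : TensorField n) (j : Fin n) (x : E n) : ℝ :=
  divTensor g (fun y => k y - trace g k y • g y) j x / (8 * Real.pi)

/-- `|J|_g`. -/
def momentumNorm (g k : TensorField n) (x : E n) : ℝ :=
  Real.sqrt (∑ i, ∑ j, (g x)⁻¹ i j * momentumDensity g k i x * momentumDensity g k j x)

/-- The `g`-unit normal of the coordinate spheres that points to infinity: `∇r / |∇r|_g`,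
`r = ‖x‖`. -/
def sphereNormal (g : TensorField n) (i : Fin n) (x : E n) : ℝ :=
  gradient g (fun y => ‖y‖) i x / Real.sqrt (gradNormSq g (fun y => ‖y‖) x)

/-- Mean curvature of the coordinate sphere through `x` (the divergence of its unit normal). -/
def sphereMeanCurvature (g : TensorField n) (x : E n) : ℝ :=
  divVector g (sphereNormal g) x

/-- `Tr_Σ k` for the coordinate sphere `Σ` through `x`. -/
def sphereTrace (g k : TensorField n) (x : E n) : ℝ :=
  ∑ i, ∑ j, ((g x)⁻¹ i j - sphereNormal g i x * sphereNormal g j x) * k x i j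

/-- Null expansion `θ₊ = H + Tr_Σ k` of the coordinate sphere through `x`. -/
def thetaPlus (g k : TensorField n) (x : E n) : ℝ :=
  sphereMeanCurvature g x + sphereTrace g k x

/-- Null expansion `θ₋ = H - Tr_Σ k` of the coordinate sphere through `x`. -/
def thetaMinus (g k : TensorField n) (x : E n) : ℝ :=
  sphereMeanCurvature g x - sphereTrace g k x

/-! ### Initial data sets -/

/-- The manifold `ℝⁿ` without the open ball of radius `r₀`; this is `ℝⁿ` itself if `r₀ = 0`. -/
def region (n : ℕ) (r₀ : ℝ) : Set (E n) := {x | r₀ ≤ ‖x‖}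

/-- An initial data set on `ℝⁿ` (`r₀ = 0`) or on the complement of a ball (`r₀ > 0`). Smoothness up
to the boundary means that the components are the restrictions of functions that are smooth near
each point of the manifold. -/
structure InitialData (n : ℕ) where
  r₀ : ℝ
  r₀_nonneg : 0 ≤ r₀
  g : TensorField n
  k : TensorField n
  g_smooth : ∀ x ∈ region n r₀, ∀ i j, ContDiffAt ℝ ∞ (fun y => g y i j) x
  k_smooth : ∀ x ∈ region n r₀, ∀ i j, ContDiffAt ℝ ∞ (fun y => k y i j) x
  g_posDef : ∀ x ∈ region n r₀, (g x).PosDef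
  k_symm : ∀ x ∈ region n r₀, (k x).IsSymm

namespace InitialData

/-- The manifold with boundary `M`. -/
def M (D : InitialData n) : Set (E n) := region n D.r₀

/-- `g = g₁₁(r) dr² + ρ(r)² g_{S^{n-1}}` and `kᵢⱼ = nᵢ nⱼ k_n(r) + (gᵢⱼ - nᵢ nⱼ) k_t(r)`, where
`dr = ∑ (xᵢ/r) dxᵢ`, `g_{S^{n-1}} = r⁻² (∑ dxᵢ² - dr²)` and `nᵢ = √g₁₁ xᵢ/r`. -/
def SphericallySymmetric (D : InitialData n) : Prop :=
  ∃ g₁₁ ρ kn kt : ℝ → ℝ, ∀ x ∈ D.M, x ≠ 0 → ∀ i j,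
    D.g x i j = g₁₁ ‖x‖ * (x i / ‖x‖) * (x j / ‖x‖)
      + ρ ‖x‖ ^ 2 * (((1 : Matrix (Fin n) (Fin n) ℝ) i j - (x i / ‖x‖) * (x j / ‖x‖)) / ‖x‖ ^ 2) ∧
    D.k x i j =
      (Real.sqrt (g₁₁ ‖x‖) * (x i / ‖x‖)) * (Real.sqrt (g₁₁ ‖x‖) * (x j / ‖x‖)) * kn ‖x‖
      + (D.g x i j - (Real.sqrt (g₁₁ ‖x‖) * (x i / ‖x‖)) * (Real.sqrt (g₁₁ ‖x‖) * (x j / ‖x‖)))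
        * kt ‖x‖

/-- Asymptotic flatness with constants `ρ₀` and `C`. -/
structure AsymptoticallyFlatWith (D : InitialData n) (ρ₀ C : ℝ) : Prop where
  r₀_le : D.r₀ ≤ ρ₀
  metric_decay : ∀ x : E n, ρ₀ < ‖x‖ → ∀ i j, ∀ β : List (Fin n), β.length ≤ 2 →
    |iterPd β (fun y => D.g y i j - (1 : Matrix (Fin n) (Fin n) ℝ) i j) x|
      ≤ C / ‖x‖ ^ (n - 2 + β.length)
  k_decay : ∀ x : E n, ρ₀ < ‖x‖ → ∀ i j, ∀ β : List (Fin n), β.length ≤ 1 →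
    |iterPd β (fun y => D.k y i j) x| ≤ C / ‖x‖ ^ (n - 1 + β.length)
  scalar_decay : ∀ x : E n, ρ₀ < ‖x‖ → |scalarCurvature D.g x| ≤ C / ‖x‖ ^ (n + 1)
  trace_decay : ∀ x : E n, ρ₀ < ‖x‖ → |trace D.g D.k x| ≤ C / ‖x‖ ^ n

/-- The dominant energy condition `μ ≥ |J|_g`. -/
def DominantEnergy (D : InitialData n) : Prop :=
  ∀ x ∈ D.M, momentumNorm D.g D.k x ≤ energyDensity D.g D.k x

/-- The coordinate sphere of radius `r` is a future apparent horizon. -/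
def FutureHorizon (D : InitialData n) (r : ℝ) : Prop :=
  ∀ x : E n, ‖x‖ = r → thetaPlus D.g D.k x = 0

/-- The coordinate sphere of radius `r` is a past apparent horizon. -/
def PastHorizon (D : InitialData n) (r : ℝ) : Prop :=
  ∀ x : E n, ‖x‖ = r → thetaMinus D.g D.k x = 0

/-- Either there is no boundary and no symmetry sphere is an apparent horizon, or the boundary is an
apparent horizon and no symmetry sphere outside it is one. -/
def NoHorizonOrOutermostBoundary (D : InitialData n) : Prop :=
  (0 < D.r₀ → D.FutureHorizon D.r₀ ∨ D.PastHorizon D.r₀) ∧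
    ∀ r, D.r₀ < r → ¬ D.FutureHorizon r ∧ ¬ D.PastHorizon r

end InitialData

/-! ### ADM mass -/

/-- The volume `ω_{n-1}` of the unit sphere of `ℝⁿ`. -/
def unitSphereVolume (n : ℕ) : ℝ := (volume : Measure (E n)).toSphere.real univ

/-- The integral of `F` over the coordinate sphere of radius `r`. -/
def sphereIntegral (F : E n → ℝ) (r : ℝ) : ℝ :=
  r ^ (n - 1) * ∫ θ : Metric.sphere (0 : E n) 1, F (r • (θ : E n)) ∂(volume : Measure (E n)).toSphere

/-- The flux whose limit is the ADM energy. -/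
def energyFlux (g : TensorField n) (r : ℝ) : ℝ :=
  1 / (2 * ((n : ℝ) - 1) * unitSphereVolume n) * sphereIntegral (fun x =>
    ∑ i, ∑ j, (pd i (fun y => g y i j) x - pd j (fun y => g y i i) x) * (x j / ‖x‖)) r

/-- The flux whose limit is the `i`-th component of the ADM linear momentum. -/
def momentumFlux (g k : TensorField n) (i : Fin n) (r : ℝ) : ℝ :=
  1 / (2 * ((n : ℝ) - 1) * unitSphereVolume n) * sphereIntegral (fun x =>
    ∑ j, (k x i j - trace g k x * g x i j) * (x j / ‖x‖)) r

/-- `m` is the ADM mass `√(E² - |P|²)`. -/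
def InitialData.HasADMMass (D : InitialData n) (m : ℝ) : Prop :=
  ∃ (energy : ℝ) (P : Fin n → ℝ), Tendsto (energyFlux D.g) atTop (𝓝 energy) ∧
    (∀ i, Tendsto (momentumFlux D.g D.k i) atTop (𝓝 (P i))) ∧
    m = Real.sqrt (energy ^ 2 - ∑ i, P i ^ 2)

/-! ### The Jang deformation and its conformal transformation -/

/-- `x` tends to the sphere of radius `r₀` from outside. -/
def toBoundary (n : ℕ) (r₀ : ℝ) : Filter (E n) := comap (fun x => ‖x‖) (𝓝[>] r₀)

/-- `F` depends on `‖x‖` only, on the set `s`. -/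
def RadialOn (F : E n → ℝ) (s : Set (E n)) : Prop :=
  ∀ x ∈ s, ∀ y ∈ s, ‖x‖ = ‖y‖ → F x = F y

/-- The left-hand side of the Jang equation. -/
def jangOperator (g k : TensorField n) (f : E n → ℝ) (x : E n) : ℝ :=
  ∑ a, ∑ b, ((g x)⁻¹ a b - gradient g f a x * gradient g f b x / (1 + gradNormSq g f x)) *
    (hessian g f a b x / Real.sqrt (1 + gradNormSq g f x) - k x a b)

/-- The spherically symmetric solution of the Jang equation that vanishes at infinity and, if there
is a boundary, blows up there: to `+∞` at a future and to `-∞` at a past horizon. -/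
structure IsJangSolution (D : InitialData n) (f : E n → ℝ) : Prop where
  smooth : ContDiffOn ℝ ∞ f (interior D.M)
  radial : RadialOn f (interior D.M)
  jang : ∀ x ∈ interior D.M, jangOperator D.g D.k f x = 0
  atInfinity : Tendsto f (Bornology.cobounded (E n)) (𝓝 0)
  blowUp : 0 < D.r₀ →
    (D.FutureHorizon D.r₀ ∧ Tendsto f (toBoundary n D.r₀) atTop) ∨
    (D.PastHorizon D.r₀ ∧ Tendsto f (toBoundary n D.r₀) atBot)

/-- The Jang metric `ḡ = g + df²`. -/
def jangMetric (g : TensorField n) (f : E n → ℝ) : TensorField n :=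
  fun x => g x + Matrix.of fun i j => pd i f x * pd j f x

/-- The conformal factor: the positive spherically symmetric solution of
`Δ_ḡ u - c_n R_ḡ u = 0`, `c_n = (n-2)/(4(n-1))`, with `u = 1 + α |x|^{2-n} + O₂(|x|^{1-n})` at
infinity, and `u → 0` along the cylindrical end over the boundary, if there is one. -/
structure IsConformalFactor (D : InitialData n) (f u : E n → ℝ) : Prop where
  smooth : ContDiffOn ℝ ∞ u (interior D.M)
  radial : RadialOn u (interior D.M)
  pos : ∀ x ∈ interior D.M, 0 < u x
  equation : ∀ x ∈ interior D.M, laplacian (jangMetric D.g f) u x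
    - ((n : ℝ) - 2) / (4 * ((n : ℝ) - 1)) * scalarCurvature (jangMetric D.g f) x * u x = 0
  atInfinity : ∃ α C R : ℝ, ∀ x : E n, R < ‖x‖ → ∀ β : List (Fin n), β.length ≤ 2 →
    |iterPd β (fun y => u y - (1 + α / ‖y‖ ^ (n - 2))) x| ≤ C / ‖x‖ ^ (n - 1 + β.length)
  atBoundary : 0 < D.r₀ → Tendsto u (toBoundary n D.r₀) (𝓝 0)

/-- The conformal metric `g̃ = u^{4/(n-2)} ḡ`. -/
def conformalMetric (g : TensorField n) (f u : E n → ℝ) : TensorField n :=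
  fun x => (u x ^ (4 / ((n : ℝ) - 2))) • jangMetric g f x

/-- `Φ` is a Riemannian isometry of `(M̃, g̃)` onto Euclidean space which takes the centre of symmetry
to the origin. If there is a boundary, `M̃` is the interior of `M` and the cylindrical end is closed
by one point, the centre, so that `Φ` maps onto the complement of the origin. -/
structure IsEuclideanIsometry (D : InitialData n) (f u : E n → ℝ)
    (Φ : OpenPartialHomeomorph (E n) (E n)) : Prop where
  source_eq : Φ.source = interior D.M
  target_eq : Φ.target = if D.r₀ = 0 then univ else {0}ᶜ
  centre : D.r₀ = 0 → Φ 0 = 0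
  contDiff : ContDiffOn ℝ 1 Φ Φ.source
  contDiff_symm : ContDiffOn ℝ 1 Φ.symm Φ.target
  pullback : ∀ x ∈ Φ.source, ∀ i j,
    inner ℝ (fderiv ℝ Φ x (EuclideanSpace.single i 1)) (fderiv ℝ Φ x (EuclideanSpace.single j 1))
      = conformalMetric D.g f u x i j

/-! ### Annuli and Hölder norms in Euclidean space -/

/-- The area of the origin-centred sphere through `y`. -/
def sphereArea (y : E n) : ℝ := unitSphereVolume n * ‖y‖ ^ (n - 1)

/-- The closed annulus between the origin-centred spheres of area `A₀` and `A₁` (`A₁ = ∞` is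
allowed). -/
def annulus (n : ℕ) (A₀ : ℝ) (A₁ : ℝ≥0∞) : Set (E n) :=
  {y | A₀ ≤ sphereArea y ∧ ENNReal.ofReal (sphereArea y) ≤ A₁}

/-- The norm of `C^{0,1/2}(Ω)`: the sup norm plus the Hölder seminorm. -/
def holderHalfNorm (w : E n → ℝ) (Ω : Set (E n)) : ℝ≥0∞ :=
  (⨆ y : Ω, ‖w y‖ₑ) + eHolderNorm (1 / 2 : ℝ≥0) (Ω.domRestrict w)

end

end SphericalData

open SphericalData

namespace SphericalData

noncomputable section

variable {n : ℕ}

local notation "δ" => (1 : Matrix (Fin n) (Fin n) ℝ)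

/-! ### Calculus of radial functions -/

/-! Everything reduces to ordinary differential equations in `r`. Write `A² dr² + ρ² g_S` for the
metric, `B = √(A² + F'²)` for the radial coefficient of the Jang metric, `σ = u^{2/(n-2)} ρ` for the
area radius of the conformal metric, and `τ` for the derivative of `σ` in conformal arc length.

Flatness. The equation for `u` says that the conformal metric is scalar flat, so `σ^{n-2} (1 - τ²)`,
twice a Schwarzschild mass, is a constant `c` (`exists_const`). Since `σ → 0` at the inner end, `c ≤
0`. At a regular centre `τ` is bounded, whence `c = 0`. Over a horizon, `c < 0` would force
`σ^{(n-2)/2}` to increase at a rate at least `κ B ≥ κ |F'|`, which is impossible because `F` is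
unbounded there (`const_nonneg_of_blowUp`). So `τ² = 1`, and `τ = 1` because `σ → ∞`
(`JangSystem.areaSlope_eq_one`). Hence `x ↦ (σ/r) x` is an isometry onto Euclidean space, punctured
if there is a boundary (`exists_isEuclideanIsometry`).

Mass. Let `X = ρ'/B`, and let `h_t` be the tangential second fundamental form of the Jang graph. The
corrected slope `G = X + (F'/A) ρ (h_t - k_t)` absorbs the divergence term of the Schoen–Yau
identity. The Jang equation and the dominant energy condition give `ρ G'/B ≤ (n-2)/2 (1 - G²) - n/2
(G - X)²` (`exists_boostedSlope_deriv`). With `τ = 1` the quasilocal mass `Z = σ^{n-2} (1 - G)` then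
satisfies `Z' ≥ σ^{n-2} (B/ρ) ((n-2)/2 (1 - G)² + n/2 (G - X)²)`. The first square is a Riccati
inequality, which together with `σ → 0` excludes negative values of `Z` (`DecayProfile.Z_nonneg`).
At infinity `Z` tends to the ADM energy (`tendsto_jangMass`), and the momentum vanishes by oddness,
so `0 ≤ Z ≤ m`.

Estimates. The relation `τ = 1` also reads `(log u)' = (n-2)/2 (B/ρ) (1 - X)`, and `(1 - X)² ≤ 2 (1
- G)² + 2 (G - X)²`. Both squares are paid for by `Z'`, so the weighted Dirichlet energy `∫ (d log
u/dσ)² σ^{n-1} dσ` is at most `(n-2)² m`. Cauchy–Schwarz on a bounded range of `σ` gives the Hölder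
bound (`DecayProfile.sq_sub_le`); up to infinity, where `log u → 0`, it gives pointwise decay
(`DecayProfile.sq_le`). On the annulus, the outer area `1/√m` and `m < 1` turn these into bounds
with `m^{1/4}/√A₀`. -/

lemma pd_congr {F G : E n → ℝ} {x : E n} (h : F =ᶠ[𝓝 x] G) (i : Fin n) : pd i F x = pd i G x := by
  unfold pd; rw [h.fderiv_eq]

lemma pd_eq_of_hasFDerivAt {F : E n → ℝ} {L : E n →L[ℝ] ℝ} {x : E n} (h : HasFDerivAt F L x)
    (i : Fin n) : pd i F x = L (EuclideanSpace.single i 1) := by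
  unfold pd; rw [h.fderiv]

lemma pd_const (c : ℝ) (i : Fin n) (x : E n) : pd i (fun _ => c) x = 0 := by
  simp [pd]

lemma pd_add {F G : E n → ℝ} {x : E n} (hF : DifferentiableAt ℝ F x) (hG : DifferentiableAt ℝ G x)
    (i : Fin n) : pd i (fun y => F y + G y) x = pd i F x + pd i G x := by
  unfold pd; rw [fderiv_fun_add hF hG]; rfl

lemma pd_mul {F G : E n → ℝ} {x : E n} (hF : DifferentiableAt ℝ F x) (hG : DifferentiableAt ℝ G x)
    (i : Fin n) : pd i (fun y => F y * G y) x = F x * pd i G x + G x * pd i F x := by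
  unfold pd; rw [fderiv_fun_mul hF hG]; rfl

lemma differentiableAt_coord (i : Fin n) (x : E n) : DifferentiableAt ℝ (fun y : E n => y i) x :=
  (EuclideanSpace.proj (𝕜 := ℝ) i).differentiableAt

lemma pd_coord (i j : Fin n) (x : E n) :
    pd i (fun y => y j) x = δ i j := by
  have h : HasFDerivAt (fun y : E n => y j) (EuclideanSpace.proj (𝕜 := ℝ) j) x :=
    (EuclideanSpace.proj (𝕜 := ℝ) j).hasFDerivAt
  rw [pd_eq_of_hasFDerivAt h i]
  simp [Matrix.one_apply, eq_comm]

lemma hasFDerivAt_radial {φ : ℝ → ℝ} {φ' : ℝ} {x : E n} (hx : x ≠ 0) (h : HasDerivAt φ φ' ‖x‖) :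
    HasFDerivAt (fun y : E n => φ ‖y‖) ((φ' / ‖x‖) • innerSL ℝ x) x := by
  have hr : ‖x‖ ≠ 0 := norm_ne_zero_iff.2 hx
  have h1 : HasFDerivAt (fun y : E n => ‖y‖ ^ 2) (2 • innerSL ℝ x) x :=
    (hasStrictFDerivAt_norm_sq x).hasFDerivAt
  have h2 : HasFDerivAt (fun y : E n => ‖y‖) ((1 / ‖x‖) • innerSL ℝ x) x := by
    have := h1.sqrt (by positivity)
    simp only [Real.sqrt_sq (norm_nonneg _)] at this
    refine this.congr_fderiv ?_
    ext v
    simp only [smul_apply, innerSL_apply_apply, smul_eq_mul, nsmul_eq_mul]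
    push_cast
    field_simp
  refine (h.comp_hasFDerivAt x h2).congr_fderiv ?_
  rw [smul_smul]; congr 1; ring

lemma pd_radial {φ : ℝ → ℝ} {φ' : ℝ} {x : E n} (hx : x ≠ 0) (h : HasDerivAt φ φ' ‖x‖) (i : Fin n) :
    pd i (fun y => φ ‖y‖) x = φ' / ‖x‖ * x i := by
  rw [pd_eq_of_hasFDerivAt (hasFDerivAt_radial hx h)]
  simp [EuclideanSpace.inner_single_right]

lemma pd_radial_mul {φ : ℝ → ℝ} {φ' : ℝ} {x : E n} (hx : x ≠ 0) (h : HasDerivAt φ φ' ‖x‖)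
    {G : E n → ℝ} (hG : DifferentiableAt ℝ G x) (i : Fin n) :
    pd i (fun y => φ ‖y‖ * G y) x = φ' / ‖x‖ * x i * G x + φ ‖x‖ * pd i G x := by
  rw [pd_mul (hasFDerivAt_radial hx h).differentiableAt hG, pd_radial hx h]; ring

lemma sum_sq_coord (x : E n) : ∑ i, x i * x i = ‖x‖ ^ 2 := by
  rw [EuclideanSpace.norm_sq_eq]; simp [sq]

/-! ### Inverse and Christoffel symbols of a radial metric. -/

/-- `g` is the metric `A(r)² dr² + ρ(r)² g_{S^{n-1}}` on `{‖x‖ > r₀}`. -/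
structure IsRadialMetric (g : TensorField n) (r₀ : ℝ) (A ρ : ℝ → ℝ) : Prop where
  nonneg : 0 ≤ r₀
  A_pos : ∀ r, r₀ < r → 0 < A r
  ρ_pos : ∀ r, r₀ < r → 0 < ρ r
  A_smooth : ContDiffOn ℝ ∞ A (Ioi r₀)
  ρ_smooth : ContDiffOn ℝ ∞ ρ (Ioi r₀)
  eq : ∀ x : E n, r₀ < ‖x‖ → ∀ i j, g x i j =
    (ρ ‖x‖ / ‖x‖) ^ 2 * δ i j
      + (A ‖x‖ ^ 2 - (ρ ‖x‖ / ‖x‖) ^ 2) / ‖x‖ ^ 2 * (x i * x j)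

lemma ContDiffOn.hasDerivAt_Ioi {φ : ℝ → ℝ} {r₀ r : ℝ} (h : ContDiffOn ℝ ∞ φ (Ioi r₀)) (hr : r₀ < r) :
    HasDerivAt φ (deriv φ r) r :=
  ((h.contDiffAt (Ioi_mem_nhds hr)).differentiableAt (by simp)).hasDerivAt

lemma ContDiffOn.deriv_Ioi {φ : ℝ → ℝ} {r₀ : ℝ} (h : ContDiffOn ℝ ∞ φ (Ioi r₀)) :
    ContDiffOn ℝ ∞ (deriv φ) (Ioi r₀) :=
  ((contDiffOn_infty_iff_deriv_of_isOpen isOpen_Ioi).1 h).2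

lemma eventually_lt_norm {r₀ : ℝ} {x : E n} (h : r₀ < ‖x‖) : ∀ᶠ y in 𝓝 x, r₀ < ‖y‖ :=
  continuous_norm.continuousAt.eventually (Ioi_mem_nhds h)

namespace IsRadialMetric

variable {g : TensorField n} {r₀ : ℝ} {A ρ : ℝ → ℝ}

lemma norm_pos (h : IsRadialMetric g r₀ A ρ) {x : E n} (hx : r₀ < ‖x‖) : 0 < ‖x‖ :=
  h.nonneg.trans_lt hx

/-- The metric has eigenvalue `(ρ/r)²` orthogonally to `x` and `A²` along `x`; inverting both
eigenvalues gives a matrix of the same shape. -/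
lemma inv_eq (h : IsRadialMetric g r₀ A ρ) {x : E n} (hx : r₀ < ‖x‖) (i j : Fin n) :
    (g x)⁻¹ i j = (‖x‖ / ρ ‖x‖) ^ 2 * δ i j
      + (1 / A ‖x‖ ^ 2 - (‖x‖ / ρ ‖x‖) ^ 2) / ‖x‖ ^ 2 * (x i * x j) := by
  have hA := (h.A_pos _ hx).ne'
  have hρ := (h.ρ_pos _ hx).ne'
  have hr := (h.norm_pos hx).ne'
  set N : Matrix (Fin n) (Fin n) ℝ := Matrix.of fun i j =>
    (‖x‖ / ρ ‖x‖) ^ 2 * δ i j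
      + (1 / A ‖x‖ ^ 2 - (‖x‖ / ρ ‖x‖) ^ 2) / ‖x‖ ^ 2 * (x i * x j) with hN
  have : (g x)⁻¹ = N := by
    apply Matrix.inv_eq_right_inv
    ext a b
    have hs := sum_sq_coord x
    have e : ∀ c, g x a c * N c b =
        (ρ ‖x‖ / ‖x‖) ^ 2 * (‖x‖ / ρ ‖x‖) ^ 2 * (δ a c
          * δ c b)
        + (ρ ‖x‖ / ‖x‖) ^ 2 * ((1 / A ‖x‖ ^ 2 - (‖x‖ / ρ ‖x‖) ^ 2) / ‖x‖ ^ 2) * x b *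
          (δ a c * x c)
        + (A ‖x‖ ^ 2 - (ρ ‖x‖ / ‖x‖) ^ 2) / ‖x‖ ^ 2 * (‖x‖ / ρ ‖x‖) ^ 2 * x a *
          (x c * δ c b)
        + (A ‖x‖ ^ 2 - (ρ ‖x‖ / ‖x‖) ^ 2) / ‖x‖ ^ 2
          * ((1 / A ‖x‖ ^ 2 - (‖x‖ / ρ ‖x‖) ^ 2) / ‖x‖ ^ 2) * x a * x b * (x c * x c) := by
      intro c
      rw [h.eq x hx, hN, Matrix.of_apply]; ring
    simp only [Matrix.mul_apply, e, Finset.sum_add_distrib, ← Finset.mul_sum, hs]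
    simp only [Matrix.one_apply, ite_mul, mul_ite, one_mul, mul_one, zero_mul, mul_zero,
      Finset.sum_ite_eq, Finset.sum_ite_eq', Finset.mem_univ, if_true]
    split_ifs <;> field_simp <;> ring
  rw [this, hN, Matrix.of_apply]

/-- The coefficient `P` of the Christoffel symbols
`P (xᵢ δₗⱼ + xⱼ δₗᵢ) + Q xₗ δᵢⱼ + S xᵢ xⱼ xₗ`. -/
def _root_.SphericalData.chrP (ρ : ℝ → ℝ) (r : ℝ) : ℝ := deriv ρ r / (ρ r * r) - 1 / r ^ 2

/-- The coefficient `Q` of the Christoffel symbols. -/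
def _root_.SphericalData.chrQ (A ρ : ℝ → ℝ) (r : ℝ) : ℝ :=
  1 / r ^ 2 - ρ r * deriv ρ r / (A r ^ 2 * r ^ 3)

/-- The coefficient `S` of the Christoffel symbols. -/
def _root_.SphericalData.chrS (A ρ : ℝ → ℝ) (r : ℝ) : ℝ :=
  (deriv A r / (A r * r) - 2 * chrP ρ r - chrQ A ρ r) / r ^ 2

lemma pd_metric (h : IsRadialMetric g r₀ A ρ) {x : E n} (hx : r₀ < ‖x‖) (k i j : Fin n) :
    pd k (fun y => g y i j) x =
      2 * (ρ ‖x‖ / ‖x‖) ^ 2 * chrP ρ ‖x‖ * x k * δ i j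
      + (2 * A ‖x‖ * deriv A ‖x‖ / ‖x‖ ^ 3 - 2 * A ‖x‖ ^ 2 / ‖x‖ ^ 4
          - 2 * ρ ‖x‖ * deriv ρ ‖x‖ / ‖x‖ ^ 5 + 4 * ρ ‖x‖ ^ 2 / ‖x‖ ^ 6) * (x k * x i * x j)
      + (A ‖x‖ ^ 2 - (ρ ‖x‖ / ‖x‖) ^ 2) / ‖x‖ ^ 2 *
        (δ k i * x j + δ k j * x i) := by
  have hr := (h.norm_pos hx).ne'
  have hρ := (h.ρ_pos _ hx).ne'
  have hx0 : x ≠ 0 := norm_ne_zero_iff.1 hr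
  have dA := ContDiffOn.hasDerivAt_Ioi h.A_smooth hx
  have dρ := ContDiffOn.hasDerivAt_Ioi h.ρ_smooth hx
  have d1 : HasDerivAt (fun r => (ρ r / r) ^ 2) (2 * (ρ ‖x‖ / ‖x‖) ^ 2 * chrP ρ ‖x‖ * ‖x‖) ‖x‖ := by
    refine ((dρ.fun_div (hasDerivAt_id' _) hr).fun_pow 2).congr_deriv ?_
    simp only [chrP]; norm_num; field_simp
  have d2 : HasDerivAt (fun r => (A r ^ 2 - (ρ r / r) ^ 2) / r ^ 2)
      ((2 * A ‖x‖ * deriv A ‖x‖ / ‖x‖ ^ 3 - 2 * A ‖x‖ ^ 2 / ‖x‖ ^ 4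
          - 2 * ρ ‖x‖ * deriv ρ ‖x‖ / ‖x‖ ^ 5 + 4 * ρ ‖x‖ ^ 2 / ‖x‖ ^ 6) * ‖x‖) ‖x‖ := by
    refine (((dA.fun_pow 2).fun_sub d1).fun_div ((hasDerivAt_id' _).fun_pow 2)
      (pow_ne_zero 2 hr)).congr_deriv ?_
    simp only [chrP]; field_simp; norm_num; ring
  have e : (fun y => g y i j) =ᶠ[𝓝 x] fun y => (ρ ‖y‖ / ‖y‖) ^ 2 * δ i j
      + (A ‖y‖ ^ 2 - (ρ ‖y‖ / ‖y‖) ^ 2) / ‖y‖ ^ 2 * (y i * y j) := by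
    filter_upwards [eventually_lt_norm hx] with y hy using h.eq y hy i j
  have hc := (differentiableAt_coord i x).fun_mul (differentiableAt_coord j x)
  rw [pd_congr e, pd_add ((hasFDerivAt_radial hx0 d1).differentiableAt.mul_const _)
    ((hasFDerivAt_radial hx0 d2).differentiableAt.fun_mul hc),
    pd_radial_mul hx0 d1 (differentiableAt_const _), pd_radial_mul hx0 d2 hc, pd_const,
    pd_mul (differentiableAt_coord i x) (differentiableAt_coord j x), pd_coord, pd_coord]
  field_simp
  ring

lemma christoffel_eq (h : IsRadialMetric g r₀ A ρ) {x : E n} (hx : r₀ < ‖x‖) (l i j : Fin n) :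
    christoffel g l i j x =
      chrP ρ ‖x‖ * (x i * δ l j
        + x j * δ l i)
      + chrQ A ρ ‖x‖ * (x l * δ i j)
      + chrS A ρ ‖x‖ * (x i * x j * x l) := by
  have hA := (h.A_pos _ hx).ne'
  have hρ := (h.ρ_pos _ hx).ne'
  have hr := (h.norm_pos hx).ne'
  have hs := sum_sq_coord x
  unfold christoffel
  simp only [h.pd_metric hx, h.inv_eq hx]
  set p := chrP ρ ‖x‖ with hp
  set c1 := 2 * (ρ ‖x‖ / ‖x‖) ^ 2 * p with hc1
  set c2 := (2 * A ‖x‖ * deriv A ‖x‖ / ‖x‖ ^ 3 - 2 * A ‖x‖ ^ 2 / ‖x‖ ^ 4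
          - 2 * ρ ‖x‖ * deriv ρ ‖x‖ / ‖x‖ ^ 5 + 4 * ρ ‖x‖ ^ 2 / ‖x‖ ^ 6) with hc2
  set c3 := (A ‖x‖ ^ 2 - (ρ ‖x‖ / ‖x‖) ^ 2) / ‖x‖ ^ 2 with hc3
  set e1 := (‖x‖ / ρ ‖x‖) ^ 2 with he1
  set e2 := (1 / A ‖x‖ ^ 2 - e1) / ‖x‖ ^ 2 with he2
  have hsym : ∀ a b, δ a b = δ b a := by
    intro a b; simp [Matrix.one_apply, eq_comm]
  -- The summand is sorted by its dependence on the summation index `a`, so that every sum is one of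
  -- `∑ δδ`, `∑ δx`, `∑ xx`. The curvature and divergence computations below use the same device.
  have e : ∀ a, (e1 * δ l a + e2 * (x l * x a)) *
      (c1 * x i * δ a j + c2 * (x i * x a * x j)
        + c3 * (δ i a * x j + δ i j * x a)
      + (c1 * x j * δ a i + c2 * (x j * x a * x i)
        + c3 * (δ j a * x i + δ j i * x a))
      - (c1 * x a * δ i j + c2 * (x a * x i * x j)
        + c3 * (δ a i * x j + δ a j * x i)))
      = (e1 * c1 * x i) * (δ l a * δ a j)
        + (e1 * c1 * x j) * (δ l a * δ a i)
        + (e1 * (c2 * x i * x j + (2 * c3 - c1) * δ i j))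
          * (δ l a * x a)
        + (e2 * c1 * x i * x l) * (x a * δ a j)
        + (e2 * c1 * x j * x l) * (x a * δ a i)
        + (e2 * (c2 * x i * x j + (2 * c3 - c1) * δ i j) * x l)
          * (x a * x a) := by
    intro a
    rw [hsym i a, hsym j a, hsym j i]; ring
  simp only [e, Finset.sum_add_distrib, ← Finset.mul_sum, hs]
  have s1 : ∀ b, ∑ a, δ l a * δ a b
      = δ l b := fun b => by rw [← Matrix.mul_apply, one_mul]
  have s2 : ∑ a, δ l a * x a = x l := by simp [Matrix.one_apply]
  have s3 : ∀ b, ∑ a, x a * δ a b = x b := fun b => by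
    simp [Matrix.one_apply]
  rw [s1, s1, s2, s3, s3]
  -- It remains to compare the coefficients of the three tensor shapes. The combination `e1 + e2 r²`
  -- is `1/A²`, the radial eigenvalue of the inverse metric.
  have t1 : e1 * c1 = 2 * p := by rw [he1, hc1]; field_simp
  have t2 : (e1 + e2 * ‖x‖ ^ 2) * (2 * c3 - c1) = 2 * chrQ A ρ ‖x‖ := by
    rw [he2, he1, hc3, hc1, hp, chrQ, chrP]; field_simp; ring
  have t3 : 2 * e2 * c1 + (e1 + e2 * ‖x‖ ^ 2) * c2 = 2 * chrS A ρ ‖x‖ := by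
    rw [he2, he1, hc2, hc1, hp, chrS, chrQ, chrP]; field_simp; ring
  linear_combination (1 / 2 * (x i * δ l j
        + x j * δ l i)) * t1
    + (1 / 2 * (x l * δ i j)) * t2 + (1 / 2 * (x i * x j * x l)) * t3

end IsRadialMetric

end

end SphericalData

namespace SphericalData

noncomputable section

variable {n : ℕ}

local notation "δ" => (1 : Matrix (Fin n) (Fin n) ℝ)

/-! ### Sums of Kronecker symbols and coordinates -/

lemma delta_comm (a b : Fin n) : δ a b = δ b a := by simp [Matrix.one_apply, eq_comm]

lemma sum_delta_mul (a : Fin n) (f : Fin n → ℝ) : ∑ l, δ l a * f l = f a := by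
  simp [Matrix.one_apply]

lemma sum_delta_self : ∑ l : Fin n, δ l l = n := by simp

lemma delta_self (l : Fin n) : δ l l = 1 := by simp

lemma sum_mul_radial (x : E n) (p q p' q' : ℝ) (i j : Fin n) :
    ∑ a, (p * δ i a + q * (x i * x a)) * (p' * δ a j + q' * (x a * x j)) =
      p * p' * δ i j + (p * q' + q * p' + q * q' * ‖x‖ ^ 2) * (x i * x j) := by
  have e : ∀ a, (p * δ i a + q * (x i * x a)) * (p' * δ a j + q' * (x a * x j)) =
      δ a i * (p * p' * δ a j) + δ a i * (p * q' * x a * x j) + δ a j * (q * p' * (x i * x a))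
      + q * q' * x i * x j * (x a * x a) := by
    intro a; rw [delta_comm i a]; ring
  simp only [e, Finset.sum_add_distrib, sum_delta_mul, ← Finset.mul_sum, sum_sq_coord]
  ring

lemma sum_sum_mul_radial (x : E n) (p q p' q' : ℝ) :
    ∑ i, ∑ j, (p * δ i j + q * (x i * x j)) * (p' * δ i j + q' * (x i * x j)) =
      ((n : ℝ) - 1) * (p * p') + (p + q * ‖x‖ ^ 2) * (p' + q' * ‖x‖ ^ 2) := by
  have e : ∀ i, ∑ j, (p * δ i j + q * (x i * x j)) * (p' * δ i j + q' * (x i * x j)) =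
      p * p' * δ i i + (p * q' + q * p' + q * q' * ‖x‖ ^ 2) * (x i * x i) := by
    intro i
    rw [← sum_mul_radial]
    refine Finset.sum_congr rfl fun j _ => ?_
    rw [delta_comm j i, mul_comm (x j)]
  simp only [e, Finset.sum_add_distrib, ← Finset.mul_sum, sum_sq_coord, sum_delta_self]
  ring

lemma sum_mul_coord (x : E n) (p q : ℝ) (i : Fin n) :
    ∑ a, (p * δ i a + q * (x i * x a)) * x a = (p + q * ‖x‖ ^ 2) * x i := by
  have e : ∀ a, (p * δ i a + q * (x i * x a)) * x a = δ a i * (p * x a) + q * x i * (x a * x a) := by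
    intro a; rw [delta_comm i a]; ring
  simp only [e, Finset.sum_add_distrib, ← Finset.mul_sum, sum_sq_coord, sum_delta_mul]
  ring

/-! ### Ricci and scalar curvature of a radial metric. -/

/-- The symmetric tensor `A(r)² k_n(r) dr² + k_t(r) ρ(r)² g_{S^{n-1}}`. -/
def IsRadialTensor (k : TensorField n) (r₀ : ℝ) (A ρ kn kt : ℝ → ℝ) : Prop :=
  ∀ x : E n, r₀ < ‖x‖ → ∀ i j, k x i j =
    (ρ ‖x‖ / ‖x‖) ^ 2 * kt ‖x‖ * δ i j
      + (A ‖x‖ ^ 2 * kn ‖x‖ - (ρ ‖x‖ / ‖x‖) ^ 2 * kt ‖x‖) / ‖x‖ ^ 2 * (x i * x j)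

namespace IsRadialMetric

variable {g k : TensorField n} {r₀ : ℝ} {A ρ kn kt : ℝ → ℝ}

/-- The trace sees `n - 1` tangential eigenvalues and one radial eigenvalue. All the traces of
radial tensors below go through this formula. -/
lemma contract (h : IsRadialMetric g r₀ A ρ) {x : E n} (hx : r₀ < ‖x‖) (p q : ℝ) :
    ∑ i, ∑ j, (g x)⁻¹ i j * (p * δ i j + q * (x i * x j)) =
      ((n : ℝ) - 1) * ((‖x‖ / ρ ‖x‖) ^ 2 * p) + (p + q * ‖x‖ ^ 2) / A ‖x‖ ^ 2 := by
  have hr := (h.norm_pos hx).ne'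
  simp only [h.inv_eq hx]
  rw [sum_sum_mul_radial]
  field_simp
  ring

lemma pd_christoffel (h : IsRadialMetric g r₀ A ρ) {x : E n} (hx : r₀ < ‖x‖) {P' Q' S' : ℝ}
    (hP : HasDerivAt (chrP ρ) P' ‖x‖) (hQ : HasDerivAt (chrQ A ρ) Q' ‖x‖)
    (hS : HasDerivAt (chrS A ρ) S' ‖x‖) (m l i j : Fin n) :
    pd m (christoffel g l i j) x =
      P' / ‖x‖ * x m * (x i * δ l j + x j * δ l i) + chrP ρ ‖x‖ * (δ m i * δ l j + δ m j * δ l i)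
      + (Q' / ‖x‖ * x m * x l + chrQ A ρ ‖x‖ * δ m l) * δ i j
      + S' / ‖x‖ * x m * (x i * x j * x l)
      + chrS A ρ ‖x‖ * (δ m i * x j * x l + δ m j * x i * x l + δ m l * x i * x j) := by
  have hx0 : x ≠ 0 := norm_ne_zero_iff.1 (h.norm_pos hx).ne'
  have e : christoffel g l i j =ᶠ[𝓝 x] fun y =>
      chrP ρ ‖y‖ * (y i * δ l j + y j * δ l i) + chrQ A ρ ‖y‖ * (y l * δ i j)
        + chrS A ρ ‖y‖ * (y i * y j * y l) := by
    filter_upwards [eventually_lt_norm hx] with y hy using h.christoffel_eq hy l i j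
  have d := fun i => differentiableAt_coord i x
  have dP := (hasFDerivAt_radial hx0 hP).differentiableAt
  have dQ := (hasFDerivAt_radial hx0 hQ).differentiableAt
  have dS := (hasFDerivAt_radial hx0 hS).differentiableAt
  have c : ∀ t : ℝ, DifferentiableAt ℝ (fun _ : E n => t) x := fun t => differentiableAt_const t
  have d1 := ((d i).fun_mul (c (δ l j))).fun_add ((d j).fun_mul (c (δ l i)))
  have d2 := (d l).fun_mul (c (δ i j))
  have d3 := ((d i).fun_mul (d j)).fun_mul (d l)
  rw [pd_congr e, pd_add ((dP.fun_mul d1).fun_add (dQ.fun_mul d2)) (dS.fun_mul d3),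
    pd_add (dP.fun_mul d1) (dQ.fun_mul d2), pd_radial_mul hx0 hP d1, pd_radial_mul hx0 hQ d2,
    pd_radial_mul hx0 hS d3, pd_add ((d i).fun_mul (c _)) ((d j).fun_mul (c _)),
    pd_mul (d i) (c _), pd_mul (d j) (c _), pd_mul (d l) (c _),
    pd_mul ((d i).fun_mul (d j)) (d l), pd_mul (d i) (d j)]
  simp only [pd_coord, pd_const]
  ring

/-- The values and derivatives of the Christoffel coefficients enter as independent numbers, which
leaves a polynomial identity. `T` is the coefficient in `∑ₗ Γˡₗₐ = T xₐ`, and `T'` is its radial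
derivative. -/
lemma ricci_eq (h : IsRadialMetric g r₀ A ρ) {x : E n} (hx : r₀ < ‖x‖) {P' Q' S' P Q S T T' : ℝ}
    (hP : HasDerivAt (chrP ρ) P' ‖x‖) (hQ : HasDerivAt (chrQ A ρ) Q' ‖x‖)
    (hS : HasDerivAt (chrS A ρ) S' ‖x‖) (eP : chrP ρ ‖x‖ = P) (eQ : chrQ A ρ ‖x‖ = Q)
    (eS : chrS A ρ ‖x‖ = S) (hT : T = (n + 1) * P + Q + S * ‖x‖ ^ 2)
    (hT' : T' = (n + 1) * P' + Q' + S' * ‖x‖ ^ 2 + 2 * S * ‖x‖) (i j : Fin n) :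
    ricci g i j x =
      (2 * P + Q' * ‖x‖ + n * Q - T + T * Q * ‖x‖ ^ 2 - 2 * P * Q * ‖x‖ ^ 2) * δ i j
      + (2 * P' / ‖x‖ + S' * ‖x‖ + (n + 2) * S - T' / ‖x‖ + 2 * T * P + T * S * ‖x‖ ^ 2
          - ((n + 3) * P ^ 2 + 2 * P * Q + 4 * P * S * ‖x‖ ^ 2 + Q ^ 2 + 2 * Q * S * ‖x‖ ^ 2
            + S ^ 2 * ‖x‖ ^ 4)) * (x i * x j) := by
  have hr := (h.norm_pos hx).ne'
  unfold ricci
  simp only [h.pd_christoffel hx hP hQ hS, h.christoffel_eq hx, eP, eQ, eS]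
  have hs := sum_sq_coord x
  have hsum : ∑ _l : Fin n, (1 : ℝ) = n := by simp
  have s1 : ∀ l, ∑ a, ((P * (x l * δ l a + x a * δ l l) + Q * (x l * δ l a)
        + S * (x l * x a * x l)) * (P * (x i * δ a j + x j * δ a i) + Q * (x a * δ i j)
        + S * (x i * x j * x a))
      - (P * (x j * δ l a + x a * δ l j) + Q * (x l * δ j a) + S * (x j * x a * x l))
        * (P * (x i * δ a l + x l * δ a i) + Q * (x a * δ i l) + S * (x i * x l * x a))) =
      (P + Q) * (x l * (P * (x i * δ l j + x j * δ l i) + Q * (x l * δ i j)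
        + S * (x i * x j * x l)))
      + (P + S * (x l * x l)) * (2 * P * (x i * x j) + Q * ‖x‖ ^ 2 * δ i j
        + S * ‖x‖ ^ 2 * (x i * x j))
      - P * x j * (P * (x i + x l * δ l i) + Q * (x l * δ l i) + S * (x i * x l * x l))
      - (P * δ l j + S * x j * x l) * (2 * P * (x i * x l) + Q * ‖x‖ ^ 2 * δ l i
        + S * ‖x‖ ^ 2 * (x i * x l))
      - Q * x l * (P * (x i * δ l j + x l * δ i j) + Q * (x j * δ l i) + S * (x i * x l * x j)) := by
    intro l
    rw [delta_self]
    have e : ∀ a, ((P * (x l * δ l a + x a * 1) + Q * (x l * δ l a)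
        + S * (x l * x a * x l)) * (P * (x i * δ a j + x j * δ a i) + Q * (x a * δ i j)
        + S * (x i * x j * x a))
      - (P * (x j * δ l a + x a * δ l j) + Q * (x l * δ j a) + S * (x j * x a * x l))
        * (P * (x i * δ a l + x l * δ a i) + Q * (x a * δ i l) + S * (x i * x l * x a))) =
        δ a l * ((P + Q) * x l * (P * (x i * δ a j + x j * δ a i) + Q * (x a * δ i j)
          + S * (x i * x j * x a))
          - P * x j * (P * (x i * δ a l + x l * δ a i) + Q * (x a * δ i l) + S * (x i * x l * x a)))
        + δ a j * ((P + S * (x l * x l)) * P * x i * x a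
          - Q * x l * (P * (x i * δ a l + x l * δ a i) + Q * (x a * δ i l) + S * (x i * x l * x a)))
        + δ a i * ((P + S * (x l * x l)) * P * x j * x a
          - (P * δ l j + S * x j * x l) * (P * x l * x a))
        - δ a l * ((P * δ l j + S * x j * x l) * (P * x i * x a))
        + ((P + S * (x l * x l)) * (Q * δ i j + S * (x i * x j))
          - (P * δ l j + S * x j * x l) * (Q * δ i l + S * (x i * x l))) * (x a * x a) := by
      intro a
      rw [delta_comm l a, delta_comm j a]; ring
    simp only [e, Finset.sum_add_distrib, Finset.sum_sub_distrib, sum_delta_mul, ← Finset.mul_sum, hs,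
      delta_self]
    rw [delta_comm i l, delta_comm j l, delta_comm j i]
    ring
  simp only [s1]
  have e : ∀ l, (P' / ‖x‖ * x l * (x i * δ l j + x j * δ l i) + P * (δ l i * δ l j + δ l j * δ l i)
        + (Q' / ‖x‖ * x l * x l + Q * δ l l) * δ i j + S' / ‖x‖ * x l * (x i * x j * x l)
        + S * (δ l i * x j * x l + δ l j * x i * x l + δ l l * x i * x j)
      - (P' / ‖x‖ * x j * (x i * δ l l + x l * δ l i) + P * (δ j i * δ l l + δ j l * δ l i)
        + (Q' / ‖x‖ * x j * x l + Q * δ j l) * δ i l + S' / ‖x‖ * x j * (x i * x l * x l)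
        + S * (δ j i * x l * x l + δ j l * x i * x l + δ j l * x i * x l))
      + ((P + Q) * (x l * (P * (x i * δ l j + x j * δ l i) + Q * (x l * δ i j)
        + S * (x i * x j * x l)))
      + (P + S * (x l * x l)) * (2 * P * (x i * x j) + Q * ‖x‖ ^ 2 * δ i j
        + S * ‖x‖ ^ 2 * (x i * x j))
      - P * x j * (P * (x i + x l * δ l i) + Q * (x l * δ l i) + S * (x i * x l * x l))
      - (P * δ l j + S * x j * x l) * (2 * P * (x i * x l) + Q * ‖x‖ ^ 2 * δ l i
        + S * ‖x‖ ^ 2 * (x i * x l))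
      - Q * x l * (P * (x i * δ l j + x l * δ i j) + Q * (x j * δ l i) + S * (x i * x l * x j)))) =
      δ l j * (P' / ‖x‖ * x i * x l + 2 * P * δ l i + S * x i * x l - P * δ l i
          - Q * δ l i - 2 * S * x i * x l
          + (P + Q) * P * x i * x l - P * (2 * P * (x i * x l) + Q * ‖x‖ ^ 2 * δ l i
            + S * ‖x‖ ^ 2 * (x i * x l)) - Q * P * x i * x l)
      + δ l i * (P' / ‖x‖ * x j * x l + S * x j * x l - P' / ‖x‖ * x j * x l
          - Q' / ‖x‖ * x j * x l
          + (P + Q) * P * x j * x l - P * x j * (P * x l + Q * x l)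
          - S * x j * Q * ‖x‖ ^ 2 * x l - Q * Q * x j * x l)
      + (Q' / ‖x‖ * δ i j + S' / ‖x‖ * x i * x j - S' / ‖x‖ * x i * x j
          - S * δ i j + (P + Q) * (Q * δ i j + S * (x i * x j))
          + S * (2 * P * (x i * x j) + Q * ‖x‖ ^ 2 * δ i j + S * ‖x‖ ^ 2 * (x i * x j))
          - P * S * (x i * x j) - S * x j * (2 * P * x i + S * ‖x‖ ^ 2 * x i)
          - Q * P * δ i j - Q * S * (x i * x j)) * (x l * x l)
      + (Q * δ i j + S * x i * x j - P' / ‖x‖ * x i * x j - P * δ i j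
          + P * (2 * P * (x i * x j) + Q * ‖x‖ ^ 2 * δ i j + S * ‖x‖ ^ 2 * (x i * x j))
          - P * P * (x i * x j)) * 1 := by
    intro l
    rw [delta_self, delta_comm j l, delta_comm i l, delta_comm j i]; ring
  simp only [e, Finset.sum_add_distrib, sum_delta_mul, ← Finset.mul_sum, hs, hsum]
  rw [delta_comm j i, hT', hT]
  field_simp
  ring

/-- The scalar curvature of `A² dr² + ρ² g_{S^{n-1}}`. -/
lemma scalarCurvature_eq (h : IsRadialMetric g r₀ A ρ) {x : E n} (hx : r₀ < ‖x‖) :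
    scalarCurvature g x = ((n : ℝ) - 1) *
      (((n : ℝ) - 2) * (1 - (deriv ρ ‖x‖ / A ‖x‖) ^ 2) / ρ ‖x‖ ^ 2
        - 2 * (deriv (deriv ρ) ‖x‖ - deriv ρ ‖x‖ * deriv A ‖x‖ / A ‖x‖) / (A ‖x‖ ^ 2 * ρ ‖x‖)) := by
  have hA := (h.A_pos _ hx).ne'
  have hρ := (h.ρ_pos _ hx).ne'
  have hr := (h.norm_pos hx).ne'
  have dA := ContDiffOn.hasDerivAt_Ioi h.A_smooth hx
  have dA2 := ContDiffOn.hasDerivAt_Ioi (ContDiffOn.deriv_Ioi h.A_smooth) hx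
  have dρ := ContDiffOn.hasDerivAt_Ioi h.ρ_smooth hx
  have dρ2 := ContDiffOn.hasDerivAt_Ioi (ContDiffOn.deriv_Ioi h.ρ_smooth) hx
  have did := hasDerivAt_id' ‖x‖
  set r := ‖x‖ with hrdef
  have hP : HasDerivAt (chrP ρ) (deriv (deriv ρ) r / (ρ r * r) - (deriv ρ r) ^ 2 / (ρ r ^ 2 * r)
      - deriv ρ r / (ρ r * r ^ 2) + 2 / r ^ 3) r := by
    refine ((dρ2.fun_div (dρ.fun_mul did) (mul_ne_zero hρ hr)).fun_sub
      ((hasDerivAt_const r (1 : ℝ)).fun_div (did.fun_pow 2) (pow_ne_zero 2 hr))).congr_deriv ?_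
    field_simp; norm_num; ring
  have hQ : HasDerivAt (chrQ A ρ) (- 2 / r ^ 3 - (deriv ρ r ^ 2 + ρ r * deriv (deriv ρ) r)
      / (A r ^ 2 * r ^ 3) + ρ r * deriv ρ r * (2 * deriv A r / (A r ^ 3 * r ^ 3)
        + 3 / (A r ^ 2 * r ^ 4))) r := by
    refine (((hasDerivAt_const r (1 : ℝ)).fun_div (did.fun_pow 2) (pow_ne_zero 2 hr)).fun_sub
      ((dρ.fun_mul dρ2).fun_div ((dA.fun_pow 2).fun_mul (did.fun_pow 3))
        (mul_ne_zero (pow_ne_zero 2 hA) (pow_ne_zero 3 hr)))).congr_deriv ?_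
    field_simp; norm_num; ring
  -- The value of this derivative is not needed: it cancels from the curvature.
  obtain ⟨L', hL⟩ : ∃ L', HasDerivAt (fun r => deriv A r / (A r * r)) L' r :=
    ⟨_, dA2.fun_div (dA.fun_mul did) (mul_ne_zero hA hr)⟩
  set P := chrP ρ r with eP
  set Q := chrQ A ρ r with eQ
  set P' := deriv (deriv ρ) r / (ρ r * r) - (deriv ρ r) ^ 2 / (ρ r ^ 2 * r)
      - deriv ρ r / (ρ r * r ^ 2) + 2 / r ^ 3 with eP'
  set Q' := - 2 / r ^ 3 - (deriv ρ r ^ 2 + ρ r * deriv (deriv ρ) r)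
      / (A r ^ 2 * r ^ 3) + ρ r * deriv ρ r * (2 * deriv A r / (A r ^ 3 * r ^ 3)
        + 3 / (A r ^ 2 * r ^ 4)) with eQ'
  set L := deriv A r / (A r * r) with eL
  have hS : HasDerivAt (chrS A ρ) ((L' - 2 * P' - Q') / r ^ 2 - 2 * (L - 2 * P - Q) / r ^ 3) r := by
    refine (((hL.fun_sub (hP.const_mul 2)).fun_sub hQ).fun_div (did.fun_pow 2)
      (pow_ne_zero 2 hr)).congr_deriv ?_
    simp only [← eL, ← eP, ← eQ]
    field_simp; norm_num; ring
  unfold scalarCurvature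
  simp only [h.ricci_eq hx hP hQ hS rfl rfl rfl rfl rfl]
  rw [h.contract hx]
  simp only [← hrdef, chrS, ← eP, ← eQ, ← eL]
  -- `key1` is the coefficient of the tangential part of the Ricci tensor, `key2` its value on the
  -- radial direction; all second derivatives of `A` drop out of the latter.
  have key1 : 2 * P + Q' * r + n * Q - ((n + 1) * P + Q + (L - 2 * P - Q) / r ^ 2 * r ^ 2)
      + ((n + 1) * P + Q + (L - 2 * P - Q) / r ^ 2 * r ^ 2) * Q * r ^ 2 - 2 * P * Q * r ^ 2
      = 2 * P + Q' * r + n * Q - ((n - 1) * P + L) + ((n - 1) * P + L) * Q * r ^ 2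
        - 2 * P * Q * r ^ 2 := by
    field_simp; ring
  have key2 : 2 * P + Q' * r + n * Q - ((n + 1) * P + Q + (L - 2 * P - Q) / r ^ 2 * r ^ 2)
      + ((n + 1) * P + Q + (L - 2 * P - Q) / r ^ 2 * r ^ 2) * Q * r ^ 2 - 2 * P * Q * r ^ 2
      + (2 * P' / r + ((L' - 2 * P' - Q') / r ^ 2 - 2 * (L - 2 * P - Q) / r ^ 3) * r
        + (n + 2) * ((L - 2 * P - Q) / r ^ 2)
        - ((n + 1) * P' + Q' + ((L' - 2 * P' - Q') / r ^ 2 - 2 * (L - 2 * P - Q) / r ^ 3) * r ^ 2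
          + 2 * ((L - 2 * P - Q) / r ^ 2) * r) / r
        + 2 * ((n + 1) * P + Q + (L - 2 * P - Q) / r ^ 2 * r ^ 2) * P
        + ((n + 1) * P + Q + (L - 2 * P - Q) / r ^ 2 * r ^ 2) * ((L - 2 * P - Q) / r ^ 2) * r ^ 2
        - ((n + 3) * P ^ 2 + 2 * P * Q + 4 * P * ((L - 2 * P - Q) / r ^ 2) * r ^ 2 + Q ^ 2
          + 2 * Q * ((L - 2 * P - Q) / r ^ 2) * r ^ 2
          + ((L - 2 * P - Q) / r ^ 2) ^ 2 * r ^ 4)) * r ^ 2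
      = (n - 1) * (L - 3 * P - P' * r + r ^ 2 * (P * L - P ^ 2)) := by
    field_simp; ring
  rw [key2, key1, eP', eQ', eP, eQ, chrP, chrQ, eL]
  field_simp
  ring

end IsRadialMetric

end

end SphericalData

/-! ### The Jang operator, the energy and the momentum of radial data. -/

namespace SphericalData

noncomputable section

variable {n : ℕ}

local notation "δ" => (1 : Matrix (Fin n) (Fin n) ℝ)

/-- The radial coefficient `√(A² + F'²)` of the Jang metric. -/
def jangA (A F : ℝ → ℝ) (r : ℝ) : ℝ := Real.sqrt (A r ^ 2 + deriv F r ^ 2)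

lemma jangA_sq (A F : ℝ → ℝ) (r : ℝ) : jangA A F r ^ 2 = A r ^ 2 + deriv F r ^ 2 :=
  Real.sq_sqrt (by positivity)

lemma pd_radialOn {f : E n → ℝ} {F : ℝ → ℝ} {r₀ : ℝ} (h0 : 0 ≤ r₀)
    (hF : ContDiffOn ℝ ∞ F (Ioi r₀)) (hf : ∀ y : E n, r₀ < ‖y‖ → f y = F ‖y‖) {x : E n}
    (hx : r₀ < ‖x‖) (i : Fin n) : pd i f x = deriv F ‖x‖ / ‖x‖ * x i := by
  have e : f =ᶠ[𝓝 x] fun y => F ‖y‖ := by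
    filter_upwards [eventually_lt_norm hx] with y hy using hf y hy
  rw [pd_congr e, pd_radial (norm_ne_zero_iff.1 (h0.trans_lt hx).ne')
    (ContDiffOn.hasDerivAt_Ioi hF hx)]

namespace IsRadialMetric

variable {g k : TensorField n} {r₀ : ℝ} {A ρ kn kt F : ℝ → ℝ} {f : E n → ℝ}

lemma hessian_eq (h : IsRadialMetric g r₀ A ρ) (hF : ContDiffOn ℝ ∞ F (Ioi r₀))
    (hf : ∀ y : E n, r₀ < ‖y‖ → f y = F ‖y‖) {x : E n} (hx : r₀ < ‖x‖) (i j : Fin n) :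
    hessian g f i j x = deriv F ‖x‖ * ρ ‖x‖ * deriv ρ ‖x‖ / (A ‖x‖ ^ 2 * ‖x‖ ^ 2) * δ i j
      + (deriv (deriv F) ‖x‖ - deriv F ‖x‖ * deriv A ‖x‖ / A ‖x‖
        - deriv F ‖x‖ * ρ ‖x‖ * deriv ρ ‖x‖ / (A ‖x‖ ^ 2 * ‖x‖ ^ 2)) / ‖x‖ ^ 2 * (x i * x j) := by
  have hA := (h.A_pos _ hx).ne'
  have hρ := (h.ρ_pos _ hx).ne'
  have hr := (h.norm_pos hx).ne'
  have hx0 : x ≠ 0 := norm_ne_zero_iff.1 hr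
  have dF2 := ContDiffOn.hasDerivAt_Ioi (ContDiffOn.deriv_Ioi hF) hx
  have dq : HasDerivAt (fun r => deriv F r / r) (deriv (deriv F) ‖x‖ / ‖x‖ - deriv F ‖x‖ / ‖x‖ ^ 2)
      ‖x‖ := by
    refine (dF2.fun_div (hasDerivAt_id' _) hr).congr_deriv ?_
    field_simp
  have e : pd j f =ᶠ[𝓝 x] fun y => deriv F ‖y‖ / ‖y‖ * y j := by
    filter_upwards [eventually_lt_norm hx] with y hy using pd_radialOn h.nonneg hF hf hy j
  unfold hessian
  rw [pd_congr e, pd_radial_mul hx0 dq (differentiableAt_coord j x), pd_coord]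
  simp only [h.christoffel_eq hx, pd_radialOn h.nonneg hF hf hx]
  have e2 : ∀ l, (chrP ρ ‖x‖ * (x i * δ l j + x j * δ l i) + chrQ A ρ ‖x‖ * (x l * δ i j)
      + chrS A ρ ‖x‖ * (x i * x j * x l)) * (deriv F ‖x‖ / ‖x‖ * x l) =
      δ l j * (chrP ρ ‖x‖ * (deriv F ‖x‖ / ‖x‖) * x i * x l)
      + δ l i * (chrP ρ ‖x‖ * (deriv F ‖x‖ / ‖x‖) * x j * x l)
      + (chrQ A ρ ‖x‖ * δ i j + chrS A ρ ‖x‖ * (x i * x j)) * (deriv F ‖x‖ / ‖x‖) * (x l * x l) := by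
    intro l; ring
  simp only [e2, Finset.sum_add_distrib, sum_delta_mul, ← Finset.mul_sum, sum_sq_coord]
  rw [chrS, chrQ, chrP]
  field_simp
  ring

lemma gradient_eq (h : IsRadialMetric g r₀ A ρ) (hF : ContDiffOn ℝ ∞ F (Ioi r₀))
    (hf : ∀ y : E n, r₀ < ‖y‖ → f y = F ‖y‖) {x : E n} (hx : r₀ < ‖x‖) (i : Fin n) :
    gradient g f i x = deriv F ‖x‖ / (‖x‖ * A ‖x‖ ^ 2) * x i := by
  have hr := (h.norm_pos hx).ne'
  unfold gradient
  simp only [h.inv_eq hx, pd_radialOn h.nonneg hF hf hx]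
  simp only [mul_left_comm _ (deriv F ‖x‖ / ‖x‖), ← Finset.mul_sum]
  rw [sum_mul_coord]
  field_simp
  ring

lemma gradNormSq_eq (h : IsRadialMetric g r₀ A ρ) (hF : ContDiffOn ℝ ∞ F (Ioi r₀))
    (hf : ∀ y : E n, r₀ < ‖y‖ → f y = F ‖y‖) {x : E n} (hx : r₀ < ‖x‖) :
    gradNormSq g f x = deriv F ‖x‖ ^ 2 / A ‖x‖ ^ 2 := by
  have hr := (h.norm_pos hx).ne'
  unfold gradNormSq
  simp only [h.gradient_eq hF hf hx, pd_radialOn h.nonneg hF hf hx]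
  simp only [mul_mul_mul_comm _ (x _), ← Finset.mul_sum, sum_sq_coord]
  field_simp

lemma laplacian_eq (h : IsRadialMetric g r₀ A ρ) (hF : ContDiffOn ℝ ∞ F (Ioi r₀))
    (hf : ∀ y : E n, r₀ < ‖y‖ → f y = F ‖y‖) {x : E n} (hx : r₀ < ‖x‖) :
    laplacian g f x = ((n : ℝ) - 1) * (deriv F ‖x‖ * deriv ρ ‖x‖ / (A ‖x‖ ^ 2 * ρ ‖x‖))
      + (deriv (deriv F) ‖x‖ - deriv F ‖x‖ * deriv A ‖x‖ / A ‖x‖) / A ‖x‖ ^ 2 := by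
  have hρ := (h.ρ_pos _ hx).ne'
  have hr := (h.norm_pos hx).ne'
  unfold laplacian
  simp only [h.hessian_eq hF hf hx]
  rw [h.contract hx]
  field_simp
  ring

lemma jangA_pos (h : IsRadialMetric g r₀ A ρ) {r : ℝ} (hr : r₀ < r) : 0 < jangA A F r :=
  Real.sqrt_pos.2 (by have := h.A_pos r hr; positivity)

/-- Since `df²` is a multiple of `dr²`, only the radial coefficient changes; every formula for
radial metrics therefore applies to the Jang metric as well. -/
lemma jangMetric (h : IsRadialMetric g r₀ A ρ) (hF : ContDiffOn ℝ ∞ F (Ioi r₀))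
    (hf : ∀ y : E n, r₀ < ‖y‖ → f y = F ‖y‖) :
    IsRadialMetric (jangMetric g f) r₀ (jangA A F) ρ where
  nonneg := h.nonneg
  A_pos r hr := h.jangA_pos hr
  ρ_pos := h.ρ_pos
  A_smooth := ((h.A_smooth.pow 2).add ((ContDiffOn.deriv_Ioi hF).pow 2)).sqrt
    fun r hr => by have := h.A_pos r hr; positivity
  ρ_smooth := h.ρ_smooth
  eq x hx i j := by
    have hr := (h.norm_pos hx).ne'
    simp only [SphericalData.jangMetric, Matrix.add_apply, Matrix.of_apply, h.eq x hx,
      pd_radialOn h.nonneg hF hf hx, jangA_sq]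
    field_simp
    ring

/-- The first factor of the operator is the inverse of the Jang metric, so the operator is a trace
and `contract`, applied to that metric, evaluates it. -/
lemma jangOperator_eq (h : IsRadialMetric g r₀ A ρ) (hk : IsRadialTensor k r₀ A ρ kn kt)
    (hF : ContDiffOn ℝ ∞ F (Ioi r₀)) (hf : ∀ y : E n, r₀ < ‖y‖ → f y = F ‖y‖) {x : E n}
    (hx : r₀ < ‖x‖) :
    jangOperator g k f x =
      ((n : ℝ) - 1) * (deriv F ‖x‖ * deriv ρ ‖x‖ / (A ‖x‖ * ρ ‖x‖ * jangA A F ‖x‖) - kt ‖x‖)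
      + (A ‖x‖ * deriv (deriv F) ‖x‖ - deriv F ‖x‖ * deriv A ‖x‖) / jangA A F ‖x‖ ^ 3
      - A ‖x‖ ^ 2 * kn ‖x‖ / jangA A F ‖x‖ ^ 2 := by
  have hA := h.A_pos _ hx
  have hρ := (h.ρ_pos _ hx).ne'
  have hr := (h.norm_pos hx).ne'
  have hJ := h.jangA_pos (F := F) hx
  have hsq := jangA_sq A F ‖x‖
  have e1 : 1 + gradNormSq g f x = jangA A F ‖x‖ ^ 2 / A ‖x‖ ^ 2 := by
    rw [h.gradNormSq_eq hF hf hx, hsq]; field_simp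
  have e2 : Real.sqrt (1 + gradNormSq g f x) = jangA A F ‖x‖ / A ‖x‖ := by
    rw [e1, ← div_pow, Real.sqrt_sq (by positivity)]
  have e3 : ∀ a b, (g x)⁻¹ a b - gradient g f a x * gradient g f b x / (1 + gradNormSq g f x)
      = (SphericalData.jangMetric g f x)⁻¹ a b := by
    intro a b
    rw [(h.jangMetric hF hf).inv_eq hx, h.inv_eq hx, h.gradient_eq hF hf hx,
      h.gradient_eq hF hf hx, e1]
    have hA' := hA.ne'
    have hJ' := hJ.ne'
    field_simp
    linear_combination (x a * x b * ρ ‖x‖ ^ 2) * hsq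
  unfold jangOperator
  simp only [e3, e2]
  set lam := deriv F ‖x‖ * ρ ‖x‖ * deriv ρ ‖x‖ / (A ‖x‖ ^ 2 * ‖x‖ ^ 2) / (jangA A F ‖x‖ / A ‖x‖)
    - (ρ ‖x‖ / ‖x‖) ^ 2 * kt ‖x‖ with hlam
  set nu := ((deriv (deriv F) ‖x‖ - deriv F ‖x‖ * deriv A ‖x‖ / A ‖x‖
        - deriv F ‖x‖ * ρ ‖x‖ * deriv ρ ‖x‖ / (A ‖x‖ ^ 2 * ‖x‖ ^ 2)) / ‖x‖ ^ 2)
          / (jangA A F ‖x‖ / A ‖x‖)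
    - (A ‖x‖ ^ 2 * kn ‖x‖ - (ρ ‖x‖ / ‖x‖) ^ 2 * kt ‖x‖) / ‖x‖ ^ 2 with hnu
  have e4 : ∀ a b, hessian g f a b x / (jangA A F ‖x‖ / A ‖x‖) - k x a b =
      lam * δ a b + nu * (x a * x b) := by
    intro a b
    rw [h.hessian_eq hF hf hx, hk x hx, hlam, hnu]; ring
  simp only [e4]
  rw [(h.jangMetric hF hf).contract hx, hlam, hnu]
  have hA' := hA.ne'
  have hJ' := hJ.ne'
  field_simp
  ring

lemma trace_eq (h : IsRadialMetric g r₀ A ρ) (hk : IsRadialTensor k r₀ A ρ kn kt) {x : E n}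
    (hx : r₀ < ‖x‖) : trace g k x = kn ‖x‖ + ((n : ℝ) - 1) * kt ‖x‖ := by
  have hA := (h.A_pos _ hx).ne'
  have hρ := (h.ρ_pos _ hx).ne'
  have hr := (h.norm_pos hx).ne'
  unfold trace
  simp only [hk x hx]
  rw [h.contract hx]
  field_simp
  ring

lemma normSq_eq (h : IsRadialMetric g r₀ A ρ) (hk : IsRadialTensor k r₀ A ρ kn kt) {x : E n}
    (hx : r₀ < ‖x‖) : normSq g k x = kn ‖x‖ ^ 2 + ((n : ℝ) - 1) * kt ‖x‖ ^ 2 := by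
  have hA := (h.A_pos _ hx).ne'
  have hρ := (h.ρ_pos _ hx).ne'
  have hr := (h.norm_pos hx).ne'
  unfold normSq
  set p := (‖x‖ / ρ ‖x‖) ^ 2 with hp
  set q := (1 / A ‖x‖ ^ 2 - p) / ‖x‖ ^ 2 with hq
  set lam := (ρ ‖x‖ / ‖x‖) ^ 2 * kt ‖x‖ with hlam
  set nu := (A ‖x‖ ^ 2 * kn ‖x‖ - lam) / ‖x‖ ^ 2 with hnu
  have e : ∀ i j, ∑ a, ∑ b, (g x)⁻¹ i a * (g x)⁻¹ j b * k x i j * k x a b =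
      (lam * δ i j + nu * (x i * x j)) *
        (p * (p * lam) * δ i j + (p * (p * nu + q * lam + q * nu * ‖x‖ ^ 2) + q * (p * lam)
          + q * (p * nu + q * lam + q * nu * ‖x‖ ^ 2) * ‖x‖ ^ 2) * (x i * x j)) := by
    intro i j
    rw [← sum_mul_radial x p q, Finset.mul_sum]
    refine Finset.sum_congr rfl fun a _ => ?_
    rw [delta_comm a j, mul_comm (x a) (x j), ← sum_mul_radial x p q lam nu j a, Finset.mul_sum,
      Finset.mul_sum]
    refine Finset.sum_congr rfl fun b _ => ?_
    rw [h.inv_eq hx, h.inv_eq hx, hk x hx, hk x hx, ← hp, ← hq, ← hlam, ← hnu, delta_comm b a,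
      mul_comm (x b) (x a)]
    ring
  simp only [e]
  rw [sum_sum_mul_radial, hq, hnu, hlam, hp]
  field_simp
  ring

lemma divTensor_eq (h : IsRadialMetric g r₀ A ρ) {T : TensorField n} {τn τt : ℝ → ℝ}
    (hn : ContDiffOn ℝ ∞ τn (Ioi r₀)) (ht : ContDiffOn ℝ ∞ τt (Ioi r₀))
    (hT : IsRadialTensor T r₀ A ρ τn τt) {x : E n} (hx : r₀ < ‖x‖) (j : Fin n) :
    divTensor g T j x = (deriv τn ‖x‖ + ((n : ℝ) - 1) * (deriv ρ ‖x‖ / ρ ‖x‖)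
      * (τn ‖x‖ - τt ‖x‖)) / ‖x‖ * x j := by
  have hA := (h.A_pos _ hx).ne'
  have hρ := (h.ρ_pos _ hx).ne'
  have hr := (h.norm_pos hx).ne'
  have hx0 : x ≠ 0 := norm_ne_zero_iff.1 hr
  have hs := sum_sq_coord x
  have dA := ContDiffOn.hasDerivAt_Ioi h.A_smooth hx
  have dρ := ContDiffOn.hasDerivAt_Ioi h.ρ_smooth hx
  have dn := ContDiffOn.hasDerivAt_Ioi hn hx
  have dt := ContDiffOn.hasDerivAt_Ioi ht hx
  have did := hasDerivAt_id' ‖x‖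
  set T1 : ℝ → ℝ := fun r => (ρ r / r) ^ 2 * τt r with hT1
  set T2 : ℝ → ℝ := fun r => (A r ^ 2 * τn r - (ρ r / r) ^ 2 * τt r) / r ^ 2 with hT2
  have d1 : HasDerivAt T1 (2 * (ρ ‖x‖ / ‖x‖) ^ 2 * chrP ρ ‖x‖ * ‖x‖ * τt ‖x‖
      + (ρ ‖x‖ / ‖x‖) ^ 2 * deriv τt ‖x‖) ‖x‖ := by
    refine (((dρ.fun_div did hr).fun_pow 2).fun_mul dt).congr_deriv ?_
    simp only [chrP]; norm_num; field_simp; simp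
  set T1' := 2 * (ρ ‖x‖ / ‖x‖) ^ 2 * chrP ρ ‖x‖ * ‖x‖ * τt ‖x‖
      + (ρ ‖x‖ / ‖x‖) ^ 2 * deriv τt ‖x‖ with hT1'
  have d2 : HasDerivAt T2 ((2 * A ‖x‖ * deriv A ‖x‖ * τn ‖x‖ + A ‖x‖ ^ 2 * deriv τn ‖x‖ - T1')
      / ‖x‖ ^ 2 - 2 * T2 ‖x‖ / ‖x‖) ‖x‖ := by
    refine ((((dA.fun_pow 2).fun_mul dn).fun_sub d1).fun_div (did.fun_pow 2)
      (pow_ne_zero 2 hr)).congr_deriv ?_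
    simp only [hT2, hT1]; norm_num; field_simp
  set T2' := (2 * A ‖x‖ * deriv A ‖x‖ * τn ‖x‖ + A ‖x‖ ^ 2 * deriv τn ‖x‖ - T1')
      / ‖x‖ ^ 2 - 2 * T2 ‖x‖ / ‖x‖ with hT2'
  have eT : ∀ y : E n, r₀ < ‖y‖ → ∀ i j, T y i j = T1 ‖y‖ * δ i j + T2 ‖y‖ * (y i * y j) := hT
  have dT : ∀ l i j, pd l (fun y => T y i j) x = T1' / ‖x‖ * x l * δ i j
      + T2' / ‖x‖ * x l * (x i * x j) + T2 ‖x‖ * (δ l i * x j + δ l j * x i) := by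
    intro l i j
    have e : (fun y => T y i j) =ᶠ[𝓝 x] fun y => T1 ‖y‖ * δ i j + T2 ‖y‖ * (y i * y j) := by
      filter_upwards [eventually_lt_norm hx] with y hy using eT y hy i j
    have hc := (differentiableAt_coord i x).fun_mul (differentiableAt_coord j x)
    rw [pd_congr e, pd_add ((hasFDerivAt_radial hx0 d1).differentiableAt.mul_const _)
      ((hasFDerivAt_radial hx0 d2).differentiableAt.fun_mul hc),
      pd_radial_mul hx0 d1 (differentiableAt_const _), pd_radial_mul hx0 d2 hc, pd_const,
      pd_mul (differentiableAt_coord i x) (differentiableAt_coord j x), pd_coord, pd_coord]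
    ring
  have sym : ∀ a b, T x a b = T x b a := by
    intro a b; rw [eT x hx, eT x hx, delta_comm, mul_comm (x a)]
  have ct : ∀ l i j, ∑ a, christoffel g a l i x * T x a j =
      chrP ρ ‖x‖ * (x l * (T1 ‖x‖ * δ i j + T2 ‖x‖ * (x i * x j))
        + x i * (T1 ‖x‖ * δ l j + T2 ‖x‖ * (x l * x j)))
      + (chrQ A ρ ‖x‖ * δ l i + chrS A ρ ‖x‖ * (x l * x i)) * (T1 ‖x‖ + T2 ‖x‖ * ‖x‖ ^ 2) * x j := by
    intro l i j
    simp only [h.christoffel_eq hx, eT x hx]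
    have e : ∀ a, (chrP ρ ‖x‖ * (x l * δ a i + x i * δ a l) + chrQ A ρ ‖x‖ * (x a * δ l i)
        + chrS A ρ ‖x‖ * (x l * x i * x a)) * (T1 ‖x‖ * δ a j + T2 ‖x‖ * (x a * x j)) =
        δ a i * (chrP ρ ‖x‖ * x l * (T1 ‖x‖ * δ a j + T2 ‖x‖ * (x a * x j)))
        + δ a l * (chrP ρ ‖x‖ * x i * (T1 ‖x‖ * δ a j + T2 ‖x‖ * (x a * x j)))
        + δ a j * ((chrQ A ρ ‖x‖ * δ l i + chrS A ρ ‖x‖ * (x l * x i)) * T1 ‖x‖ * x a)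
        + (chrQ A ρ ‖x‖ * δ l i + chrS A ρ ‖x‖ * (x l * x i)) * T2 ‖x‖ * x j * (x a * x a) := by
      intro a; ring
    simp only [e, Finset.sum_add_distrib, sum_delta_mul, ← Finset.mul_sum, hs]
    ring
  have ct2 : ∀ l i j, ∑ a, christoffel g a l j x * T x i a =
      ∑ a, christoffel g a l j x * T x a i := by
    intro l i j; exact Finset.sum_congr rfl fun a _ => by rw [sym]
  unfold divTensor
  simp only [dT, ct2, ct, h.inv_eq hx]
  set P := chrP ρ ‖x‖ with hP
  set Q := chrQ A ρ ‖x‖ with hQ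
  set S := chrS A ρ ‖x‖ with hS
  set p := (‖x‖ / ρ ‖x‖) ^ 2 with hp
  set q := (1 / A ‖x‖ ^ 2 - p) / ‖x‖ ^ 2 with hq
  set t1 := T1 ‖x‖ with ht1
  set t2 := T2 ‖x‖ with ht2
  set tn := t1 + t2 * ‖x‖ ^ 2 with htn
  have e : ∀ i, ∑ l, (p * δ i l + q * (x i * x l)) *
      (T1' / ‖x‖ * x l * δ i j + T2' / ‖x‖ * x l * (x i * x j) + t2 * (δ l i * x j + δ l j * x i)
        - (P * (x l * (t1 * δ i j + t2 * (x i * x j)) + x i * (t1 * δ l j + t2 * (x l * x j)))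
          + (Q * δ l i + S * (x l * x i)) * tn * x j)
        - (P * (x l * (t1 * δ j i + t2 * (x j * x i)) + x j * (t1 * δ l i + t2 * (x l * x i)))
          + (Q * δ l j + S * (x l * x j)) * tn * x i)) =
      (p + q * ‖x‖ ^ 2) * x i * (T1' / ‖x‖ * δ i j + T2' / ‖x‖ * (x i * x j)
        - 2 * P * (t1 * δ i j + t2 * (x i * x j)) - 2 * P * t2 * (x i * x j)
        - 2 * S * tn * (x i * x j))
      + (p + q * (x i * x i)) * (t2 - Q * tn - P * t1) * x j
      + (p * δ i j + q * (x i * x j)) * (t2 - P * t1 - Q * tn) * x i := by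
    intro i
    have e : ∀ l, (p * δ i l + q * (x i * x l)) *
      (T1' / ‖x‖ * x l * δ i j + T2' / ‖x‖ * x l * (x i * x j) + t2 * (δ l i * x j + δ l j * x i)
        - (P * (x l * (t1 * δ i j + t2 * (x i * x j)) + x i * (t1 * δ l j + t2 * (x l * x j)))
          + (Q * δ l i + S * (x l * x i)) * tn * x j)
        - (P * (x l * (t1 * δ j i + t2 * (x j * x i)) + x j * (t1 * δ l i + t2 * (x l * x i)))
          + (Q * δ l j + S * (x l * x j)) * tn * x i)) =
        δ l i * (p * (x l * (T1' / ‖x‖ * δ i j + T2' / ‖x‖ * (x i * x j)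
          - 2 * P * (t1 * δ i j + t2 * (x i * x j)) - 2 * P * t2 * (x i * x j)
          - 2 * S * tn * (x i * x j)) + δ l j * (t2 - P * t1 - Q * tn) * x i
          + δ l i * ((t2 - Q * tn - P * t1) * x j)))
        + δ l i * (q * x i * x l * ((t2 - Q * tn - P * t1) * x j))
        + δ l j * (q * x i * x l * ((t2 - P * t1 - Q * tn) * x i))
        + q * x i * (T1' / ‖x‖ * δ i j + T2' / ‖x‖ * (x i * x j)
          - 2 * P * (t1 * δ i j + t2 * (x i * x j)) - 2 * P * t2 * (x i * x j)
          - 2 * S * tn * (x i * x j)) * (x l * x l) := by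
      intro l
      rw [delta_comm i l, delta_comm j i]; ring
    simp only [e, Finset.sum_add_distrib, sum_delta_mul, ← Finset.mul_sum, hs, delta_self]
    ring
  simp only [e]
  have hsum : ∑ _l : Fin n, (1 : ℝ) = n := by simp
  have e' : ∀ i, (p + q * ‖x‖ ^ 2) * x i * (T1' / ‖x‖ * δ i j + T2' / ‖x‖ * (x i * x j)
        - 2 * P * (t1 * δ i j + t2 * (x i * x j)) - 2 * P * t2 * (x i * x j)
        - 2 * S * tn * (x i * x j))
      + (p + q * (x i * x i)) * (t2 - Q * tn - P * t1) * x j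
      + (p * δ i j + q * (x i * x j)) * (t2 - P * t1 - Q * tn) * x i =
      δ i j * ((p + q * ‖x‖ ^ 2) * (T1' / ‖x‖ - 2 * P * t1) * x i + p * (t2 - P * t1 - Q * tn) * x i)
      + ((p + q * ‖x‖ ^ 2) * (T2' / ‖x‖ - 4 * P * t2 - 2 * S * tn)
        + 2 * q * (t2 - Q * tn - P * t1)) * x j * (x i * x i)
      + p * (t2 - Q * tn - P * t1) * x j * 1 := by
    intro i; ring
  simp only [e', Finset.sum_add_distrib, sum_delta_mul, ← Finset.mul_sum, hs, hsum]
  have hsplit : T1' = 2 * (ρ ‖x‖ / ‖x‖) ^ 2 * P * ‖x‖ * τt ‖x‖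
      + (ρ ‖x‖ / ‖x‖) ^ 2 * deriv τt ‖x‖ := hT1'
  rw [hT2', hsplit, htn, hS, chrS, ← hP, ← hQ]
  rw [show t2 = (A ‖x‖ ^ 2 * τn ‖x‖ - (ρ ‖x‖ / ‖x‖) ^ 2 * τt ‖x‖) / ‖x‖ ^ 2 from rfl,
    show t1 = (ρ ‖x‖ / ‖x‖) ^ 2 * τt ‖x‖ from rfl, hq, hp, hQ, hP, chrQ, chrP]
  field_simp
  ring

lemma energyDensity_eq (h : IsRadialMetric g r₀ A ρ) (hk : IsRadialTensor k r₀ A ρ kn kt) {x : E n}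
    (hx : r₀ < ‖x‖) : 16 * Real.pi * energyDensity g k x =
      scalarCurvature g x + ((n : ℝ) - 1) * (2 * kn ‖x‖ * kt ‖x‖ + ((n : ℝ) - 2) * kt ‖x‖ ^ 2) := by
  have := Real.pi_pos.ne'
  rw [energyDensity, h.trace_eq hk hx, h.normSq_eq hk hx]
  field_simp
  ring

/-- The tensor `k - (Tr k) g` is radial with normal component `-(n-1) k_t`. Hence its divergence
contains a derivative of `k_t` but none of `k_n`. -/
lemma momentumNorm_eq (h : IsRadialMetric g r₀ A ρ) (hk : IsRadialTensor k r₀ A ρ kn kt)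
    (hn : ContDiffOn ℝ ∞ kn (Ioi r₀)) (ht : ContDiffOn ℝ ∞ kt (Ioi r₀)) {x : E n}
    (hx : r₀ < ‖x‖) : 8 * Real.pi * momentumNorm g k x =
      |((n : ℝ) - 1) * (deriv ρ ‖x‖ / ρ ‖x‖ * (kn ‖x‖ - kt ‖x‖) - deriv kt ‖x‖)| / A ‖x‖ := by
  have hA := h.A_pos _ hx
  have hr := (h.norm_pos hx).ne'
  set c := ((n : ℝ) - 1) * (deriv ρ ‖x‖ / ρ ‖x‖ * (kn ‖x‖ - kt ‖x‖) - deriv kt ‖x‖) with hc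
  have hT : IsRadialTensor (fun y => k y - trace g k y • g y) r₀ A ρ
      (fun r => -((n : ℝ) - 1) * kt r) (fun r => -kn r - ((n : ℝ) - 2) * kt r) := by
    intro y hy i j
    have hy' := (h.norm_pos hy).ne'
    simp only [Matrix.sub_apply, Matrix.smul_apply, smul_eq_mul, h.trace_eq hk hy, h.eq y hy,
      hk y hy]
    field_simp
    ring
  have hJ : ∀ j, momentumDensity g k j x = c / (8 * Real.pi * ‖x‖) * x j := by
    intro j
    have hd : deriv (fun r => -((n : ℝ) - 1) * kt r) ‖x‖ = -((n : ℝ) - 1) * deriv kt ‖x‖ :=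
      ((ContDiffOn.hasDerivAt_Ioi ht hx).const_mul _).deriv
    rw [momentumDensity, h.divTensor_eq (contDiffOn_const.mul ht)
      (hn.neg.sub (contDiffOn_const.mul ht)) hT hx, hd, hc]
    have := Real.pi_pos.ne'
    field_simp
    ring
  have hsum : ∑ i, ∑ j, (g x)⁻¹ i j * momentumDensity g k i x * momentumDensity g k j x =
      (c / (8 * Real.pi * A ‖x‖)) ^ 2 := by
    have e : ∀ i j, (g x)⁻¹ i j * momentumDensity g k i x * momentumDensity g k j x =
        (g x)⁻¹ i j * (0 * δ i j + (c / (8 * Real.pi * ‖x‖)) ^ 2 * (x i * x j)) := by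
      intro i j; rw [hJ, hJ]; ring
    simp only [e]
    rw [h.contract hx]
    field_simp
    ring
  rw [momentumNorm, hsum, Real.sqrt_sq_eq_abs, abs_div, abs_of_pos (a := 8 * Real.pi * A ‖x‖)
    (by positivity)]
  have := Real.pi_pos.ne'
  field_simp

end IsRadialMetric

end

end SphericalData

namespace SphericalData

noncomputable section

variable {n : ℕ}

local notation "δ" => (1 : Matrix (Fin n) (Fin n) ℝ)

/-! ### Integrals over spheres -/

open scoped Pointwise in
lemma measurePreserving_neg_toSphere :
    MeasurePreserving (fun θ : Metric.sphere (0 : E n) 1 => -θ)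
      (volume : Measure (E n)).toSphere (volume : Measure (E n)).toSphere := by
  have hm : Measurable (fun θ : Metric.sphere (0 : E n) 1 => -θ) := continuous_neg.measurable
  refine ⟨hm, Measure.ext fun s hs => ?_⟩
  rw [Measure.map_apply hm hs, Measure.toSphere_apply' _ (hm hs), Measure.toSphere_apply' _ hs]
  congr 1
  rw [← Measure.measure_neg (volume : Measure (E n)) (Ioo (0 : ℝ) 1 •
    (Subtype.val '' s))]
  congr 1
  ext y
  simp only [Set.mem_neg, Set.mem_smul, Set.mem_image, Set.mem_preimage]
  constructor
  · rintro ⟨t, ht, _, ⟨θ, hθ, rfl⟩, rfl⟩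
    exact ⟨t, ht, _, ⟨-θ, hθ, rfl⟩, by simp⟩
  · rintro ⟨t, ht, _, ⟨θ, hθ, rfl⟩, h⟩
    exact ⟨t, ht, _, ⟨-θ, by simpa using hθ, rfl⟩, by simp [h]⟩

/-- The integrand is odd and the measure is invariant under the antipodal map. -/
lemma integral_coord_toSphere (i : Fin n) :
    ∫ θ : Metric.sphere (0 : E n) 1, (θ : E n) i ∂(volume : Measure (E n)).toSphere = 0 := by
  have h := measurePreserving_neg_toSphere (n := n)
  have h1 := h.integral_comp (Homeomorph.neg _).measurableEmbedding
    (fun θ : Metric.sphere (0 : E n) 1 => (θ : E n) i)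
  have h2 : ∀ θ : Metric.sphere (0 : E n) 1, ((-θ : Metric.sphere (0 : E n) 1) : E n) i
      = - (θ : E n) i := by intro θ; simp
  simp only [h2, integral_neg] at h1
  linarith

lemma unitSphereVolume_pos (hn : 0 < n) : 0 < unitSphereVolume n := by
  have : Nonempty (Fin n) := ⟨⟨0, hn⟩⟩
  unfold unitSphereVolume
  rw [Measure.toSphere_real_apply_univ]
  have h1 : 0 < (volume : Measure (E n)).real (Metric.ball 0 1) :=
    ENNReal.toReal_pos (Metric.measure_ball_pos _ _ one_pos).ne' measure_ball_lt_top.ne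
  have h2 : Module.finrank ℝ (E n) = n := by simp
  rw [h2]
  positivity

lemma sphereIntegral_const {G : E n → ℝ} {r c : ℝ} (hr : 0 ≤ r) (hG : ∀ x : E n, ‖x‖ = r → G x = c) :
    sphereIntegral G r = r ^ (n - 1) * (unitSphereVolume n * c) := by
  unfold sphereIntegral unitSphereVolume
  have : ∀ θ : Metric.sphere (0 : E n) 1, G (r • (θ : E n)) = c := fun θ =>
    hG _ (by simp [norm_smul, abs_of_nonneg hr])
  simp [this]

/-! ### Fluxes of radial data -/

namespace IsRadialMetric

variable {g k : TensorField n} {r₀ : ℝ} {A ρ kn kt : ℝ → ℝ}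

lemma energyFlux_eq (h : IsRadialMetric g r₀ A ρ) (hn : 3 ≤ n) {r : ℝ} (hr : r₀ < r) :
    energyFlux g r = r ^ (n - 2) * (A r ^ 2 + (ρ r / r) ^ 2 - 2 * (ρ r / r) * deriv ρ r) / 2 := by
  have hr0 : 0 < r := h.nonneg.trans_lt hr
  have hn1 : (n : ℝ) - 1 ≠ 0 := by
    have : (3 : ℝ) ≤ n := by exact_mod_cast hn
    linarith
  have hω := (unitSphereVolume_pos (n := n) (by omega)).ne'
  unfold energyFlux
  rw [sphereIntegral_const (c := ((n : ℝ) - 1) / r *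
    (A r ^ 2 + (ρ r / r) ^ 2 - 2 * (ρ r / r) * deriv ρ r)) hr0.le]
  -- Writing `n = m + 2` removes the truncated subtractions from the exponents.
  · obtain ⟨m, rfl⟩ : ∃ m, n = m + 2 := ⟨n - 2, by omega⟩
    have e1 : m + 2 - 1 = m + 1 := rfl
    simp only [e1, Nat.add_sub_cancel]
    have := hr0.ne'
    field_simp
    ring
  · intro x hx
    have hx' : r₀ < ‖x‖ := hx ▸ hr
    have hρ := (h.ρ_pos _ hr).ne'
    have hs := sum_sq_coord x
    simp only [h.pd_metric hx', hx]
    set c1 := 2 * (ρ r / r) ^ 2 * chrP ρ r with hc1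
    set c2 := 2 * A r * deriv A r / r ^ 3 - 2 * A r ^ 2 / r ^ 4
          - 2 * ρ r * deriv ρ r / r ^ 5 + 4 * ρ r ^ 2 / r ^ 6
    set c3 := (A r ^ 2 - (ρ r / r) ^ 2) / r ^ 2 with hc3
    have e : ∀ i, ∑ j, ((c1 * x i * δ i j + c2 * (x i * x i * x j) + c3 * (δ i i * x j + δ i j * x i))
        - (c1 * x j * δ i i + c2 * (x j * x i * x i) + c3 * (δ j i * x i + δ j i * x i)))
          * (x j / r) = (c1 - c3) * (x i * x i) / r + (c3 - c1) * ‖x‖ ^ 2 / r * 1 := by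
      intro i
      have e : ∀ j, ((c1 * x i * δ i j + c2 * (x i * x i * x j) + c3 * (δ i i * x j + δ i j * x i))
        - (c1 * x j * δ i i + c2 * (x j * x i * x i) + c3 * (δ j i * x i + δ j i * x i)))
          * (x j / r) = δ j i * ((c1 - c3) * x i * x j / r) + (c3 - c1) / r * (x j * x j) := by
        intro j; rw [delta_comm i j, delta_self]; ring
      simp only [e, Finset.sum_add_distrib, sum_delta_mul, ← Finset.mul_sum, hs]
      ring
    have hsum : ∑ _l : Fin n, (1 : ℝ) = n := by simp
    simp only [e, Finset.sum_add_distrib, ← Finset.mul_sum, ← Finset.sum_div, hs, hsum]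
    rw [hx, hc1, hc3, chrP]
    field_simp
    ring

/-- On a symmetry sphere the integrand is a constant times a coordinate function, which has mean
zero. Therefore the ADM momentum vanishes. -/
lemma momentumFlux_eq (h : IsRadialMetric g r₀ A ρ) (hk : IsRadialTensor k r₀ A ρ kn kt) {r : ℝ}
    (hr : r₀ < r) (i : Fin n) : momentumFlux g k i r = 0 := by
  have hr0 : 0 < r := h.nonneg.trans_lt hr
  unfold momentumFlux sphereIntegral
  have e : ∀ θ : Metric.sphere (0 : E n) 1,
      ∑ j, (k (r • (θ : E n)) i j - trace g k (r • (θ : E n)) * g (r • (θ : E n)) i j)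
        * ((r • (θ : E n)) j / ‖r • (θ : E n)‖) =
      A r ^ 2 * (-((n : ℝ) - 1) * kt r) * (θ : E n) i := by
    intro θ
    set x := r • (θ : E n) with hxd
    have hx : ‖x‖ = r := by simp [hxd, norm_smul, abs_of_pos hr0]
    have hx' : r₀ < ‖x‖ := hx ▸ hr
    have hθ : (θ : E n) i = x i / r := by
      simp [hxd]; field_simp
    simp only [h.trace_eq hk hx', h.eq x hx', hk x hx', hx, hθ]
    set T := kn r + ((n : ℝ) - 1) * kt r with hT
    have e : ∀ j, ((ρ r / r) ^ 2 * kt r * δ i j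
        + (A r ^ 2 * kn r - (ρ r / r) ^ 2 * kt r) / r ^ 2 * (x i * x j)
        - T * ((ρ r / r) ^ 2 * δ i j + (A r ^ 2 - (ρ r / r) ^ 2) / r ^ 2 * (x i * x j))) * (x j / r) =
        1 / r * (((ρ r / r) ^ 2 * (kt r - T) * δ i j
          + (A r ^ 2 * (kn r - T) - (ρ r / r) ^ 2 * (kt r - T)) / r ^ 2 * (x i * x j)) * x j) := by
      intro j; ring
    simp only [e, ← Finset.mul_sum]
    rw [sum_mul_coord, hx, hT]
    field_simp
    ring
  simp only [e]
  rw [integral_const_mul, integral_coord_toSphere]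
  simp

end IsRadialMetric

/-! ### The radial profiles of spherically symmetric data -/

/-- The point at signed distance `r` from the origin on a coordinate axis. -/
def axisPoint (i : Fin n) (r : ℝ) : E n := EuclideanSpace.single i r

lemma norm_axisPoint (i : Fin n) (r : ℝ) : ‖axisPoint i r‖ = |r| := by
  simp [axisPoint]

lemma contDiff_axisPoint (i : Fin n) : ContDiff ℝ ∞ (axisPoint i) := by
  have : (axisPoint i : ℝ → E n) = fun r => r • EuclideanSpace.single i (1 : ℝ) := by
    ext r j; simp [axisPoint]
  rw [this]
  fun_prop

lemma interior_region {r₀ : ℝ} (h : 0 < r₀) : interior (region n r₀) = {x : E n | r₀ < ‖x‖} := by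
  have : region n r₀ = (Metric.ball (0 : E n) r₀)ᶜ := by ext; simp [region]
  rw [this, interior_compl, closure_ball _ h.ne']
  ext; simp

lemma interior_region_zero : interior (region n 0) = univ := by
  have : region n 0 = univ := by ext; simp [region]
  rw [this, interior_univ]

namespace InitialData

lemma mem_interior (D : InitialData n) {x : E n} (hx : D.r₀ < ‖x‖) : x ∈ interior D.M := by
  rcases D.r₀_nonneg.eq_or_lt with h | h
  · unfold M; rw [← h, interior_region_zero]; trivial
  · unfold M; rw [interior_region h]; exact hx

lemma mem_M (D : InitialData n) {x : E n} (hx : D.r₀ ≤ ‖x‖) : x ∈ D.M := hx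

/-- `√g₁₁` along the axis `i`. -/
def profileA (D : InitialData n) (i : Fin n) (r : ℝ) : ℝ := Real.sqrt (D.g (axisPoint i r) i i)

/-- `ρ(r)/r` along the axis `i`, read off from the component `gⱼⱼ`. -/
def profileB (D : InitialData n) (i j : Fin n) (r : ℝ) : ℝ := Real.sqrt (D.g (axisPoint i r) j j)

/-- The area radius `ρ`. -/
def profileRho (D : InitialData n) (i j : Fin n) (r : ℝ) : ℝ := r * D.profileB i j r

/-- The normal component of `k`. -/
def profileKn (D : InitialData n) (i : Fin n) (r : ℝ) : ℝ :=
  D.k (axisPoint i r) i i / D.g (axisPoint i r) i i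

/-- The tangential component of `k`. -/
def profileKt (D : InitialData n) (i j : Fin n) (r : ℝ) : ℝ :=
  D.k (axisPoint i r) j j / D.g (axisPoint i r) j j

lemma axisPoint_mem (D : InitialData n) (i : Fin n) {r : ℝ} (hr : D.r₀ ≤ |r|) :
    axisPoint i r ∈ region n D.r₀ := by
  simpa [region, norm_axisPoint] using hr

lemma g_axis_pos (D : InitialData n) (i j : Fin n) {r : ℝ} (hr : D.r₀ ≤ |r|) :
    0 < D.g (axisPoint i r) j j :=
  (D.g_posDef _ (D.axisPoint_mem i hr)).diag_pos

lemma contDiffAt_g_axis (D : InitialData n) (i j l : Fin n) {r : ℝ} (hr : D.r₀ ≤ |r|) :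
    ContDiffAt ℝ ∞ (fun r => D.g (axisPoint i r) j l) r :=
  ContDiffAt.comp r (D.g_smooth _ (D.axisPoint_mem i hr) j l) (contDiff_axisPoint i).contDiffAt

lemma contDiffAt_k_axis (D : InitialData n) (i j l : Fin n) {r : ℝ} (hr : D.r₀ ≤ |r|) :
    ContDiffAt ℝ ∞ (fun r => D.k (axisPoint i r) j l) r :=
  ContDiffAt.comp r (D.k_smooth _ (D.axisPoint_mem i hr) j l) (contDiff_axisPoint i).contDiffAt

lemma contDiffAt_profileA (D : InitialData n) (i : Fin n) {r : ℝ} (hr : D.r₀ ≤ |r|) :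
    ContDiffAt ℝ ∞ (D.profileA i) r :=
  (D.contDiffAt_g_axis i i i hr).sqrt (D.g_axis_pos i i hr).ne'

lemma contDiffAt_profileB (D : InitialData n) (i j : Fin n) {r : ℝ} (hr : D.r₀ ≤ |r|) :
    ContDiffAt ℝ ∞ (D.profileB i j) r :=
  (D.contDiffAt_g_axis i j j hr).sqrt (D.g_axis_pos i j hr).ne'

lemma contDiffAt_profileRho (D : InitialData n) (i j : Fin n) {r : ℝ} (hr : D.r₀ ≤ |r|) :
    ContDiffAt ℝ ∞ (D.profileRho i j) r :=
  contDiffAt_id.mul (D.contDiffAt_profileB i j hr)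

lemma profileA_pos (D : InitialData n) (i : Fin n) {r : ℝ} (hr : D.r₀ ≤ |r|) :
    0 < D.profileA i r := Real.sqrt_pos.2 (D.g_axis_pos i i hr)

lemma profileB_pos (D : InitialData n) (i j : Fin n) {r : ℝ} (hr : D.r₀ ≤ |r|) :
    0 < D.profileB i j r := Real.sqrt_pos.2 (D.g_axis_pos i j hr)

lemma le_abs_of_lt (D : InitialData n) {r : ℝ} (hr : D.r₀ < r) : D.r₀ ≤ |r| :=
  hr.le.trans (le_abs_self r)

lemma contDiffOn_profileKn (D : InitialData n) (i : Fin n) :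
    ContDiffOn ℝ ∞ (D.profileKn i) (Ioi D.r₀) := fun _ hr =>
  ((D.contDiffAt_k_axis i i i (D.le_abs_of_lt hr)).div (D.contDiffAt_g_axis i i i (D.le_abs_of_lt hr))
    (D.g_axis_pos i i (D.le_abs_of_lt hr)).ne').contDiffWithinAt

lemma contDiffOn_profileKt (D : InitialData n) (i j : Fin n) :
    ContDiffOn ℝ ∞ (D.profileKt i j) (Ioi D.r₀) := fun _ hr =>
  ((D.contDiffAt_k_axis i j j (D.le_abs_of_lt hr)).div (D.contDiffAt_g_axis i j j (D.le_abs_of_lt hr))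
    (D.g_axis_pos i j (D.le_abs_of_lt hr)).ne').contDiffWithinAt

/-- The functions supplied by spherical symmetry need be neither smooth nor, for `ρ`, positive. At a
point of the axis `i` the component `gᵢᵢ` is `g₁₁` and `gⱼⱼ` is `(ρ/r)²`, so the values along the
axis provide smooth positive profiles. -/
lemma SphericallySymmetric.radial {D : InitialData n} (h : D.SphericallySymmetric) {i j : Fin n}
    (hij : i ≠ j) :
    IsRadialMetric D.g D.r₀ (D.profileA i) (D.profileRho i j) ∧
      IsRadialTensor D.k D.r₀ (D.profileA i) (D.profileRho i j) (D.profileKn i)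
        (D.profileKt i j) := by
  obtain ⟨g₁₁, ρ, kn, kt, H⟩ := h
  have key : ∀ r, D.r₀ < r → g₁₁ r = D.profileA i r ^ 2 ∧ ρ r ^ 2 = D.profileRho i j r ^ 2 ∧
      kn r = D.profileKn i r ∧ kt r = D.profileKt i j r := by
    intro r hr
    have hr0 : 0 < r := D.r₀_nonneg.trans_lt hr
    have hr' := D.le_abs_of_lt hr
    have hn : ‖axisPoint i r‖ = r := by rw [norm_axisPoint, abs_of_pos hr0]
    have hx0 : axisPoint i r ≠ 0 := norm_ne_zero_iff.1 (by rw [hn]; exact hr0.ne')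
    have hM := D.mem_M (x := axisPoint i r) (by rw [hn]; exact hr.le)
    have hi : (axisPoint i r) i = r := by simp [axisPoint]
    have hj : (axisPoint i r) j = 0 := by simp [axisPoint, hij.symm]
    have h1 := H _ hM hx0 i i
    have h2 := H _ hM hx0 j j
    rw [hn, hi, Matrix.one_apply_eq, div_self hr0.ne'] at h1
    rw [hn, hj, Matrix.one_apply_eq] at h2
    have pA := D.g_axis_pos i i hr'
    have pB := D.g_axis_pos i j hr'
    have e1 : g₁₁ r = D.g (axisPoint i r) i i := by rw [h1.1]; ring
    have e2 : ρ r ^ 2 = r ^ 2 * D.g (axisPoint i r) j j := by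
      rw [h2.1]; field_simp; ring
    refine ⟨?_, ?_, ?_, ?_⟩
    · rw [e1, profileA, Real.sq_sqrt pA.le]
    · rw [e2, profileRho, profileB, mul_pow, Real.sq_sqrt pB.le]
    · have hsq : Real.sqrt (g₁₁ r) * Real.sqrt (g₁₁ r) = g₁₁ r :=
        Real.mul_self_sqrt (by rw [e1]; exact pA.le)
      have h3 := h1.2
      rw [profileKn, eq_div_iff pA.ne', h3]
      have : Real.sqrt (g₁₁ r) * 1 * (Real.sqrt (g₁₁ r) * 1) = D.g (axisPoint i r) i i := by
        rw [mul_one, hsq, e1]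
      rw [this]; ring
    · have h3 := h2.2
      rw [profileKt, eq_div_iff pB.ne', h3]
      ring
  have hρ : ∀ r, D.r₀ < r → 0 < D.profileRho i j r := fun r hr =>
    mul_pos (D.r₀_nonneg.trans_lt hr) (D.profileB_pos i j (D.le_abs_of_lt hr))
  have hM : IsRadialMetric D.g D.r₀ (D.profileA i) (D.profileRho i j) := by
    refine ⟨D.r₀_nonneg, fun r hr => D.profileA_pos i (D.le_abs_of_lt hr), hρ,
      fun r hr => (D.contDiffAt_profileA i (D.le_abs_of_lt hr)).contDiffWithinAt,
      fun r hr => (D.contDiffAt_profileRho i j (D.le_abs_of_lt hr)).contDiffWithinAt, ?_⟩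
    intro x hx a b
    have hx' := (D.r₀_nonneg.trans_lt hx).ne'
    obtain ⟨k1, k2, -, -⟩ := key _ hx
    rw [(H x (D.mem_M hx.le) (norm_ne_zero_iff.1 hx') a b).1, k1, k2]
    field_simp
    ring
  refine ⟨hM, ?_⟩
  intro x hx a b
  have hx' := (D.r₀_nonneg.trans_lt hx).ne'
  obtain ⟨k1, -, k3, k4⟩ := key _ hx
  have hA := D.profileA_pos i (D.le_abs_of_lt hx)
  rw [(H x (D.mem_M hx.le) (norm_ne_zero_iff.1 hx') a b).2, k1, k3, k4, Real.sqrt_sq hA.le,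
    hM.eq x hx]
  field_simp
  ring

end InitialData

end

end SphericalData

namespace SphericalData

noncomputable section

/-! ### Monotonicity on half-lines -/

lemma monotoneOn_of_hasDerivAt {s : Set ℝ} (hs : Convex ℝ s) {f f' : ℝ → ℝ}
    (hf : ∀ r ∈ s, HasDerivAt f (f' r) r) (h0 : ∀ r ∈ s, 0 ≤ f' r) : MonotoneOn f s :=
  monotoneOn_of_deriv_nonneg hs (fun r hr => (hf r hr).continuousAt.continuousWithinAt)
    (fun r hr => (hf r (interior_subset hr)).differentiableAt.differentiableWithinAt)
    (fun r hr => by rw [(hf r (interior_subset hr)).deriv]; exact h0 r (interior_subset hr))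

lemma antitoneOn_of_hasDerivAt {s : Set ℝ} (hs : Convex ℝ s) {f f' : ℝ → ℝ}
    (hf : ∀ r ∈ s, HasDerivAt f (f' r) r) (h0 : ∀ r ∈ s, f' r ≤ 0) : AntitoneOn f s :=
  antitoneOn_of_deriv_nonpos hs (fun r hr => (hf r hr).continuousAt.continuousWithinAt)
    (fun r hr => (hf r (interior_subset hr)).differentiableAt.differentiableWithinAt)
    (fun r hr => by rw [(hf r (interior_subset hr)).deriv]; exact h0 r (interior_subset hr))

lemma eq_of_hasDerivAt_zero {s : Set ℝ} (hs : Convex ℝ s) {f : ℝ → ℝ}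
    (hf : ∀ r ∈ s, HasDerivAt f 0 r) {a b : ℝ} (ha : a ∈ s) (hb : b ∈ s) : f a = f b := by
  have h1 := monotoneOn_of_hasDerivAt hs hf fun _ _ => le_rfl
  have h2 := antitoneOn_of_hasDerivAt hs hf fun _ _ => le_rfl
  rcases le_total a b with h | h
  · exact le_antisymm (h1 ha hb h) (h2 ha hb h)
  · exact le_antisymm (h2 hb ha h) (h1 hb ha h)

/-- Optimising the weighted arithmetic–geometric mean inequality over `t` recovers Cauchy–Schwarz.
For `x, p > 0` the choice `t = x/p` suffices; the other choices of `t` treat `x = 0` and `p = 0`,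
without a sign assumption on `q`. -/
lemma sq_le_of_forall_pos_le {x p q : ℝ} (hx : 0 ≤ x) (hp : 0 ≤ p)
    (h : ∀ t > 0, x ≤ (t * p + t⁻¹ * q) / 2) : x ^ 2 ≤ p * q := by
  rcases hx.eq_or_lt with rfl | hx
  · rcases hp.eq_or_lt with rfl | hp
    · simp
    · have hq : 0 ≤ q := by
        by_contra hq
        push Not at hq
        have ht : 0 < (-q / p) / (1 + (-q / p)) := by
          have : 0 < -q / p := div_pos (by linarith) hp
          positivity
        set a := -q / p with ha
        have ha0 : 0 < a := div_pos (by linarith) hp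
        have hqa : q = -(a * p) := by rw [ha]; field_simp
        have h1 := h _ ht
        rw [hqa, inv_div] at h1
        have h2 : a / (1 + a) * p + (1 + a) / a * -(a * p) = (a / (1 + a) - (1 + a)) * p := by
          field_simp
          ring
        have h3 : a / (1 + a) < 1 := by rw [div_lt_one (by positivity)]; linarith
        nlinarith
      simpa using mul_nonneg hp.le hq
  · rcases hp.eq_or_lt with rfl | hp
    · exfalso
      have ht : 0 < (|q| + 1) / x := by positivity
      have h1 := h _ ht
      rw [inv_div, mul_zero, zero_add, le_div_iff₀ two_pos, div_mul_eq_mul_div,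
        le_div_iff₀ (by positivity)] at h1
      have h2 : x * 2 * (|q| + 1) ≤ x * |q| := h1.trans (by gcongr; exact le_abs_self q)
      have h3 : 0 ≤ x * |q| := by positivity
      nlinarith
    · have h1 := h (x / p) (by positivity)
      rw [inv_div, div_mul_cancel₀ _ hp.ne'] at h1
      have h2 : p / x * q = p * q / x := by ring
      rw [h2] at h1
      have h3 : x ≤ p * q / x := by linarith
      rw [le_div_iff₀ hx] at h3
      nlinarith

/-! ### Decay estimates from a monotone mass. -/

/-- A nonnegative increasing mass function `Z` on `(r₀, ∞)` with limit `e`, which dominates the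
derivative of `φ` as a function of the area radius `σ`. -/
structure DecayProfile (n : ℕ) (r₀ e : ℝ) (σ Z φ σ' Z' φ' : ℝ → ℝ) : Prop where
  two_lt : 3 ≤ n
  hσ : ∀ r ∈ Ioi r₀, HasDerivAt σ (σ' r) r
  hZ : ∀ r ∈ Ioi r₀, HasDerivAt Z (Z' r) r
  hφ : ∀ r ∈ Ioi r₀, HasDerivAt φ (φ' r) r
  σ_pos : ∀ r ∈ Ioi r₀, 0 < σ r
  σ'_pos : ∀ r ∈ Ioi r₀, 0 < σ' r
  riccati : ∀ r ∈ Ioi r₀, σ' r * Z r ^ 2 ≤ 2 * (Z' r * σ r ^ (n - 1))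
  control : ∀ r ∈ Ioi r₀, φ' r ^ 2 * σ r ^ (n - 1) ≤ ((n : ℝ) - 2) ^ 2 * (σ' r * Z' r)
  σ_zero : Tendsto σ (𝓝[>] r₀) (𝓝 0)
  σ_top : Tendsto σ atTop atTop
  Z_lim : Tendsto Z atTop (𝓝 e)
  φ_lim : Tendsto φ atTop (𝓝 0)

namespace DecayProfile

variable {n : ℕ} {r₀ e : ℝ} {σ Z φ σ' Z' φ' : ℝ → ℝ}

lemma cast_pos (h : DecayProfile n r₀ e σ Z φ σ' Z' φ') : 0 < (n : ℝ) - 2 := by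
  have : (3 : ℝ) ≤ n := by exact_mod_cast h.two_lt
  linarith

lemma Z'_nonneg (h : DecayProfile n r₀ e σ Z φ σ' Z' φ') {r : ℝ} (hr : r ∈ Ioi r₀) : 0 ≤ Z' r := by
  have h1 := h.riccati r hr
  have h2 : 0 ≤ σ' r * Z r ^ 2 := mul_nonneg (h.σ'_pos r hr).le (sq_nonneg _)
  have h3 : 0 < σ r ^ (n - 1) := pow_pos (h.σ_pos r hr) _
  by_contra hc
  push Not at hc
  nlinarith [mul_neg_of_neg_of_pos hc h3]

lemma Z_mono (h : DecayProfile n r₀ e σ Z φ σ' Z' φ') : MonotoneOn Z (Ioi r₀) :=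
  monotoneOn_of_hasDerivAt (convex_Ioi r₀) h.hZ fun _ hr => h.Z'_nonneg hr

lemma hasDerivAt_inv_pow (h : DecayProfile n r₀ e σ Z φ σ' Z' φ') {r : ℝ} (hr : r ∈ Ioi r₀) :
    HasDerivAt (fun r => (σ r ^ (n - 2))⁻¹) (-(((n : ℝ) - 2) * (σ' r / σ r ^ (n - 1)))) r := by
  have hs := (h.σ_pos r hr).ne'
  obtain ⟨m, rfl⟩ : ∃ m, n = m + 3 := ⟨n - 3, by have := h.two_lt; omega⟩
  refine (((h.hσ r hr).fun_pow _).fun_inv (pow_ne_zero _ hs)).congr_deriv ?_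
  have e1 : m + 3 - 2 = m + 1 := rfl
  have e2 : m + 3 - 1 = m + 2 := rfl
  simp only [e1, e2, Nat.add_sub_cancel]
  push_cast
  field_simp
  ring

/-- If `Z` is negative at `r`, monotonicity keeps it negative all the way inwards. The Riccati
inequality then says that `-1/Z + σ^{2-n}/(2(n-2))` is nondecreasing on `(r₀, r]`. But `-1/Z > 0`
and `σ^{2-n} → ∞` at the inner end, a contradiction. -/
lemma Z_nonneg (h : DecayProfile n r₀ e σ Z φ σ' Z' φ') {r : ℝ} (hr : r ∈ Ioi r₀) : 0 ≤ Z r := by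
  by_contra hneg
  push Not at hneg
  have hn := h.cast_pos
  have hZneg : ∀ t ∈ Ioc r₀ r, Z t < 0 := fun t ht =>
    (h.Z_mono ht.1 hr ht.2).trans_lt hneg
  have hmono : MonotoneOn (fun t => -(Z t)⁻¹ + (2 * ((n : ℝ) - 2))⁻¹ * (σ t ^ (n - 2))⁻¹)
      (Ioc r₀ r) := by
    refine monotoneOn_of_hasDerivAt (convex_Ioc r₀ r) (f' := fun t => Z' t / Z t ^ 2
      + (2 * ((n : ℝ) - 2))⁻¹ * -(((n : ℝ) - 2) * (σ' t / σ t ^ (n - 1)))) (fun t ht => ?_)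
      (fun t ht => ?_)
    · refine (((h.hZ t ht.1).fun_inv (hZneg t ht).ne).fun_neg.fun_add
        ((h.hasDerivAt_inv_pow ht.1).const_mul _)).congr_deriv ?_
      ring
    · have hz : 0 < Z t ^ 2 := by have := (hZneg t ht).ne; positivity
      have hs : 0 < σ t ^ (n - 1) := pow_pos (h.σ_pos t ht.1) _
      have : (2 * ((n : ℝ) - 2))⁻¹ * -(((n : ℝ) - 2) * (σ' t / σ t ^ (n - 1)))
          = -(σ' t / (2 * σ t ^ (n - 1))) := by
        field_simp
      rw [this, ← sub_eq_add_neg, sub_nonneg, div_le_div_iff₀ (by positivity) hz]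
      linarith [h.riccati t ht.1]
  have hlim : Tendsto (fun t => (2 * ((n : ℝ) - 2))⁻¹ * (σ t ^ (n - 2))⁻¹) (𝓝[>] r₀) atTop := by
    refine Tendsto.const_mul_atTop (by positivity) ?_
    have h1 : Tendsto (fun t => σ t ^ (n - 2)) (𝓝[>] r₀) (𝓝[>] 0) := by
      refine tendsto_nhdsWithin_iff.2 ⟨?_, ?_⟩
      · have := h.σ_zero.pow (n - 2)
        rwa [zero_pow (by have := h.two_lt; omega)] at this
      · filter_upwards [self_mem_nhdsWithin] with t ht using pow_pos (h.σ_pos t ht) _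
    exact h1.inv_tendsto_nhdsGT_zero
  have hev := hlim.eventually_gt_atTop
    (-(Z r)⁻¹ + (2 * ((n : ℝ) - 2))⁻¹ * (σ r ^ (n - 2))⁻¹)
  have hIoc : Ioc r₀ r ∈ 𝓝[>] r₀ := Ioc_mem_nhdsGT hr
  obtain ⟨t, ht1, ht2⟩ := (hev.and hIoc).exists
  have h1 := hmono ht2 (right_mem_Ioc.2 hr) ht2.2
  have h2 : 0 < -(Z t)⁻¹ := by
    have := inv_lt_zero.2 (hZneg t ht2); linarith
  simp only at h1
  linarith

lemma Z_le (h : DecayProfile n r₀ e σ Z φ σ' Z' φ') {r : ℝ} (hr : r ∈ Ioi r₀) : Z r ≤ e := by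
  refine ge_of_tendsto h.Z_lim ?_
  filter_upwards [eventually_ge_atTop r] with t ht
  exact h.Z_mono hr (lt_of_lt_of_le hr ht : r₀ < t) ht

lemma e_nonneg (h : DecayProfile n r₀ e σ Z φ σ' Z' φ') : 0 ≤ e := by
  have hr : r₀ + 1 ∈ Ioi r₀ := by simp
  exact (h.Z_nonneg hr).trans (h.Z_le hr)

lemma σ_strictMono (h : DecayProfile n r₀ e σ Z φ σ' Z' φ') : StrictMonoOn σ (Ioi r₀) :=
  strictMonoOn_of_deriv_pos (convex_Ioi r₀)
    (fun r hr => (h.hσ r hr).continuousAt.continuousWithinAt)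
    (fun r hr => by
      have hr' := interior_subset hr
      rw [(h.hσ r hr').deriv]; exact h.σ'_pos r hr')

/-- This is the arithmetic–geometric mean inequality for the product on the right of `control`, with
a free weight `t` to be optimised after integration. -/
lemma abs_φ'_le (h : DecayProfile n r₀ e σ Z φ σ' Z' φ') {r t : ℝ} (hr : r ∈ Ioi r₀) (ht : 0 < t) :
    |φ' r| ≤ ((n : ℝ) - 2) / 2 * (t * Z' r + t⁻¹ * (σ' r / σ r ^ (n - 1))) := by
  have hn := h.cast_pos
  have hZ := h.Z'_nonneg hr
  have hs := h.σ_pos r hr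
  have hs' := h.σ'_pos r hr
  refine abs_le_of_sq_le_sq ?_ (by positivity)
  have h1 : φ' r ^ 2 ≤ ((n : ℝ) - 2) ^ 2 * (σ' r / σ r ^ (n - 1) * Z' r) := by
    have := h.control r hr
    rw [← le_div_iff₀ (pow_pos hs _)] at this
    refine this.trans (le_of_eq ?_)
    field_simp
  set q := σ' r / σ r ^ (n - 1) with hq
  have h2 : (t * Z' r + t⁻¹ * q) ^ 2 = (t * Z' r - t⁻¹ * q) ^ 2 + 4 * (q * Z' r) := by
    field_simp; ring
  rw [mul_pow, h2]
  nlinarith [sq_nonneg (((n : ℝ) - 2) * (t * Z' r - t⁻¹ * q))]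

/-- Integration is replaced by monotonicity of the majorant plus or minus `φ`. The term in `Z`
contributes at most `e` because `0 ≤ Z ≤ e`. `W` is any explicit majorant for the integral of
`σ'/σ^{n-1}`; the two choices made below give the Hölder bound and the decay bound. -/
lemma abs_sub_le_of_bound (h : DecayProfile n r₀ e σ Z φ σ' Z' φ') {a b t : ℝ} (ha : a ∈ Ioi r₀)
    (hab : a ≤ b) (ht : 0 < t) {W W' : ℝ → ℝ} (hW : ∀ r ∈ Ici a, HasDerivAt W (W' r) r)
    (hWle : ∀ r ∈ Ici a, σ' r / σ r ^ (n - 1) ≤ W' r) :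
    |φ b - φ a| ≤ ((n : ℝ) - 2) / 2 * (t * e + t⁻¹ * (W b - W a)) := by
  have hn := h.cast_pos
  have hsub : ∀ r ∈ Ici a, r ∈ Ioi r₀ := fun r hr => (mem_Ioi.1 ha).trans_le hr
  have hb : b ∈ Ioi r₀ := hsub b hab
  have hbd : ∀ r ∈ Ici a, |φ' r| ≤ ((n : ℝ) - 2) / 2 * (t * Z' r + t⁻¹ * W' r) := fun r hr => by
    refine (h.abs_φ'_le (hsub r hr) ht).trans ?_
    have := hWle r hr
    gcongr
  have hd : ∀ r ∈ Ici a, HasDerivAt (fun r => ((n : ℝ) - 2) / 2 * (t * Z r + t⁻¹ * W r))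
      (((n : ℝ) - 2) / 2 * (t * Z' r + t⁻¹ * W' r)) r := fun r hr =>
    (((h.hZ r (hsub r hr)).const_mul t).fun_add ((hW r hr).const_mul t⁻¹)).const_mul _
  have m1 := monotoneOn_of_hasDerivAt (convex_Ici a)
    (fun r hr => (hd r hr).fun_sub (h.hφ r (hsub r hr)))
    (fun r hr => by have := (abs_le.1 (hbd r hr)).2; linarith) self_mem_Ici hab hab
  have m2 := monotoneOn_of_hasDerivAt (convex_Ici a)
    (fun r hr => (hd r hr).fun_add (h.hφ r (hsub r hr)))
    (fun r hr => by have := (abs_le.1 (hbd r hr)).1; linarith) self_mem_Ici hab hab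
  have hZ : Z b - Z a ≤ e := by linarith [h.Z_le hb, h.Z_nonneg ha]
  have h3 : ((n : ℝ) - 2) / 2 * (t * Z b + t⁻¹ * W b) - ((n : ℝ) - 2) / 2 * (t * Z a + t⁻¹ * W a)
      ≤ ((n : ℝ) - 2) / 2 * (t * e + t⁻¹ * (W b - W a)) := by
    rw [← mul_sub]
    refine mul_le_mul_of_nonneg_left ?_ (by positivity)
    have := mul_le_mul_of_nonneg_left hZ ht.le
    linarith
  simp only at m1 m2
  exact abs_le.2 ⟨by linarith, by linarith⟩

/-- Hölder continuity of exponent `1/2` in the area radius. -/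
lemma sq_sub_le (h : DecayProfile n r₀ e σ Z φ σ' Z' φ') {a b : ℝ} (ha : a ∈ Ioi r₀)
    (hab : a ≤ b) :
    (φ b - φ a) ^ 2 * σ a ^ (n - 1) ≤ ((n : ℝ) - 2) ^ 2 * e * (σ b - σ a) := by
  have hn := h.cast_pos
  have hsa := h.σ_pos a ha
  have hsub : ∀ r ∈ Ici a, r ∈ Ioi r₀ := fun r hr => (mem_Ioi.1 ha).trans_le hr
  have key : |φ b - φ a| ^ 2 ≤
      (((n : ℝ) - 2) * e) * (((n : ℝ) - 2) * ((σ b - σ a) / σ a ^ (n - 1))) := by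
    refine sq_le_of_forall_pos_le (abs_nonneg _) (mul_nonneg hn.le h.e_nonneg) fun t ht => ?_
    -- On `[a, ∞)` the weight `σ^{n-1}` is at least its value at `a`, so a majorant linear in `σ`
    -- works.
    have := h.abs_sub_le_of_bound ha hab ht (W := fun r => σ r / σ a ^ (n - 1))
      (fun r hr => (h.hσ r (hsub r hr)).div_const _) (fun r hr => by
        have h1 := h.σ_strictMono.monotoneOn ha (hsub r hr) hr
        have h2 := h.σ'_pos r (hsub r hr)
        gcongr)
    refine this.trans (le_of_eq ?_)
    ring
  rw [sq_abs] at key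
  calc (φ b - φ a) ^ 2 * σ a ^ (n - 1)
      ≤ (((n : ℝ) - 2) * e) * (((n : ℝ) - 2) * ((σ b - σ a) / σ a ^ (n - 1))) * σ a ^ (n - 1) := by
        gcongr
    _ = ((n : ℝ) - 2) ^ 2 * e * (σ b - σ a) := by field_simp

/-- Pointwise decay in the area radius. -/
lemma sq_le (h : DecayProfile n r₀ e σ Z φ σ' Z' φ') {a : ℝ} (ha : a ∈ Ioi r₀) :
    φ a ^ 2 * σ a ^ (n - 2) ≤ ((n : ℝ) - 2) * e := by
  have hn := h.cast_pos
  have hsa := h.σ_pos a ha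
  have hsub : ∀ r ∈ Ici a, r ∈ Ioi r₀ := fun r hr => (mem_Ioi.1 ha).trans_le hr
  have key : |φ a| ^ 2 ≤ (((n : ℝ) - 2) * e) * (σ a ^ (n - 2))⁻¹ := by
    refine sq_le_of_forall_pos_le (abs_nonneg _) (mul_nonneg hn.le h.e_nonneg) fun t ht => ?_
    -- The bound is proved between `a` and `b` and passed to the limit `b → ∞`, where `φ` vanishes.
    have hlim : Tendsto (fun b => |φ b - φ a|) atTop (𝓝 |0 - φ a|) :=
      (h.φ_lim.sub_const _).abs
    rw [zero_sub, abs_neg] at hlim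
    refine le_of_tendsto hlim ?_
    filter_upwards [eventually_ge_atTop a] with b hab
    have hb := hsub b hab
    -- Here `W` is the exact antiderivative of `σ'/σ^{n-1}`, which stays bounded at infinity.
    have := h.abs_sub_le_of_bound ha hab ht (W := fun r => -((n : ℝ) - 2)⁻¹ * (σ r ^ (n - 2))⁻¹)
      (fun r hr => (h.hasDerivAt_inv_pow (hsub r hr)).const_mul _) (fun r hr => by
        refine le_of_eq ?_
        field_simp)
    refine this.trans ?_
    have h1 : 0 < (σ b ^ (n - 2))⁻¹ := inv_pos.2 (pow_pos (h.σ_pos b hb) _)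
    have e1 : ((n : ℝ) - 2) / 2 * (t * e + t⁻¹ * (-((n : ℝ) - 2)⁻¹ * (σ b ^ (n - 2))⁻¹
        - -((n : ℝ) - 2)⁻¹ * (σ a ^ (n - 2))⁻¹)) =
        (t * (((n : ℝ) - 2) * e) + t⁻¹ * (σ a ^ (n - 2))⁻¹) / 2 - t⁻¹ * (σ b ^ (n - 2))⁻¹ / 2 := by
      field_simp
      ring
    rw [e1]
    have : 0 < t⁻¹ * (σ b ^ (n - 2))⁻¹ := by positivity
    linarith
  rw [sq_abs] at key
  calc φ a ^ 2 * σ a ^ (n - 2) ≤ (((n : ℝ) - 2) * e) * (σ a ^ (n - 2))⁻¹ * σ a ^ (n - 2) := by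
        gcongr
    _ = ((n : ℝ) - 2) * e := by field_simp

end DecayProfile

end

end SphericalData

/-! ### The radial system: flatness and monotonicity of the mass. -/

namespace SphericalData

noncomputable section

/-- The radial form of the Jang equation, of the dominant energy condition and of the equation for
the conformal factor, for the radial profiles of a spherically symmetric initial data set. -/
structure JangSystem (n : ℕ) (r₀ : ℝ) (A ρ kn kt F U : ℝ → ℝ) : Prop where
  three_le : 3 ≤ n
  A_pos : ∀ r, r₀ < r → 0 < A r
  ρ_pos : ∀ r, r₀ < r → 0 < ρ r
  U_pos : ∀ r, r₀ < r → 0 < U r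
  A_smooth : ContDiffOn ℝ ∞ A (Ioi r₀)
  ρ_smooth : ContDiffOn ℝ ∞ ρ (Ioi r₀)
  kt_smooth : ContDiffOn ℝ ∞ kt (Ioi r₀)
  F_smooth : ContDiffOn ℝ ∞ F (Ioi r₀)
  U_smooth : ContDiffOn ℝ ∞ U (Ioi r₀)
  jang : ∀ r, r₀ < r →
    ((n : ℝ) - 1) * (deriv F r * deriv ρ r / (A r * ρ r * jangA A F r) - kt r)
      + (A r * deriv (deriv F) r - deriv F r * deriv A r) / jangA A F r ^ 3
      - A r ^ 2 * kn r / jangA A F r ^ 2 = 0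
  dec : ∀ r, r₀ < r →
    2 * (|((n : ℝ) - 1) * (deriv ρ r / ρ r * (kn r - kt r) - deriv kt r)| / A r) ≤
      ((n : ℝ) - 1) * (((n : ℝ) - 2) * (1 - (deriv ρ r / A r) ^ 2) / ρ r ^ 2
        - 2 * (deriv (deriv ρ) r - deriv ρ r * deriv A r / A r) / (A r ^ 2 * ρ r))
      + ((n : ℝ) - 1) * (2 * kn r * kt r + ((n : ℝ) - 2) * kt r ^ 2)
  conf : ∀ r, r₀ < r →
    ((n : ℝ) - 1) * (deriv U r * deriv ρ r / (jangA A F r ^ 2 * ρ r))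
      + (deriv (deriv U) r - deriv U r * deriv (jangA A F) r / jangA A F r) / jangA A F r ^ 2
      - ((n : ℝ) - 2) / (4 * ((n : ℝ) - 1)) * (((n : ℝ) - 1) *
        (((n : ℝ) - 2) * (1 - (deriv ρ r / jangA A F r) ^ 2) / ρ r ^ 2
        - 2 * (deriv (deriv ρ) r - deriv ρ r * deriv (jangA A F) r / jangA A F r)
          / (jangA A F r ^ 2 * ρ r))) * U r = 0

/-- The area radius `σ = u^{2/(n-2)} ρ` of the conformal metric. -/
def areaRadius (n : ℕ) (ρ U : ℝ → ℝ) (r : ℝ) : ℝ := U r ^ (2 / ((n : ℝ) - 2)) * ρ r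

/-- The derivative of `σ` with respect to the arc length of the conformal metric. -/
def areaSlope (n : ℕ) (A ρ F U : ℝ → ℝ) (r : ℝ) : ℝ :=
  deriv ρ r / jangA A F r + 2 / ((n : ℝ) - 2) * (ρ r * deriv U r / (jangA A F r * U r))

/-- The expansion of the symmetry spheres in the direction of the Jang graph. -/
def boostedSlope (A ρ kt F : ℝ → ℝ) (r : ℝ) : ℝ :=
  deriv ρ r * jangA A F r / A r ^ 2 - ρ r * kt r * deriv F r / A r

/-- The quasilocal mass whose monotonicity follows from the Jang equation and the dominant energy
condition. -/
def jangMass (n : ℕ) (A ρ kt F U : ℝ → ℝ) (r : ℝ) : ℝ :=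
  areaRadius n ρ U r ^ (n - 2) * (1 - boostedSlope A ρ kt F r)

namespace JangSystem

variable {n : ℕ} {r₀ : ℝ} {A ρ kn kt F U : ℝ → ℝ}

lemma cast_pos (h : JangSystem n r₀ A ρ kn kt F U) : 0 < (n : ℝ) - 2 := by
  have : (3 : ℝ) ≤ n := by exact_mod_cast h.three_le
  linarith

lemma jangA_pos (h : JangSystem n r₀ A ρ kn kt F U) {r : ℝ} (hr : r₀ < r) : 0 < jangA A F r :=
  Real.sqrt_pos.2 (by have := h.A_pos r hr; positivity)

lemma hasDerivAt_jangA (h : JangSystem n r₀ A ρ kn kt F U) {r : ℝ} (hr : r₀ < r) :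
    HasDerivAt (jangA A F) ((A r * deriv A r + deriv F r * deriv (deriv F) r) / jangA A F r) r := by
  have hA := h.A_pos r hr
  have dA := ContDiffOn.hasDerivAt_Ioi h.A_smooth hr
  have dF := ContDiffOn.hasDerivAt_Ioi (ContDiffOn.deriv_Ioi h.F_smooth) hr
  have hp : A r ^ 2 + deriv F r ^ 2 ≠ 0 := by positivity
  refine (((dA.fun_pow 2).fun_add (dF.fun_pow 2)).sqrt hp).congr_deriv ?_
  have : Real.sqrt (A r ^ 2 + deriv F r ^ 2) = jangA A F r := rfl
  rw [this]
  have hB := (h.jangA_pos hr).ne'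
  norm_num
  field_simp

lemma areaRadius_pos (h : JangSystem n r₀ A ρ kn kt F U) {r : ℝ} (hr : r₀ < r) :
    0 < areaRadius n ρ U r :=
  mul_pos (Real.rpow_pos_of_pos (h.U_pos r hr) _) (h.ρ_pos r hr)

lemma hasDerivAt_areaRadius (h : JangSystem n r₀ A ρ kn kt F U) {r : ℝ} (hr : r₀ < r) :
    HasDerivAt (areaRadius n ρ U)
      (areaRadius n ρ U r * areaSlope n A ρ F U r * jangA A F r / ρ r) r := by
  have hU := h.U_pos r hr
  have dU := ContDiffOn.hasDerivAt_Ioi h.U_smooth hr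
  have dρ := ContDiffOn.hasDerivAt_Ioi h.ρ_smooth hr
  have hρ := (h.ρ_pos r hr).ne'
  have hB := (h.jangA_pos hr).ne'
  have hn := h.cast_pos.ne'
  refine ((dU.rpow_const (p := 2 / ((n : ℝ) - 2)) (Or.inl hU.ne')).fun_mul dρ).congr_deriv ?_
  rw [Real.rpow_sub_one hU.ne', areaRadius, areaSlope]
  have hU' := hU.ne'
  field_simp
  ring

/-- Scalar flatness of the conformal metric. -/
lemma hasDerivAt_areaSlope (h : JangSystem n r₀ A ρ kn kt F U) {r : ℝ} (hr : r₀ < r) :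
    HasDerivAt (areaSlope n A ρ F U) (((n : ℝ) - 2) * jangA A F r / (2 * ρ r)
      * (1 - areaSlope n A ρ F U r ^ 2)) r := by
  have hU := (h.U_pos r hr).ne'
  have dU := ContDiffOn.hasDerivAt_Ioi h.U_smooth hr
  have dU2 := ContDiffOn.hasDerivAt_Ioi (ContDiffOn.deriv_Ioi h.U_smooth) hr
  have dρ := ContDiffOn.hasDerivAt_Ioi h.ρ_smooth hr
  have dρ2 := ContDiffOn.hasDerivAt_Ioi (ContDiffOn.deriv_Ioi h.ρ_smooth) hr
  have dB : HasDerivAt (jangA A F) (deriv (jangA A F) r) r :=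
    (h.hasDerivAt_jangA hr).differentiableAt.hasDerivAt
  have hρ := (h.ρ_pos r hr).ne'
  have hB := (h.jangA_pos hr).ne'
  have hn := h.cast_pos.ne'
  have hn1 : (n : ℝ) - 1 ≠ 0 := by have := h.cast_pos; linarith
  refine ((dρ2.fun_div dB hB).fun_add (((dρ.fun_mul dU2).fun_div (dB.fun_mul dU)
    (mul_ne_zero hB hU)).const_mul (2 / ((n : ℝ) - 2)))).congr_deriv ?_
  have hc := h.conf r hr
  have e : deriv (deriv U) r = deriv U r * deriv (jangA A F) r / jangA A F r
      - ((n : ℝ) - 1) * (deriv U r * deriv ρ r / ρ r)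
      + ((n : ℝ) - 2) / 4 * (((n : ℝ) - 2) * (jangA A F r ^ 2 - deriv ρ r ^ 2) / ρ r ^ 2
        - 2 * (deriv (deriv ρ) r - deriv ρ r * deriv (jangA A F) r / jangA A F r) / ρ r) * U r := by
    -- Multiplying the conformal equation by `B²` isolates `U''`.
    have h2 : jangA A F r ^ 2 * (((n : ℝ) - 1) * (deriv U r * deriv ρ r / (jangA A F r ^ 2 * ρ r))
      + (deriv (deriv U) r - deriv U r * deriv (jangA A F) r / jangA A F r) / jangA A F r ^ 2
      - ((n : ℝ) - 2) / (4 * ((n : ℝ) - 1)) * (((n : ℝ) - 1) *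
        (((n : ℝ) - 2) * (1 - (deriv ρ r / jangA A F r) ^ 2) / ρ r ^ 2
        - 2 * (deriv (deriv ρ) r - deriv ρ r * deriv (jangA A F) r / jangA A F r)
          / (jangA A F r ^ 2 * ρ r))) * U r) = 0 := by rw [hc, mul_zero]
    rw [← sub_eq_zero, ← h2]
    field_simp
    ring
  rw [e, areaSlope]
  field_simp
  ring

/-- Since `σ' = σ τ B/ρ` and `τ' = (n-2) B (1 - τ²)/(2ρ)`, the two terms of the product rule cancel.
The constant is twice the mass of a Schwarzschild metric. -/
lemma exists_const (h : JangSystem n r₀ A ρ kn kt F U) :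
    ∃ c : ℝ, ∀ r, r₀ < r →
      areaRadius n ρ U r ^ (n - 2) * (1 - areaSlope n A ρ F U r ^ 2) = c := by
  have hd : ∀ r ∈ Ioi r₀, HasDerivAt (fun r => areaRadius n ρ U r ^ (n - 2) *
      (1 - areaSlope n A ρ F U r ^ 2)) 0 r := by
    intro r hr
    have hρ := (h.ρ_pos r hr).ne'
    obtain ⟨m, rfl⟩ : ∃ m, n = m + 3 := ⟨n - 3, by have := h.three_le; omega⟩
    refine (((h.hasDerivAt_areaRadius hr).fun_pow _).fun_mul
      (((h.hasDerivAt_areaSlope hr).fun_pow 2).const_sub 1)).congr_deriv ?_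
    have e1 : m + 3 - 2 = m + 1 := rfl
    simp only [e1, Nat.add_sub_cancel]
    push_cast
    field_simp
    ring
  exact ⟨_, fun r hr => eq_of_hasDerivAt_zero (convex_Ioi r₀) hd hr
    (show r₀ + 1 ∈ Ioi r₀ by simp)⟩

/-- Otherwise `σ` would be nonincreasing on a half-line, yet it tends to infinity. -/
lemma not_areaSlope_nonpos (h : JangSystem n r₀ A ρ kn kt F U)
    (hσ : Tendsto (areaRadius n ρ U) atTop atTop) {r₁ : ℝ} (h1 : r₀ < r₁) :
    ¬ ∀ r ∈ Ici r₁, areaSlope n A ρ F U r ≤ 0 := by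
  intro hneg
  have hanti : AntitoneOn (areaRadius n ρ U) (Ici r₁) :=
    antitoneOn_of_hasDerivAt (convex_Ici r₁) (fun r hr => h.hasDerivAt_areaRadius (h1.trans_le hr))
      fun r hr => by
        have hr' := h1.trans_le hr
        have a1 := h.areaRadius_pos hr'
        have a2 := h.jangA_pos hr'
        have a3 := h.ρ_pos r hr'
        have a4 := hneg r hr
        refine div_nonpos_of_nonpos_of_nonneg ?_ a3.le
        exact mul_nonpos_of_nonpos_of_nonneg (mul_nonpos_of_nonneg_of_nonpos a1.le a4) a2.le
  obtain ⟨r, hr1, hr2⟩ := ((hσ.eventually_gt_atTop (areaRadius n ρ U r₁)).and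
    (eventually_ge_atTop r₁)).exists
  exact absurd (hanti self_mem_Ici hr2 hr2) (not_le.2 hr1)

/-- Over a boundary where `F` blows up and `σ → 0`, the conformal metric has no negative mass. -/
lemma const_nonneg_of_blowUp (h : JangSystem n r₀ A ρ kn kt F U)
    (hσ : Tendsto (areaRadius n ρ U) atTop atTop) {c R : ℝ}
    (hc : ∀ r, r₀ < r → areaRadius n ρ U r ^ (n - 2) * (1 - areaSlope n A ρ F U r ^ 2) = c)
    (hR : ∀ᶠ r in 𝓝[>] r₀, ρ r ≤ R)
    (hF : Tendsto F (𝓝[>] r₀) atTop ∨ Tendsto F (𝓝[>] r₀) atBot) : 0 ≤ c := by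
  by_contra hneg
  push Not at hneg
  have hn := h.cast_pos
  set σ := areaRadius n ρ U with hσd
  set τ := areaSlope n A ρ F U with hτd
  have hτ1 : ∀ r, r₀ < r → 1 < τ r ^ 2 := by
    intro r hr
    have h1 := hc r hr
    have h2 : 0 < σ r ^ (n - 2) := pow_pos (h.areaRadius_pos hr) _
    by_contra h3
    push Not at h3
    have : 0 ≤ σ r ^ (n - 2) * (1 - τ r ^ 2) := mul_nonneg h2.le (by linarith)
    linarith
  have hτanti : AntitoneOn τ (Ioi r₀) :=
    antitoneOn_of_hasDerivAt (convex_Ioi r₀) (fun r hr => h.hasDerivAt_areaSlope hr) fun r hr => by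
      have a1 := h.jangA_pos hr
      have a2 := h.ρ_pos r hr
      have a3 := hτ1 r hr
      exact mul_nonpos_of_nonneg_of_nonpos (by positivity) (by linarith)
  have hτpos : ∀ r, r₀ < r → 0 < τ r := by
    intro r hr
    by_contra h3
    push Not at h3
    exact h.not_areaSlope_nonpos hσ hr fun t ht => (hτanti hr (hr.trans_le ht) ht).trans h3
  -- With `y = σ^{(n-2)/2}` the conserved quantity becomes `(y τ)² = y² - c`, which is at least `-c
  -- > 0` up to the inner end, even though `y` itself may tend to zero.
  set y : ℝ → ℝ := fun r => Real.sqrt (σ r ^ (n - 2)) with hy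
  have hyd : ∀ r, r₀ < r → HasDerivAt y (((n : ℝ) - 2) / 2 * (y r * τ r) * jangA A F r / ρ r) r := by
    intro r hr
    have hs := h.areaRadius_pos hr
    have hp : 0 < σ r ^ (n - 2) := pow_pos hs _
    have hρ := (h.ρ_pos r hr).ne'
    refine (((h.hasDerivAt_areaRadius hr).fun_pow (n - 2)).sqrt hp.ne').congr_deriv ?_
    obtain ⟨m, rfl⟩ : ∃ m, n = m + 3 := ⟨n - 3, by have := h.three_le; omega⟩
    have e1 : m + 3 - 2 = m + 1 := rfl
    have hy0 : y r ≠ 0 := (Real.sqrt_pos.2 hp).ne'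
    have hy2 : y r ^ 2 = σ r ^ (m + 1) := Real.sq_sqrt hp.le
    have : Real.sqrt (areaRadius (m + 3) ρ U r ^ (m + 3 - 2)) = y r := rfl
    rw [this]
    simp only [e1, Nat.add_sub_cancel, ← hσd, ← hτd]
    push_cast
    field_simp
    rw [hy2]
    ring
  have hyτ : ∀ r, r₀ < r → Real.sqrt (-c) ≤ y r * τ r := by
    intro r hr
    have hp : 0 < σ r ^ (n - 2) := pow_pos (h.areaRadius_pos hr) _
    refine Real.sqrt_le_iff.2 ⟨mul_nonneg (Real.sqrt_nonneg _) (hτpos r hr).le, ?_⟩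
    rw [mul_pow, Real.sq_sqrt hp.le]
    have := hc r hr
    nlinarith
  obtain ⟨r₁, h1, hR1⟩ : ∃ r₁, r₀ < r₁ ∧ ∀ r ∈ Ioc r₀ r₁, ρ r ≤ R := by
    obtain ⟨r₁, h1, h2⟩ := mem_nhdsGT_iff_exists_Ioc_subset.1 hR
    exact ⟨r₁, h1, h2⟩
  have hRpos : 0 < R := (h.ρ_pos r₁ h1).trans_le (hR1 r₁ ⟨h1, le_rfl⟩)
  -- This makes `y' ≥ κ B ≥ κ |F'|` wherever `ρ ≤ R`. Both `y + κ F` and `y - κ F` are then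
  -- nondecreasing, and since `y ≥ 0` the function `F` can diverge to neither `+∞` nor `-∞` at `r₀`.
  set κ := ((n : ℝ) - 2) / 2 * Real.sqrt (-c) / R with hκ
  have hκpos : 0 < κ := by
    have : 0 < Real.sqrt (-c) := Real.sqrt_pos.2 (by linarith)
    positivity
  have hbig : ∀ r ∈ Ioc r₀ r₁,
      κ * jangA A F r ≤ ((n : ℝ) - 2) / 2 * (y r * τ r) * jangA A F r / ρ r := by
    intro r hr
    have hρ := h.ρ_pos r hr.1
    have hB := h.jangA_pos hr.1
    have e1 : κ * jangA A F r = ((n : ℝ) - 2) / 2 * Real.sqrt (-c) * jangA A F r / R := by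
      rw [hκ]; ring
    have := hyτ r hr.1
    have := hR1 r hr
    have h0 : 0 ≤ y r * τ r := (Real.sqrt_nonneg _).trans (hyτ r hr.1)
    rw [e1]
    gcongr
  have habs : ∀ r, |deriv F r| ≤ jangA A F r := fun r =>
    Real.abs_le_sqrt (by nlinarith [sq_nonneg (A r)])
  have hdF : ∀ r ∈ Ioc r₀ r₁, HasDerivAt F (deriv F r) r := fun r hr =>
    ContDiffOn.hasDerivAt_Ioi h.F_smooth hr.1
  have hIoc : Ioc r₀ r₁ ∈ 𝓝[>] r₀ := Ioc_mem_nhdsGT h1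
  rcases hF with hF | hF
  · have hmono := monotoneOn_of_hasDerivAt (convex_Ioc r₀ r₁)
      (fun r hr => (hyd r hr.1).fun_add ((hdF r hr).const_mul κ)) fun r hr => by
        have a1 := hbig r hr
        have a2 := mul_le_mul_of_nonneg_left (neg_le_of_abs_le (habs r)) hκpos.le
        linarith
    obtain ⟨r, hr1, hr2⟩ := ((hF.eventually_gt_atTop ((y r₁ + κ * F r₁) / κ)).and hIoc).exists
    have h3 := hmono hr2 (right_mem_Ioc.2 h1) hr2.2
    have h4 : 0 ≤ y r := Real.sqrt_nonneg _
    rw [div_lt_iff₀ hκpos] at hr1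
    simp only at h3
    linarith
  · have hmono := monotoneOn_of_hasDerivAt (convex_Ioc r₀ r₁)
      (fun r hr => (hyd r hr.1).fun_sub ((hdF r hr).const_mul κ)) fun r hr => by
        have a1 := hbig r hr
        have a2 := mul_le_mul_of_nonneg_left (le_of_abs_le (habs r)) hκpos.le
        linarith
    obtain ⟨r, hr1, hr2⟩ := ((hF.eventually_lt_atBot (-(y r₁ - κ * F r₁) / κ)).and hIoc).exists
    have h3 := hmono hr2 (right_mem_Ioc.2 h1) hr2.2
    have h4 : 0 ≤ y r := Real.sqrt_nonneg _
    rw [lt_div_iff₀ hκpos] at hr1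
    simp only at h3
    linarith

/-- As `σ^{n-2} → 0`, the constant satisfies `c ≤ 0`, and a bound on `τ` or the blow-up of `F` gives
`c ≥ 0`. Once `c = 0`, `τ² = 1`, so the equation for `τ` makes it constant; the value `-1` is
incompatible with `σ → ∞`. -/
lemma areaSlope_eq_one (h : JangSystem n r₀ A ρ kn kt F U)
    (hσ0 : Tendsto (areaRadius n ρ U) (𝓝[>] r₀) (𝓝 0))
    (hσ : Tendsto (areaRadius n ρ U) atTop atTop)
    (hcase : (∃ κ : ℝ, ∀ᶠ r in 𝓝[>] r₀, |areaSlope n A ρ F U r| ≤ κ) ∨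
      ((∃ R : ℝ, ∀ᶠ r in 𝓝[>] r₀, ρ r ≤ R) ∧
        (Tendsto F (𝓝[>] r₀) atTop ∨ Tendsto F (𝓝[>] r₀) atBot)))
    {r : ℝ} (hr : r₀ < r) : areaSlope n A ρ F U r = 1 := by
  obtain ⟨c, hc⟩ := h.exists_const
  have hpow : Tendsto (fun r => areaRadius n ρ U r ^ (n - 2)) (𝓝[>] r₀) (𝓝 0) := by
    have := hσ0.pow (n - 2)
    rwa [zero_pow (by have := h.three_le; omega)] at this
  have hle : c ≤ 0 := by
    refine ge_of_tendsto hpow ?_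
    filter_upwards [self_mem_nhdsWithin] with t ht
    have h2 : 0 < areaRadius n ρ U t ^ (n - 2) := pow_pos (h.areaRadius_pos ht) _
    rw [← hc t ht]
    nlinarith [mul_nonneg h2.le (sq_nonneg (areaSlope n A ρ F U t))]
  have hge : 0 ≤ c := by
    rcases hcase with ⟨κ, hκ⟩ | ⟨⟨R, hR⟩, hF⟩
    · have hlim : Tendsto (fun r => areaRadius n ρ U r ^ (n - 2) * (1 - κ ^ 2)) (𝓝[>] r₀) (𝓝 0) := by
        simpa using hpow.mul_const (1 - κ ^ 2)
      refine le_of_tendsto hlim ?_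
      filter_upwards [self_mem_nhdsWithin, hκ] with t ht hκt
      have h2 : 0 < areaRadius n ρ U t ^ (n - 2) := pow_pos (h.areaRadius_pos ht) _
      rw [← hc t ht]
      have := sq_le_sq' (neg_le_of_abs_le hκt) (le_of_abs_le hκt)
      gcongr
    · exact h.const_nonneg_of_blowUp hσ hc hR hF
  have hc0 : c = 0 := le_antisymm hle hge
  have hsq : ∀ t, r₀ < t → areaSlope n A ρ F U t ^ 2 = 1 := by
    intro t ht
    have h1 := hc t ht
    rw [hc0] at h1
    have h2 : areaRadius n ρ U t ^ (n - 2) ≠ 0 := (pow_pos (h.areaRadius_pos ht) _).ne'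
    rcases mul_eq_zero.1 h1 with h3 | h3
    · exact absurd h3 h2
    · linarith
  have hconst : ∀ t ∈ Ioi r₀, areaSlope n A ρ F U t = areaSlope n A ρ F U r := fun t ht =>
    eq_of_hasDerivAt_zero (convex_Ioi r₀) (fun s hs => by
      have := h.hasDerivAt_areaSlope hs
      rwa [hsq s hs, sub_self, mul_zero] at this) ht hr
  have hfac : (areaSlope n A ρ F U r - 1) * (areaSlope n A ρ F U r + 1) = 0 := by
    linear_combination hsq r hr
  rcases mul_eq_zero.1 hfac with h1 | h1
  · linarith
  · refine absurd (fun t ht => ?_) (h.not_areaSlope_nonpos hσ hr)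
    rw [hconst t (hr.trans_le ht)]
    linarith

/-- This is a radial form of the Schoen–Yau identity. The Jang equation eliminates `F''`, the
dominant energy condition bounds the curvature terms, and the remainder is a square. Writing `h_t`
for the tangential second fundamental form of the graph, `G - ρ'/B = (F'/A) ρ (h_t - k_t)`. -/
lemma exists_boostedSlope_deriv (h : JangSystem n r₀ A ρ kn kt F U) {r : ℝ} (hr : r₀ < r) :
    ∃ G', HasDerivAt (boostedSlope A ρ kt F) G' r ∧
      ρ r * G' / jangA A F r ≤ ((n : ℝ) - 2) / 2 * (1 - boostedSlope A ρ kt F r ^ 2)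
        - n / 2 * (boostedSlope A ρ kt F r - deriv ρ r / jangA A F r) ^ 2 := by
  have hA := h.A_pos r hr
  have hρ := h.ρ_pos r hr
  have hB := h.jangA_pos hr
  have hn := h.cast_pos
  have dA := ContDiffOn.hasDerivAt_Ioi h.A_smooth hr
  have dρ := ContDiffOn.hasDerivAt_Ioi h.ρ_smooth hr
  have dρ2 := ContDiffOn.hasDerivAt_Ioi (ContDiffOn.deriv_Ioi h.ρ_smooth) hr
  have dk := ContDiffOn.hasDerivAt_Ioi h.kt_smooth hr
  have dF2 := ContDiffOn.hasDerivAt_Ioi (ContDiffOn.deriv_Ioi h.F_smooth) hr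
  have dB := h.hasDerivAt_jangA hr
  have hsq := jangA_sq A F r
  refine ⟨_, ((dρ2.fun_mul dB).fun_div (dA.fun_pow 2) (by positivity)).fun_sub
    (((dρ.fun_mul dk).fun_mul dF2).fun_div dA hA.ne'), ?_⟩
  have hj := h.jang r hr
  have hd := h.dec r hr
  set B := jangA A F r with hBd
  set a := A r
  set p := ρ r
  set a' := deriv A r
  set p' := deriv ρ r
  set p'' := deriv (deriv ρ) r
  set f' := deriv F r
  set f'' := deriv (deriv F) r
  set k := kt r
  set k' := deriv kt r
  set l := kn r
  set w := p' / p * (l - k) - k' with hw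
  have eF : f'' = (f' * a' + a ^ 2 * B * l - ((n : ℝ) - 1) * B ^ 2 * (f' * p' / (a * p) - B * k)) / a := by
    have h2 : B ^ 3 * (((n : ℝ) - 1) * (f' * p' / (a * p * B) - k) + (a * f'' - f' * a') / B ^ 3
      - a ^ 2 * l / B ^ 2) = 0 := by rw [hj, mul_zero]
    rw [← sub_eq_zero, ← mul_zero (1 / a), ← h2]
    field_simp
    ring
  have hdec : 2 * |w| / a ≤ ((n : ℝ) - 2) * (1 - (p' / a) ^ 2) / p ^ 2
        - 2 * (p'' - p' * a' / a) / (a ^ 2 * p) + (2 * l * k + ((n : ℝ) - 2) * k ^ 2) := by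
    have hn1 : 0 < (n : ℝ) - 1 := by linarith
    rw [abs_mul, abs_of_pos hn1, ← mul_add] at hd
    refine le_of_mul_le_mul_left (le_trans (le_of_eq ?_) hd) hn1
    ring
  -- The momentum density enters multiplied by the tilt `F'/B`, of modulus at most one, so `μ ≥ |J|`
  -- controls it whatever its sign.
  have hv : |f' / B| ≤ 1 := by
    rw [abs_div, abs_of_pos hB, div_le_one hB]
    exact Real.abs_le_sqrt (by nlinarith [sq_nonneg (A r)])
  have hvw : f' / B * w ≤ |w| := by
    calc f' / B * w ≤ |f' / B * w| := le_abs_self _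
      _ = |f' / B| * |w| := abs_mul _ _
      _ ≤ 1 * |w| := by gcongr
      _ = |w| := one_mul _
  have hfin : 0 ≤ p ^ 2 / 2 * (((n : ℝ) - 2) * (1 - (p' / a) ^ 2) / p ^ 2
        - 2 * (p'' - p' * a' / a) / (a ^ 2 * p) + (2 * l * k + ((n : ℝ) - 2) * k ^ 2)
        - 2 * (f' / B * w) / a) := by
    refine mul_nonneg (by positivity) ?_
    have : 2 * (f' / B * w) / a ≤ 2 * |w| / a := by gcongr
    linarith
  -- The difference of the two sides equals the slack in the energy condition plus `n/2` times the
  -- square of `ρ (h_t - k_t)`, modulo `F'² = B² - A²`.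
  refine le_of_sub_nonneg (le_of_le_of_eq
    (add_nonneg hfin (show 0 ≤ (n : ℝ) / 2 * (p' / a * (f' / B) - p * k) ^ 2 by positivity)) ?_)
  have hf2 : f' ^ 2 = B ^ 2 - a ^ 2 := by rw [hsq]; ring
  have eG : boostedSlope A ρ kt F r = p' * B / a ^ 2 - p * k * f' / a := rfl
  rw [eG, eF, hw]
  field_simp
  linear_combination (2 * n * a ^ 2 * p ^ 2 * B ^ 2 * k ^ 2 - 2 * a ^ 2 * p ^ 2 * B ^ 2 * k ^ 2
    + 2 * a * a' * p * p' - 2 * n * p' ^ 2 * B ^ 2 + 2 * p' ^ 2 * B ^ 2 + n * a ^ 2 * p' ^ 2) * hf2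

/-- The monotonicity formula for the quasilocal mass. -/
lemma exists_jangMass_deriv (h : JangSystem n r₀ A ρ kn kt F U)
    (hτ : ∀ r, r₀ < r → areaSlope n A ρ F U r = 1) {r : ℝ} (hr : r₀ < r) :
    ∃ Z', HasDerivAt (jangMass n A ρ kt F U) Z' r ∧
      areaRadius n ρ U r ^ (n - 2) * (jangA A F r / ρ r) *
        (((n : ℝ) - 2) / 2 * (1 - boostedSlope A ρ kt F r) ^ 2
          + n / 2 * (boostedSlope A ρ kt F r - deriv ρ r / jangA A F r) ^ 2) ≤ Z' := by
  obtain ⟨G', hG, hle⟩ := h.exists_boostedSlope_deriv hr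
  have hρ := h.ρ_pos r hr
  have hB := h.jangA_pos hr
  have hs := h.areaRadius_pos hr
  have hσ := h.hasDerivAt_areaRadius hr
  rw [hτ r hr, mul_one] at hσ
  -- The lower bound follows from `(n-2)(1 - G) - (n-2)/2 (1 - G²) = (n-2)/2 (1 - G)²`.
  refine ⟨areaRadius n ρ U r ^ (n - 2) * (jangA A F r / ρ r) *
    (((n : ℝ) - 2) * (1 - boostedSlope A ρ kt F r) - ρ r * G' / jangA A F r), ?_, ?_⟩
  · refine ((hσ.fun_pow (n - 2)).fun_mul (hG.const_sub 1)).congr_deriv ?_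
    obtain ⟨m, rfl⟩ : ∃ m, n = m + 3 := ⟨n - 3, by have := h.three_le; omega⟩
    have e1 : m + 3 - 2 = m + 1 := rfl
    simp only [e1, Nat.add_sub_cancel]
    push_cast
    field_simp
    ring
  · refine mul_le_mul_of_nonneg_left ?_ (by positivity)
    linarith

/-- The first square in the monotonicity formula gives the Riccati inequality. Both squares together
control `1 - X`, where `X = ρ'/B`, and by `τ = 1` this is the logarithmic derivative of `U` up to
the factor `(n-2)/2 · B/ρ`. -/
lemma decayProfile (h : JangSystem n r₀ A ρ kn kt F U)
    (hτ : ∀ r, r₀ < r → areaSlope n A ρ F U r = 1) {e : ℝ}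
    (hσ0 : Tendsto (areaRadius n ρ U) (𝓝[>] r₀) (𝓝 0))
    (hσ : Tendsto (areaRadius n ρ U) atTop atTop)
    (hZ : Tendsto (jangMass n A ρ kt F U) atTop (𝓝 e))
    (hU : Tendsto U atTop (𝓝 1)) :
    DecayProfile n r₀ e (areaRadius n ρ U) (jangMass n A ρ kt F U) (fun r => Real.log (U r))
      (fun r => areaRadius n ρ U r * jangA A F r / ρ r) (deriv (jangMass n A ρ kt F U))
      (fun r => ((n : ℝ) - 2) / 2 * (jangA A F r / ρ r * (1 - deriv ρ r / jangA A F r))) := by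
  have hZ' : ∀ r, r₀ < r → HasDerivAt (jangMass n A ρ kt F U) (deriv (jangMass n A ρ kt F U) r) r ∧
      areaRadius n ρ U r ^ (n - 2) * (jangA A F r / ρ r) *
        (((n : ℝ) - 2) / 2 * (1 - boostedSlope A ρ kt F r) ^ 2
          + n / 2 * (boostedSlope A ρ kt F r - deriv ρ r / jangA A F r) ^ 2) ≤
      deriv (jangMass n A ρ kt F U) r := by
    intro r hr
    obtain ⟨Z', h1, h2⟩ := h.exists_jangMass_deriv hτ hr
    rw [h1.deriv]
    exact ⟨h1, h2⟩
  have hn : (3 : ℝ) ≤ n := by exact_mod_cast h.three_le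
  have hpow : ∀ r, areaRadius n ρ U r ^ (n - 1) = areaRadius n ρ U r ^ (n - 2) * areaRadius n ρ U r := by
    intro r
    rw [← pow_succ]
    congr 1
    have := h.three_le
    omega
  refine ⟨h.three_le, fun r hr => ?_, fun r hr => (hZ' r hr).1, fun r hr => ?_,
    fun r hr => h.areaRadius_pos hr, fun r hr => ?_, fun r hr => ?_, fun r hr => ?_, hσ0, hσ, hZ, ?_⟩
  · have := h.hasDerivAt_areaRadius hr
    rwa [hτ r hr, mul_one] at this
  · have hU := h.U_pos r hr
    refine ((ContDiffOn.hasDerivAt_Ioi h.U_smooth hr).log hU.ne').congr_deriv ?_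
    have ht := hτ r hr
    rw [areaSlope] at ht
    have h1 : deriv ρ r / jangA A F r =
        1 - 2 / ((n : ℝ) - 2) * (ρ r * deriv U r / (jangA A F r * U r)) := by linarith
    have hB := (h.jangA_pos hr).ne'
    have hρ := (h.ρ_pos r hr).ne'
    have hn' := h.cast_pos.ne'
    rw [h1]
    field_simp
    ring
  · have h1 := h.areaRadius_pos hr
    have h2 := h.jangA_pos hr
    have h3 := h.ρ_pos r hr
    positivity
  · have h1 := h.areaRadius_pos hr
    have h2 := h.jangA_pos hr
    have h3 := h.ρ_pos r hr
    have h4 := (hZ' r hr).2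
    set σ := areaRadius n ρ U r
    set G := boostedSlope A ρ kt F r
    set q := jangA A F r / ρ r with hq
    have hq0 : 0 < q := by positivity
    have h5 : σ ^ (n - 2) * q * (1 / 2 * (1 - G) ^ 2) ≤ deriv (jangMass n A ρ kt F U) r := by
      refine le_trans ?_ h4
      refine mul_le_mul_of_nonneg_left ?_ (by positivity)
      nlinarith [sq_nonneg (1 - G), sq_nonneg (G - deriv ρ r / jangA A F r)]
    rw [hpow, show jangMass n A ρ kt F U r = σ ^ (n - 2) * (1 - G) from rfl, mul_div_assoc, ← hq]
    have h6 := mul_le_mul_of_nonneg_right h5 (show 0 ≤ σ ^ (n - 2) * σ by positivity)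
    linarith
  · have h1 := h.areaRadius_pos hr
    have h2 := h.jangA_pos hr
    have h3 := h.ρ_pos r hr
    have h4 := (hZ' r hr).2
    set σ := areaRadius n ρ U r
    set G := boostedSlope A ρ kt F r
    set X := deriv ρ r / jangA A F r
    set q := jangA A F r / ρ r with hq
    have hq0 : 0 < q := by positivity
    -- Each square has coefficient at least `1/2` because `n ≥ 3`, and `(1 - X)² ≤ 2 (1 - G)² + 2 (G
    -- - X)²`; hence the `1/4`.
    have h5 : σ ^ (n - 2) * q * (1 / 4 * (1 - X) ^ 2) ≤ deriv (jangMass n A ρ kt F U) r := by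
      refine le_trans ?_ h4
      refine mul_le_mul_of_nonneg_left ?_ (by positivity)
      nlinarith [sq_nonneg (1 - G), sq_nonneg (G - X), sq_nonneg ((1 - G) - (G - X))]
    rw [hpow, mul_div_assoc, ← hq]
    have h6 := mul_le_mul_of_nonneg_left h5 (show 0 ≤ ((n : ℝ) - 2) ^ 2 * (σ * q) by positivity)
    linarith
  · have := hU.log one_ne_zero
    rwa [Real.log_one] at this

end JangSystem

end

end SphericalData

/-! ### From initial data to the radial system. -/

namespace SphericalData

noncomputable section

variable {n : ℕ}

/-- The values of a function on a coordinate axis. -/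
def axisProfile (f : E n → ℝ) (i : Fin n) (r : ℝ) : ℝ := f (axisPoint i r)

lemma pd_sub_const (F : E n → ℝ) (c : ℝ) (i : Fin n) (x : E n) :
    pd i (fun y => F y - c) x = pd i F x := by
  unfold pd; rw [fderiv_sub_const]

lemma norm_axisPoint_of_pos (i : Fin n) {r : ℝ} (hr : 0 < r) : ‖axisPoint i r‖ = r := by
  rw [norm_axisPoint, abs_of_pos hr]

lemma axisPoint_same (i : Fin n) (r : ℝ) : (axisPoint i r) i = r := by simp [axisPoint]

lemma axisPoint_ne {i j : Fin n} (hij : i ≠ j) (r : ℝ) : (axisPoint i r) j = 0 := by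
  simp [axisPoint, hij.symm]

section

variable {D : InitialData n} {f u : E n → ℝ} {i j : Fin n}

lemma RadialOn.eq_axisProfile (h : RadialOn f (interior D.M)) (i : Fin n) {x : E n}
    (hx : D.r₀ < ‖x‖) : f x = axisProfile f i ‖x‖ := by
  have hn := norm_axisPoint_of_pos i (D.r₀_nonneg.trans_lt hx)
  exact h x (D.mem_interior hx) _ (D.mem_interior (by rwa [hn])) hn.symm

lemma contDiffAt_axisProfile (h : ContDiffOn ℝ ∞ f (interior D.M)) (i : Fin n) {r : ℝ}
    (hr : axisPoint i r ∈ interior D.M) : ContDiffAt ℝ ∞ (axisProfile f i) r :=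
  ContDiffAt.comp r (h.contDiffAt (isOpen_interior.mem_nhds hr)) (contDiff_axisPoint i).contDiffAt

lemma axisPoint_mem_interior (D : InitialData n) (i : Fin n) {r : ℝ} (hr : D.r₀ < r) :
    axisPoint i r ∈ interior D.M :=
  D.mem_interior (by rwa [norm_axisPoint_of_pos i (D.r₀_nonneg.trans_lt hr)])

lemma contDiffOn_axisProfile (h : ContDiffOn ℝ ∞ f (interior D.M)) (i : Fin n) :
    ContDiffOn ℝ ∞ (axisProfile f i) (Ioi D.r₀) := fun _ hr =>
  (contDiffAt_axisProfile h i (axisPoint_mem_interior D i hr)).contDiffWithinAt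

lemma jangSystem (hn : 3 ≤ n) (hij : i ≠ j) (hs : D.SphericallySymmetric) (hd : D.DominantEnergy)
    (hf : IsJangSolution D f) (hu : IsConformalFactor D f u) :
    JangSystem n D.r₀ (D.profileA i) (D.profileRho i j) (D.profileKn i) (D.profileKt i j)
      (axisProfile f i) (axisProfile u i) := by
  obtain ⟨hM, hk⟩ := hs.radial hij
  have hF := contDiffOn_axisProfile hf.smooth i
  have hU := contDiffOn_axisProfile hu.smooth i
  have eF : ∀ y : E n, D.r₀ < ‖y‖ → f y = axisProfile f i ‖y‖ := fun y hy =>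
    hf.radial.eq_axisProfile i hy
  have eU : ∀ y : E n, D.r₀ < ‖y‖ → u y = axisProfile u i ‖y‖ := fun y hy =>
    hu.radial.eq_axisProfile i hy
  have hJ := hM.jangMetric hF eF
  have key : ∀ r, D.r₀ < r → ‖axisPoint i r‖ = r := fun r hr =>
    norm_axisPoint_of_pos i (D.r₀_nonneg.trans_lt hr)
  refine ⟨hn, hM.A_pos, hM.ρ_pos, fun r hr => hu.pos _ (axisPoint_mem_interior D i hr),
    hM.A_smooth, hM.ρ_smooth, D.contDiffOn_profileKt i j, hF, hU, fun r hr => ?_, fun r hr => ?_,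
    fun r hr => ?_⟩
  · have hx : D.r₀ < ‖axisPoint i r‖ := by rwa [key r hr]
    have := hf.jang _ (D.mem_interior hx)
    rwa [hM.jangOperator_eq hk hF eF hx, key r hr] at this
  · have hx : D.r₀ < ‖axisPoint i r‖ := by rwa [key r hr]
    have h1 := hd _ (D.mem_M hx.le)
    have h2 := hM.energyDensity_eq hk hx
    have h3 := hM.momentumNorm_eq hk (D.contDiffOn_profileKn i) (D.contDiffOn_profileKt i j) hx
    rw [hM.scalarCurvature_eq hx] at h2
    rw [key r hr] at h2 h3
    rw [← h3, ← h2]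
    have := mul_le_mul_of_nonneg_left h1 (show 0 ≤ 16 * Real.pi by positivity)
    linarith
  · have hx : D.r₀ < ‖axisPoint i r‖ := by rwa [key r hr]
    have := hu.equation _ (D.mem_interior hx)
    rwa [hJ.laplacian_eq hU eU hx, hJ.scalarCurvature_eq hx, key r hr] at this

/-! ### Behaviour at infinity -/

lemma tendsto_const_div_pow {m : ℕ} (hm : m ≠ 0) (c : ℝ) :
    Tendsto (fun r : ℝ => c / r ^ m) atTop (𝓝 0) :=
  tendsto_const_nhds.div_atTop (tendsto_pow_atTop hm)

variable {ρ₀ C : ℝ}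

lemma profileRho_div (D : InitialData n) (i j : Fin n) {r : ℝ} (hr : r ≠ 0) :
    D.profileRho i j r / r = D.profileB i j r := by
  rw [InitialData.profileRho]; field_simp

lemma profileA_sq (D : InitialData n) (i : Fin n) {r : ℝ} (hr : D.r₀ ≤ |r|) :
    D.profileA i r ^ 2 = D.g (axisPoint i r) i i := Real.sq_sqrt (D.g_axis_pos i i hr).le

lemma profileB_sq (D : InitialData n) (i j : Fin n) {r : ℝ} (hr : D.r₀ ≤ |r|) :
    D.profileB i j r ^ 2 = D.g (axisPoint i r) j j := Real.sq_sqrt (D.g_axis_pos i j hr).le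

lemma abs_g_axis_sub_one_le (h : D.AsymptoticallyFlatWith ρ₀ C) (i j : Fin n) {r : ℝ} (h0 : 0 < r)
    (hr : ρ₀ < r) : |D.g (axisPoint i r) j j - 1| ≤ C / r ^ (n - 2) := by
  have hn := norm_axisPoint_of_pos i h0
  have := h.metric_decay (axisPoint i r) (by rwa [hn]) j j [] (by simp)
  simpa [iterPd, hn] using this

lemma abs_k_axis_le (h : D.AsymptoticallyFlatWith ρ₀ C) (i j : Fin n) {r : ℝ} (h0 : 0 < r)
    (hr : ρ₀ < r) : |D.k (axisPoint i r) j j| ≤ C / r ^ (n - 1) := by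
  have hn := norm_axisPoint_of_pos i h0
  have := h.k_decay (axisPoint i r) (by rwa [hn]) j j [] (by simp)
  simpa [iterPd, hn] using this

/-- With `b = ρ/r`, the derivative `∂ᵢ gⱼⱼ` at a point of the axis `i` is `2 b (ρ' - b)/r`, to which
the decay of first derivatives applies. -/
lemma abs_slope_sub_le (hn : 3 ≤ n) (hij : i ≠ j) (hs : D.SphericallySymmetric)
    (h : D.AsymptoticallyFlatWith ρ₀ C) {r : ℝ} (h0 : 0 < r) (hr : ρ₀ < r) :
    |D.profileB i j r * (deriv (D.profileRho i j) r - D.profileB i j r)| ≤ C / 2 / r ^ (n - 2) := by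
  have hnr := norm_axisPoint_of_pos i h0
  have hr0 : D.r₀ < r := h.r₀_le.trans_lt hr
  obtain ⟨hM, -⟩ := hs.radial hij
  have h1 := h.metric_decay (axisPoint i r) (by rwa [hnr]) j j [i] (by simp)
  have hB := (D.profileB_pos i j (D.le_abs_of_lt hr0)).ne'
  have e : iterPd [i] (fun y => D.g y j j - (1 : Matrix (Fin n) (Fin n) ℝ) j j) (axisPoint i r)
      = 2 * (D.profileB i j r * (deriv (D.profileRho i j) r - D.profileB i j r)) / r := by
    simp only [iterPd, List.foldr]
    rw [pd_sub_const, hM.pd_metric (by rwa [hnr]), hnr, axisPoint_same, axisPoint_ne hij,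
      profileRho_div D i j h0.ne', chrP, InitialData.profileRho, Matrix.one_apply_eq]
    field_simp
    ring
  rw [e, hnr] at h1
  obtain ⟨m, rfl⟩ : ∃ m, n = m + 2 := ⟨n - 2, by omega⟩
  simp only [List.length_singleton, Nat.add_sub_cancel] at h1 ⊢
  rw [abs_div, abs_mul, abs_of_pos h0, abs_two, pow_succ, ← div_div, div_le_div_iff_of_pos_right h0]
    at h1
  rw [div_right_comm]
  linarith

lemma tendsto_profileA (hn : 3 ≤ n) (h : D.AsymptoticallyFlatWith ρ₀ C) (i : Fin n) :
    Tendsto (D.profileA i) atTop (𝓝 1) := by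
  have h1 : Tendsto (fun r => D.g (axisPoint i r) i i) atTop (𝓝 1) := by
    rw [tendsto_iff_norm_sub_tendsto_zero]
    refine squeeze_zero' (Eventually.of_forall fun _ => norm_nonneg _) ?_
      (tendsto_const_div_pow (show n - 2 ≠ 0 by omega) C)
    filter_upwards [eventually_gt_atTop 0, eventually_gt_atTop ρ₀] with r h0 hr
    exact abs_g_axis_sub_one_le h i i h0 hr
  have h2 := h1.sqrt
  rwa [Real.sqrt_one] at h2

lemma tendsto_profileB (hn : 3 ≤ n) (h : D.AsymptoticallyFlatWith ρ₀ C) (i j : Fin n) :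
    Tendsto (D.profileB i j) atTop (𝓝 1) := by
  have h1 : Tendsto (fun r => D.g (axisPoint i r) j j) atTop (𝓝 1) := by
    rw [tendsto_iff_norm_sub_tendsto_zero]
    refine squeeze_zero' (Eventually.of_forall fun _ => norm_nonneg _) ?_
      (tendsto_const_div_pow (show n - 2 ≠ 0 by omega) C)
    filter_upwards [eventually_gt_atTop 0, eventually_gt_atTop ρ₀] with r h0 hr
    exact abs_g_axis_sub_one_le h i j h0 hr
  have h2 := h1.sqrt
  rwa [Real.sqrt_one] at h2

/-- The difference `ρ' - ρ/r` is `O(r^{2-n})`, so its square tends to zero even after multiplication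
by `r^{n-2}`; the second limit is the error term in the ADM flux. -/
lemma tendsto_deriv_profileRho (hn : 3 ≤ n) (hij : i ≠ j) (hs : D.SphericallySymmetric)
    (h : D.AsymptoticallyFlatWith ρ₀ C) :
    Tendsto (deriv (D.profileRho i j)) atTop (𝓝 1) ∧
    Tendsto (fun r => r ^ (n - 2) * (deriv (D.profileRho i j) r - D.profileB i j r) ^ 2) atTop
      (𝓝 0) := by
  have hB := tendsto_profileB hn h i j
  have hq : ∀ᶠ r in atTop, 0 < r ∧ ρ₀ < r ∧ 0 < D.profileB i j r := by
    filter_upwards [eventually_gt_atTop 0, eventually_gt_atTop ρ₀] with r h0 hr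
    exact ⟨h0, hr, D.profileB_pos i j (D.le_abs_of_lt (h.r₀_le.trans_lt hr))⟩
  constructor
  · have h1 : Tendsto (fun r => D.profileB i j r *
        (deriv (D.profileRho i j) r - D.profileB i j r)) atTop (𝓝 0) := by
      refine squeeze_zero_norm' ?_ (tendsto_const_div_pow (show n - 2 ≠ 0 by omega) (C / 2))
      filter_upwards [hq] with r hr
      exact abs_slope_sub_le hn hij hs h hr.1 hr.2.1
    have h2 := (h1.div hB one_ne_zero).add hB
    rw [zero_div, zero_add] at h2
    refine h2.congr' ?_
    filter_upwards [hq] with r hr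
    have := hr.2.2.ne'
    simp only [Pi.div_apply]
    field_simp
    ring
  · have h1 : Tendsto (fun r => r ^ (n - 2) * (D.profileB i j r *
        (deriv (D.profileRho i j) r - D.profileB i j r)) ^ 2) atTop (𝓝 0) := by
      refine squeeze_zero' ?_ ?_ (tendsto_const_div_pow (show n - 2 ≠ 0 by omega) ((C / 2) ^ 2))
      · filter_upwards [hq] with r hr
        have := hr.1
        positivity
      · filter_upwards [hq] with r hr
        have h3 := abs_slope_sub_le hn hij hs h hr.1 hr.2.1
        have h0 := hr.1
        have h4 := pow_le_pow_left₀ (abs_nonneg _) h3 2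
        rw [sq_abs] at h4
        calc _ ≤ r ^ (n - 2) * (C / 2 / r ^ (n - 2)) ^ 2 := by gcongr
          _ = (C / 2) ^ 2 / r ^ (n - 2) := by field_simp
    have h2 := h1.div (hB.pow 2) (by norm_num)
    rw [zero_div] at h2
    refine h2.congr' ?_
    filter_upwards [hq] with r hr
    have := hr.2.2.ne'
    simp only [Pi.div_apply]
    field_simp

/-- The ADM energy is the limit of the Hawking-type mass of the symmetry spheres. -/
lemma tendsto_hawking (hn : 3 ≤ n) (hij : i ≠ j) (hs : D.SphericallySymmetric)
    (h : D.AsymptoticallyFlatWith ρ₀ C) {e : ℝ} (he : Tendsto (energyFlux D.g) atTop (𝓝 e)) :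
    Tendsto (fun r => D.profileRho i j r ^ (n - 2) *
      (1 - deriv (D.profileRho i j) r / D.profileA i r)) atTop (𝓝 e) := by
  obtain ⟨hM, -⟩ := hs.radial hij
  obtain ⟨h1, h2⟩ := tendsto_deriv_profileRho hn hij hs h
  have hA := tendsto_profileA hn h i
  have hB := tendsto_profileB hn h i j
  -- With `b = ρ/r`, the flux contains `A² + b² - 2bρ' = (A² - ρ'²) + (ρ' - b)²`. The last square is
  -- negligible, and dividing by `A (A + ρ') → 2` leaves `1 - ρ'/A`.
  have hlim : Tendsto (fun r => (energyFlux D.g r - r ^ (n - 2) *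
      (deriv (D.profileRho i j) r - D.profileB i j r) ^ 2 / 2) * 2 * D.profileB i j r ^ (n - 2) /
        (D.profileA i r * (D.profileA i r + deriv (D.profileRho i j) r))) atTop (𝓝 e) := by
    have := (((he.sub (h2.div_const 2)).mul_const 2).mul (hB.pow (n - 2))).div
      (hA.mul (hA.add h1)) (by norm_num)
    have e1 : (e - 0 / 2) * 2 * 1 ^ (n - 2) / (1 * (1 + 1)) = e := by rw [one_pow]; ring
    rwa [e1] at this
  refine hlim.congr' ?_
  filter_upwards [eventually_gt_atTop 0, eventually_gt_atTop D.r₀,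
    h1.eventually_const_lt zero_lt_one] with r h0 hr hd
  have hA0 := D.profileA_pos i (D.le_abs_of_lt hr)
  rw [hM.energyFlux_eq hn hr, profileRho_div D i j h0.ne', InitialData.profileRho, mul_pow]
  have : D.profileA i r + deriv (D.profileRho i j) r ≠ 0 := (add_pos hA0 hd).ne'
  field_simp
  ring

end

end

end SphericalData

/-! ### Decay of the tilt and the limit of the quasilocal mass. -/

namespace SphericalData

noncomputable section

variable {n : ℕ}

namespace JangSystem

variable {r₀ : ℝ} {A ρ kn kt F U : ℝ → ℝ}

/-- This is the Jang equation in divergence form: the flux of the tilt `F'/B` through symmetry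
spheres changes only through `k`. -/
lemma hasDerivAt_tilt (h : JangSystem n r₀ A ρ kn kt F U) {r : ℝ} (hr : r₀ < r) :
    HasDerivAt (fun r => ρ r ^ (n - 1) * (deriv F r / jangA A F r))
      (A r * ρ r ^ (n - 1) * (kn r * (1 - (deriv F r / jangA A F r) ^ 2)
        + ((n : ℝ) - 1) * kt r)) r := by
  have hA := h.A_pos r hr
  have hρ := h.ρ_pos r hr
  have hB := h.jangA_pos hr
  have dρ := ContDiffOn.hasDerivAt_Ioi h.ρ_smooth hr
  have dF2 := ContDiffOn.hasDerivAt_Ioi (ContDiffOn.deriv_Ioi h.F_smooth) hr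
  have dB := h.hasDerivAt_jangA hr
  refine ((dρ.fun_pow (n - 1)).fun_mul (dF2.fun_div dB hB.ne')).congr_deriv ?_
  obtain ⟨m, rfl⟩ : ∃ m, n = m + 2 := ⟨n - 2, by have := h.three_le; omega⟩
  have e1 : m + 2 - 1 = m + 1 := rfl
  simp only [e1, Nat.add_sub_cancel]
  have hj := h.jang r hr
  have hsq := jangA_sq A F r
  push_cast at hj ⊢
  set B := jangA A F r
  set a := A r
  set p := ρ r
  have hf2 : deriv F r ^ 2 = B ^ 2 - a ^ 2 := by rw [hsq]; ring
  have eF : deriv (deriv F) r = (deriv F r * deriv A r + a ^ 2 * B * kn r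
      - ((m : ℝ) + 2 - 1) * B ^ 2 * (deriv F r * deriv ρ r / (a * p) - B * kt r)) / a := by
    have h2 : B ^ 3 * (((m : ℝ) + 2 - 1) * (deriv F r * deriv ρ r / (a * p * B) - kt r)
      + (a * deriv (deriv F) r - deriv F r * deriv A r) / B ^ 3
      - a ^ 2 * kn r / B ^ 2) = 0 := by rw [hj, mul_zero]
    rw [← sub_eq_zero, ← mul_zero (1 / a), ← h2]
    field_simp
    ring
  rw [eF]
  field_simp
  linear_combination (-p ^ (m + 1) * (a * (deriv F r * deriv A r + B * a ^ 2 * kn r) * p -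
    B ^ 2 * (↑m + 2 - 1) * (deriv ρ r * deriv F r - B * a * p * kt r))
    + B * p ^ (m + 1) * a ^ 3 * p * kn r) * hf2

end JangSystem

section

variable {D : InitialData n} {f u : E n → ℝ} {i j : Fin n} {ρ₀ C : ℝ}

/-- As `k = O(r^{1-n})`, the divergence form has a bounded right-hand side, so `ρ^{n-1} F'/B = O(r)`
and the tilt is `O(r^{2-n})`. No decay of `F'` is assumed. -/
lemma tendsto_tilt (hn : 3 ≤ n) (h : D.AsymptoticallyFlatWith ρ₀ C) {F U : ℝ → ℝ}
    (hJ : JangSystem n D.r₀ (D.profileA i) (D.profileRho i j) (D.profileKn i) (D.profileKt i j)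
      F U) :
    Tendsto (fun r => r ^ (n - 2) * (deriv F r / jangA (D.profileA i) F r) ^ 2) atTop (𝓝 0) := by
  have hA := tendsto_profileA hn h i
  have hB := tendsto_profileB hn h i j
  have hq : ∀ᶠ r in atTop, 0 < r ∧ ρ₀ < r := by
    filter_upwards [eventually_gt_atTop 0, eventually_gt_atTop ρ₀] with r h0 hr using ⟨h0, hr⟩
  -- The limit of the bound on the derivative of the flux, plus one for room.
  set K := C * (1 + ((n : ℝ) - 1)) + 1 with hK
  have hlim : Tendsto (fun r => C * (D.profileB i j r ^ (n - 1) * (1 / D.profileA i r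
      + ((n : ℝ) - 1) * D.profileA i r / D.profileB i j r ^ 2))) atTop
      (𝓝 (C * (1 ^ (n - 1) * (1 / 1 + ((n : ℝ) - 1) * 1 / 1 ^ 2)))) :=
    ((hB.pow _).mul ((tendsto_const_nhds.div hA one_ne_zero).add
      ((hA.const_mul _).div (hB.pow 2) (by norm_num)))).const_mul C
  have hlt : C * (1 ^ (n - 1) * (1 / 1 + ((n : ℝ) - 1) * 1 / 1 ^ 2)) < K := by
    rw [hK, one_pow]; norm_num
  obtain ⟨R, hR⟩ := eventually_atTop.1 ((hlim.eventually_le_const hlt).and hq)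
  set w : ℝ → ℝ := fun r => D.profileRho i j r ^ (n - 1) * (deriv F r / jangA (D.profileA i) F r)
    with hw
  have hn1 : 0 ≤ (n : ℝ) - 1 := by
    have : (3 : ℝ) ≤ n := by exact_mod_cast hn
    linarith
  have hbound : ∀ r, R ≤ r → ‖D.profileA i r * D.profileRho i j r ^ (n - 1) *
      (D.profileKn i r * (1 - (deriv F r / jangA (D.profileA i) F r) ^ 2)
        + ((n : ℝ) - 1) * D.profileKt i j r)‖ ≤ K := by
    intro r hr
    obtain ⟨h1, h0, hr1⟩ := hR r hr
    have hrD : D.r₀ < r := h.r₀_le.trans_lt hr1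
    have hle := D.le_abs_of_lt hrD
    have hA0 := D.profileA_pos i hle
    have hB0 := D.profileB_pos i j hle
    have hJ0 := hJ.jangA_pos hrD
    refine le_trans ?_ h1
    have k1 : |D.profileKn i r| ≤ C / r ^ (n - 1) / D.profileA i r ^ 2 := by
      rw [InitialData.profileKn, ← profileA_sq D i hle, abs_div, abs_of_pos (pow_pos hA0 2)]
      have := abs_k_axis_le h i i h0 hr1
      gcongr
    have k2 : |D.profileKt i j r| ≤ C / r ^ (n - 1) / D.profileB i j r ^ 2 := by
      rw [InitialData.profileKt, ← profileB_sq D i j hle, abs_div, abs_of_pos (pow_pos hB0 2)]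
      have := abs_k_axis_le h i j h0 hr1
      gcongr
    have hv : |1 - (deriv F r / jangA (D.profileA i) F r) ^ 2| ≤ 1 := by
      have hle1 : (deriv F r / jangA (D.profileA i) F r) ^ 2 ≤ 1 := by
        rw [div_pow, div_le_one (by positivity), jangA_sq]
        nlinarith [sq_nonneg (D.profileA i r)]
      rw [abs_le]
      constructor <;> nlinarith [sq_nonneg (deriv F r / jangA (D.profileA i) F r)]
    have k3 : |D.profileKn i r * (1 - (deriv F r / jangA (D.profileA i) F r) ^ 2)
        + ((n : ℝ) - 1) * D.profileKt i j r| ≤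
        C / r ^ (n - 1) / D.profileA i r ^ 2
          + ((n : ℝ) - 1) * (C / r ^ (n - 1) / D.profileB i j r ^ 2) := by
      refine (abs_add_le _ _).trans ?_
      rw [abs_mul, abs_mul, abs_of_nonneg hn1]
      have : |D.profileKn i r| * |1 - (deriv F r / jangA (D.profileA i) F r) ^ 2| ≤
          |D.profileKn i r| * 1 := by gcongr
      have : ((n : ℝ) - 1) * |D.profileKt i j r| ≤
          ((n : ℝ) - 1) * (C / r ^ (n - 1) / D.profileB i j r ^ 2) := by gcongr
      linarith
    have hρ0 : 0 < D.profileRho i j r := mul_pos h0 hB0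
    rw [Real.norm_eq_abs, abs_mul, abs_of_pos (show 0 < D.profileA i r * D.profileRho i j r ^ (n - 1)
      by positivity)]
    refine (mul_le_mul_of_nonneg_left k3 (by positivity)).trans (le_of_eq ?_)
    rw [InitialData.profileRho, mul_pow]
    field_simp
  have hR0 := (hR R le_rfl).2
  have hK0 : 0 ≤ K := (norm_nonneg _).trans (hbound R le_rfl)
  have hgrow : ∀ r, R ≤ r → |w r| ≤ (|w R| / R + K) * r := by
    intro r hr
    have hsub : ∀ t ∈ Icc R r, D.r₀ < t := fun t ht => h.r₀_le.trans_lt (hR t ht.1).2.2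
    have := norm_image_sub_le_of_norm_deriv_le_segment' (f := w) (a := R) (b := r) (C := K)
      (fun t ht => (hJ.hasDerivAt_tilt (hsub t ht)).hasDerivWithinAt)
      (fun t ht => hbound t ht.1) r (right_mem_Icc.2 hr)
    rw [Real.norm_eq_abs] at this
    have h1 : |w r| ≤ |w R| + K * (r - R) := by
      have := abs_sub_abs_le_abs_sub (w r) (w R); linarith
    have h2 : |w R| ≤ |w R| / R * r := by
      rw [div_mul_eq_mul_div, le_div_iff₀ hR0.1]
      gcongr
    have h3 : 0 ≤ K * R := mul_nonneg hK0 hR0.1.le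
    nlinarith
  have hsq : Tendsto (fun r => (|w R| / R + K) ^ 2 / (D.profileB i j r ^ (n - 1)) ^ 2
      * (1 / r ^ (n - 2))) atTop (𝓝 0) := by
    have := ((tendsto_const_nhds (x := (|w R| / R + K) ^ 2)).div ((hB.pow (n - 1)).pow 2)
      (by norm_num)).mul (tendsto_const_div_pow (show n - 2 ≠ 0 by omega) 1)
    rwa [mul_zero] at this
  refine squeeze_zero' ?_ ?_ hsq
  · filter_upwards [eventually_gt_atTop 0] with r hr
    positivity
  · filter_upwards [eventually_ge_atTop R] with r hr
    obtain ⟨-, h0, hr1⟩ := hR r hr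
    have hB0 := D.profileB_pos i j (D.le_abs_of_lt (h.r₀_le.trans_lt hr1))
    have h1 := pow_le_pow_left₀ (abs_nonneg _) (hgrow r hr) 2
    have hwr : w r = (r * D.profileB i j r) ^ (n - 1) * (deriv F r / jangA (D.profileA i) F r) := rfl
    rw [sq_abs, hwr] at h1
    simp only [mul_pow] at h1
    have h2 : (r ^ (n - 1)) ^ 2 = r ^ (n - 2) * r ^ 2 * r ^ (n - 2) := by
      rw [← pow_mul, ← pow_add, ← pow_add]; congr 1; omega
    rw [h2] at h1
    rw [div_mul_div_comm, mul_one, le_div_iff₀ (by positivity)]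
    refine le_of_mul_le_mul_right (le_trans (le_of_eq ?_) h1) (show 0 < r ^ 2 by positivity)
    ring

lemma tendsto_axisProfile_conformal (hn : 3 ≤ n) (hu : IsConformalFactor D f u) (i : Fin n) :
    Tendsto (axisProfile u i) atTop (𝓝 1) := by
  obtain ⟨α, C, R, h⟩ := hu.atInfinity
  have h1 : Tendsto (fun r => axisProfile u i r - (1 + α / r ^ (n - 2))) atTop (𝓝 0) := by
    refine squeeze_zero_norm' ?_ (tendsto_const_div_pow (show n - 1 ≠ 0 by omega) C)
    filter_upwards [eventually_gt_atTop 0, eventually_gt_atTop R] with r h0 hr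
    have hnr := norm_axisPoint_of_pos i h0
    have := h (axisPoint i r) (by rwa [hnr]) [] (by simp)
    simpa [iterPd, hnr, axisProfile] using this
  have h2 := h1.add ((tendsto_const_div_pow (show n - 2 ≠ 0 by omega) α).const_add 1)
  simpa using h2

/-- With `v = F'/B` and `s = √(1 - v²) = A/B`, one has `G = ρ'/(A s) - ρ k_t v/s` and `1/s - 1 =
v²/(s (1 + s))`. Thus `ρ^{n-2} (1 - G)` differs from the Hawking-type mass by terms of order
`r^{n-2} v²` and `ρ^{n-1} k_t v`, both negligible. -/
lemma tendsto_jangMass (hn : 3 ≤ n) (hij : i ≠ j) (hs : D.SphericallySymmetric)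
    (h : D.AsymptoticallyFlatWith ρ₀ C) {F U : ℝ → ℝ}
    (hJ : JangSystem n D.r₀ (D.profileA i) (D.profileRho i j) (D.profileKn i) (D.profileKt i j)
      F U) (hU : Tendsto U atTop (𝓝 1)) {e : ℝ} (he : Tendsto (energyFlux D.g) atTop (𝓝 e)) :
    Tendsto (jangMass n (D.profileA i) (D.profileRho i j) (D.profileKt i j) F U) atTop (𝓝 e) := by
  have hA := tendsto_profileA hn h i
  have hB := tendsto_profileB hn h i j
  have hH := tendsto_hawking hn hij hs h he
  obtain ⟨hρ', -⟩ := tendsto_deriv_profileRho hn hij hs h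
  have hv2 := tendsto_tilt hn h hJ
  set v : ℝ → ℝ := fun r => deriv F r / jangA (D.profileA i) F r with hvd
  have hvsq : Tendsto (fun r => v r ^ 2) atTop (𝓝 0) := by
    refine squeeze_zero' (Eventually.of_forall fun _ => sq_nonneg _) ?_ hv2
    filter_upwards [eventually_ge_atTop 1] with r hr
    exact le_mul_of_one_le_left (sq_nonneg _) (one_le_pow₀ hr)
  have hv : Tendsto v atTop (𝓝 0) := by
    have := hvsq.sqrt
    simp only [Real.sqrt_sq_eq_abs, Real.sqrt_zero] at this
    exact (tendsto_zero_iff_abs_tendsto_zero _).2 this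
  set s : ℝ → ℝ := fun r => Real.sqrt (1 - v r ^ 2) with hsd
  have hslim : Tendsto s atTop (𝓝 1) := by
    have := (hvsq.const_sub 1).sqrt
    rwa [sub_zero, Real.sqrt_one] at this
  have hkv : Tendsto (fun r => D.profileRho i j r ^ (n - 1) * D.profileKt i j r * v r) atTop
      (𝓝 0) := by
    have hlim : Tendsto (fun r => D.profileB i j r ^ (n - 1) / D.profileB i j r ^ 2 * C * |v r|) atTop
        (𝓝 (1 ^ (n - 1) / 1 ^ 2 * C * |0|)) :=
      (((hB.pow (n - 1)).div (hB.pow 2) (by norm_num)).mul_const C).mul hv.abs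
    rw [abs_zero, mul_zero] at hlim
    refine squeeze_zero_norm' ?_ hlim
    filter_upwards [eventually_gt_atTop 0, eventually_gt_atTop ρ₀] with r h0 hr
    have hle := D.le_abs_of_lt (h.r₀_le.trans_lt hr)
    have hB0 := D.profileB_pos i j hle
    have h1 := abs_k_axis_le h i j h0 hr
    rw [le_div_iff₀ (by positivity)] at h1
    rw [InitialData.profileRho, InitialData.profileKt, ← profileB_sq D i j hle, Real.norm_eq_abs,
      abs_mul, abs_mul, abs_div, abs_of_pos (show 0 < (r * D.profileB i j r) ^ (n - 1) by positivity),
      abs_of_pos (pow_pos hB0 2), mul_pow]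
    refine mul_le_mul_of_nonneg_right ?_ (abs_nonneg _)
    calc _ = D.profileB i j r ^ (n - 1) / D.profileB i j r ^ 2 *
          (|D.k (axisPoint i r) j j| * r ^ (n - 1)) := by ring
      _ ≤ _ := by gcongr
  have hUp : Tendsto (fun r => U r ^ (2 / ((n : ℝ) - 2))) atTop (𝓝 1) := by
    have := hU.rpow_const (p := 2 / ((n : ℝ) - 2)) (Or.inl one_ne_zero)
    rwa [Real.one_rpow] at this
  have hlim := (hUp.pow (n - 2)).mul ((hH.sub (((hρ'.div hA one_ne_zero).mul ((hB.pow (n - 2)).mul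
    hv2)).div (hslim.mul (hslim.const_add 1)) (by norm_num))).add (hkv.div hslim one_ne_zero))
  have he' : (1 : ℝ) ^ (n - 2) * (e - 1 / 1 * (1 ^ (n - 2) * 0) / (1 * (1 + 1)) + 0 / 1) = e := by
    simp
  rw [he'] at hlim
  refine hlim.congr' ?_
  filter_upwards [eventually_gt_atTop 0, eventually_gt_atTop D.r₀] with r h0 hr
  have hle := D.le_abs_of_lt hr
  have hA0 := D.profileA_pos i hle
  have hB0 := D.profileB_pos i j hle
  have hJ0 := hJ.jangA_pos hr
  have hsq := jangA_sq (D.profileA i) F r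
  have es : s r = D.profileA i r / jangA (D.profileA i) F r := by
    have : 1 - v r ^ 2 = (D.profileA i r / jangA (D.profileA i) F r) ^ 2 := by
      simp only [hvd]
      field_simp
      linarith
    simp only [hsd]
    rw [this, Real.sqrt_sq (by positivity)]
  have hs0 : 0 < s r := by rw [es]; positivity
  have hv' : v r ^ 2 = 1 - s r ^ 2 := by
    rw [es]
    simp only [hvd]
    field_simp
    linarith
  have eJ : jangA (D.profileA i) F r = D.profileA i r / s r := by rw [es]; field_simp
  have eF : deriv F r = v r * (D.profileA i r / s r) := by
    rw [← eJ]; simp only [hvd]; field_simp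
  have eρ : D.profileRho i j r ^ (n - 1) = D.profileRho i j r ^ (n - 2) * D.profileRho i j r := by
    rw [← pow_succ]; congr 1; omega
  have eρ2 : D.profileB i j r ^ (n - 2) * r ^ (n - 2) = D.profileRho i j r ^ (n - 2) := by
    rw [InitialData.profileRho, mul_pow, mul_comm]
  simp only [Pi.div_apply]
  have hv3 : (deriv F r / jangA (D.profileA i) F r) ^ 2 = 1 - s r ^ 2 := hv'
  rw [hv3, jangMass, boostedSlope, areaRadius, mul_pow _ (D.profileRho i j r), eJ, eF, eρ,
    ← mul_assoc (D.profileB i j r ^ (n - 2)), eρ2]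
  have : 1 + s r ≠ 0 := by positivity
  field_simp
  ring

end

end

end SphericalData

/-! ### The inner end, and identification of the ADM mass. -/

namespace SphericalData

noncomputable section

variable {n : ℕ} {D : InitialData n} {f u : E n → ℝ} {i j : Fin n} {ρ₀ C : ℝ}

lemma tendsto_areaRadius_atTop (hn : 3 ≤ n) (h : D.AsymptoticallyFlatWith ρ₀ C) (i j : Fin n)
    {U : ℝ → ℝ} (hU : Tendsto U atTop (𝓝 1)) :
    Tendsto (areaRadius n (D.profileRho i j) U) atTop atTop := by
  have hUp : Tendsto (fun r => U r ^ (2 / ((n : ℝ) - 2))) atTop (𝓝 1) := by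
    have := hU.rpow_const (p := 2 / ((n : ℝ) - 2)) (Or.inl one_ne_zero)
    rwa [Real.one_rpow] at this
  have h1 := (hUp.mul (tendsto_profileB hn h i j)).pos_mul_atTop (by norm_num) tendsto_id
  refine h1.congr fun r => ?_
  rw [areaRadius, InitialData.profileRho, id]
  ring

lemma continuousAt_deriv_of_contDiffAt {φ : ℝ → ℝ} {r : ℝ} (h : ContDiffAt ℝ ∞ φ r) :
    ContinuousAt (deriv φ) r :=
  (h.continuousAt_fderiv (by simp)).clm_apply continuousAt_const

lemma continuousAt_profileRho (D : InitialData n) (i j : Fin n) :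
    ContinuousAt (D.profileRho i j) D.r₀ :=
  (D.contDiffAt_profileRho i j (le_abs_self _)).continuousAt

lemma tendsto_toBoundary (D : InitialData n) (i : Fin n) :
    Tendsto (axisPoint i) (𝓝[>] D.r₀) (toBoundary n D.r₀) := by
  refine tendsto_comap_iff.2 (tendsto_id.congr' ?_)
  filter_upwards [self_mem_nhdsWithin] with r hr
  exact (norm_axisPoint_of_pos i (D.r₀_nonneg.trans_lt hr)).symm

lemma axisPoint_zero_mem (h0 : D.r₀ = 0) (i : Fin n) : axisPoint i D.r₀ ∈ interior D.M := by
  rw [InitialData.M, h0, interior_region_zero]; trivial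

/-- At a centre `ρ` vanishes while `u` stays positive; over a boundary `u → 0` while `ρ` stays
bounded. -/
lemma tendsto_areaRadius_zero (hn : 3 ≤ n) (i j : Fin n) (hu : IsConformalFactor D f u) :
    Tendsto (areaRadius n (D.profileRho i j) (axisProfile u i)) (𝓝[>] D.r₀) (𝓝 0) := by
  have hn2 : (0 : ℝ) < (n : ℝ) - 2 := by
    have : (3 : ℝ) ≤ n := by exact_mod_cast hn
    linarith
  have hρ : Tendsto (D.profileRho i j) (𝓝[>] D.r₀) (𝓝 (D.profileRho i j D.r₀)) :=
    (continuousAt_profileRho D i j).mono_left nhdsWithin_le_nhds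
  rcases D.r₀_nonneg.eq_or_lt with h0 | h0
  · have hm := axisPoint_zero_mem h0.symm i
    have hU : Tendsto (axisProfile u i) (𝓝[>] D.r₀) (𝓝 (axisProfile u i D.r₀)) :=
      (contDiffAt_axisProfile hu.smooth i hm).continuousAt.mono_left nhdsWithin_le_nhds
    have := (hU.rpow_const (p := 2 / ((n : ℝ) - 2)) (Or.inl (hu.pos _ hm).ne')).mul hρ
    have hρ0 : D.profileRho i j D.r₀ = 0 := by
      rw [InitialData.profileRho]
      exact mul_eq_zero_of_left h0.symm _
    rwa [hρ0, mul_zero] at this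
  · have hU : Tendsto (axisProfile u i) (𝓝[>] D.r₀) (𝓝 0) :=
      (hu.atBoundary h0).comp (tendsto_toBoundary D i)
    have := (hU.rpow_const (p := 2 / ((n : ℝ) - 2)) (Or.inr (by positivity))).mul hρ
    rwa [Real.zero_rpow (by positivity), zero_mul] at this

/-- Without boundary the axis runs smoothly through the centre, so the slope is continuous, hence
bounded, there. With a boundary the blow-up of `f` is used instead. -/
lemma areaSlope_eq_one (hn : 3 ≤ n) (hij : i ≠ j) (hs : D.SphericallySymmetric)
    (h : D.AsymptoticallyFlatWith ρ₀ C) (hd : D.DominantEnergy)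
    (hf : IsJangSolution D f) (hu : IsConformalFactor D f u) {r : ℝ} (hr : D.r₀ < r) :
    areaSlope n (D.profileA i) (D.profileRho i j) (axisProfile f i) (axisProfile u i) r = 1 := by
  refine (jangSystem hn hij hs hd hf hu).areaSlope_eq_one (tendsto_areaRadius_zero hn i j hu)
    (tendsto_areaRadius_atTop hn h i j (tendsto_axisProfile_conformal hn hu i)) ?_ hr
  rcases D.r₀_nonneg.eq_or_lt with h0 | h0
  · left
    have hm := axisPoint_zero_mem h0.symm i
    have hle := le_abs_self D.r₀
    have cA := (D.contDiffAt_profileA i hle).continuousAt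
    have cρ := D.contDiffAt_profileRho i j hle
    have cF := contDiffAt_axisProfile hf.smooth i hm
    have cU := contDiffAt_axisProfile hu.smooth i hm
    have cd : ∀ {φ : ℝ → ℝ} {r : ℝ}, ContDiffAt ℝ ∞ φ r → ContinuousAt (deriv φ) r :=
      continuousAt_deriv_of_contDiffAt
    have hA := D.profileA_pos i hle
    have cJ : ContinuousAt (jangA (D.profileA i) (axisProfile f i)) D.r₀ :=
      ((cA.pow 2).add ((cd cF).pow 2)).sqrt
    have hJ : jangA (D.profileA i) (axisProfile f i) D.r₀ ≠ 0 :=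
      (Real.sqrt_pos.2 (by positivity)).ne'
    have hU : axisProfile u i D.r₀ ≠ 0 := (hu.pos _ hm).ne'
    have cτ : ContinuousAt (areaSlope n (D.profileA i) (D.profileRho i j) (axisProfile f i)
        (axisProfile u i)) D.r₀ :=
      ((cd cρ).div cJ hJ).add (((cρ.continuousAt.mul (cd cU)).div (cJ.mul cU.continuousAt)
        (mul_ne_zero hJ hU)).const_mul _)
    exact ⟨_, (cτ.abs.tendsto.mono_left nhdsWithin_le_nhds).eventually_le_const (lt_add_one _)⟩
  · right
    refine ⟨⟨D.profileRho i j D.r₀ + 1, ?_⟩, ?_⟩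
    · exact ((continuousAt_profileRho D i j).tendsto.mono_left
        nhdsWithin_le_nhds).eventually_le_const (lt_add_one _)
    · rcases hf.blowUp h0 with ⟨-, h1⟩ | ⟨-, h1⟩
      · exact Or.inl (h1.comp (tendsto_toBoundary D i))
      · exact Or.inr (h1.comp (tendsto_toBoundary D i))

/-- The estimates hold with the ADM mass as the limit of the quasilocal mass. -/
lemma exists_decayProfile (hn : 3 ≤ n) (hij : i ≠ j) (hs : D.SphericallySymmetric)
    (h : D.AsymptoticallyFlatWith ρ₀ C) (hd : D.DominantEnergy) {m : ℝ} (hm : D.HasADMMass m)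
    (hf : IsJangSolution D f) (hu : IsConformalFactor D f u) :
    ∃ Z σ' Z' φ' : ℝ → ℝ, DecayProfile n D.r₀ m
      (areaRadius n (D.profileRho i j) (axisProfile u i)) Z
      (fun r => Real.log (axisProfile u i r)) σ' Z' φ' := by
  obtain ⟨hM, hk⟩ := hs.radial hij
  obtain ⟨e, P, he, hP, rfl⟩ := hm
  have hJ := jangSystem hn hij hs hd hf hu
  have hU := tendsto_axisProfile_conformal hn hu i
  have hdec := hJ.decayProfile (fun r hr => areaSlope_eq_one hn hij hs h hd hf hu hr)
    (tendsto_areaRadius_zero hn i j hu) (tendsto_areaRadius_atTop hn h i j hU)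
    (tendsto_jangMass hn hij hs h hJ hU he) hU
  have hP0 : ∀ a, P a = 0 := fun a => by
    refine tendsto_nhds_unique (hP a) (tendsto_const_nhds.congr' ?_)
    filter_upwards [eventually_gt_atTop D.r₀] with r hr
    exact (hM.momentumFlux_eq hk hr a).symm
  -- That `√(E²)` is `E` itself requires `E ≥ 0`, which the Riccati argument has provided.
  have hme : Real.sqrt (e ^ 2 - ∑ a, P a ^ 2) = e := by
    simp [hP0, Real.sqrt_sq hdec.e_nonneg]
  rw [hme]
  exact ⟨_, _, _, _, hdec⟩

end

end SphericalData

namespace SphericalData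

noncomputable section

variable {n : ℕ}

/-! ### Radial maps of Euclidean space -/

/-- The radial map `x ↦ h(r) x`. -/
def radialMap (h : ℝ → ℝ) (x : E n) : E n := h ‖x‖ • x

/-- The map `v ↦ ⟨x, v⟩ x / r`. -/
def radialProjection (x : E n) : E n →L[ℝ] E n := ‖x‖⁻¹ • (innerSL ℝ x).smulRight x

/-- The derivative of the radial map `x ↦ h(r) x`. -/
def radialMapDeriv (h : ℝ → ℝ) (x : E n) : E n →L[ℝ] E n :=
  h ‖x‖ • ContinuousLinearMap.id ℝ (E n) + deriv h ‖x‖ • radialProjection x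

lemma radialMapDeriv_apply (h : ℝ → ℝ) (x v : E n) :
    radialMapDeriv h x v = h ‖x‖ • v + (deriv h ‖x‖ * ‖x‖⁻¹ * inner ℝ x v) • x := by
  simp [radialMapDeriv, radialProjection, smul_smul, mul_assoc]

/-- Away from the origin this is clear; at the origin the map is quadratic in `x` divided by `‖x‖`,
and the convention `0⁻¹ = 0` supplies the right value. -/
lemma continuous_radialProjection : Continuous (radialProjection : E n → E n →L[ℝ] E n) := by
  rw [continuous_iff_continuousAt]
  intro x
  rcases eq_or_ne x 0 with rfl | hx
  · have hle : ∀ y : E n, ‖radialProjection y‖ ≤ ‖y‖ := fun y => by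
      rw [radialProjection, norm_smul, ContinuousLinearMap.norm_smulRight_apply,
        innerSL_apply_norm, norm_inv, norm_norm]
      rcases eq_or_ne ‖y‖ 0 with h0 | h0
      · simp [h0]
      · rw [inv_mul_cancel_left₀ h0]
    have h0 : radialProjection (0 : E n) = 0 := by simp [radialProjection]
    rw [ContinuousAt, h0]
    exact squeeze_zero_norm hle (tendsto_norm_zero)
  · refine ContinuousAt.smul (continuous_norm.continuousAt.inv₀ (norm_ne_zero_iff.2 hx)) ?_
    have : Continuous fun y : E n => (innerSL ℝ y).smulRight y := by fun_prop
    exact this.continuousAt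

lemma hasFDerivAt_radialMap {h : ℝ → ℝ} {x : E n} (hh : DifferentiableAt ℝ h ‖x‖) :
    HasFDerivAt (radialMap h) (radialMapDeriv h x) x := by
  rcases eq_or_ne x 0 with rfl | hx
  · have e : radialMapDeriv h (0 : E n) = h 0 • ContinuousLinearMap.id ℝ (E n) := by
      ext1 v
      simp [radialMapDeriv_apply]
    rw [e, hasFDerivAt_iff_isLittleO_nhds_zero]
    have h1 : Tendsto (fun y : E n => h ‖y‖ - h 0) (𝓝 0) (𝓝 0) := by
      rw [norm_zero] at hh
      have := (hh.continuousAt.tendsto.comp (tendsto_norm_zero (E := E n))).sub_const (h 0)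
      rwa [sub_self] at this
    refine (((Asymptotics.isLittleO_one_iff ℝ).2 h1).smul_isBigO
      (Asymptotics.isBigO_refl (fun y : E n => y) _)).congr (fun y => ?_) fun y => one_smul _ _
    simp [radialMap, sub_smul]
  · refine ((hasFDerivAt_radial hx hh.hasDerivAt).smul (hasFDerivAt_id x)).congr_fderiv ?_
    ext1 v
    rw [radialMapDeriv_apply]
    simp [div_eq_mul_inv]

/-- No parity of `h` is needed at the origin, because the term `h'(r) x ⊗ x/r` is continuous there.
-/
lemma contDiffAt_radialMap {h : ℝ → ℝ} {x : E n} (hh : ContDiffAt ℝ 2 h ‖x‖) :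
    ContDiffAt ℝ 1 (radialMap h) x := by
  refine contDiffAt_one_iff.2 ⟨radialMapDeriv h, {y | ContDiffAt ℝ 2 h ‖y‖},
    continuous_norm.continuousAt.eventually (hh.eventually (by simp)), ?_,
    fun y (hy : ContDiffAt ℝ 2 h ‖y‖) => hasFDerivAt_radialMap (hy.differentiableAt (by simp))⟩
  intro y (hy : ContDiffAt ℝ 2 h ‖y‖)
  refine ContinuousAt.continuousWithinAt ?_
  have hn : ContinuousAt (fun z : E n => ‖z‖) y := continuous_norm.continuousAt
  have h1 : ContinuousAt h ‖y‖ := hy.continuousAt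
  have h2 : ContinuousAt (deriv h) ‖y‖ :=
    (hy.continuousAt_fderiv (by simp)).clm_apply continuousAt_const
  exact ((ContinuousAt.comp (f := fun z : E n => ‖z‖) h1 hn).smul continuousAt_const).add
    ((ContinuousAt.comp (f := fun z : E n => ‖z‖) h2 hn).smul
      continuous_radialProjection.continuousAt)

lemma radialMapDeriv_injective {h : ℝ → ℝ} {x : E n} (h0 : h ‖x‖ ≠ 0)
    (h1 : h ‖x‖ + deriv h ‖x‖ * ‖x‖ ≠ 0) : Function.Injective (radialMapDeriv h x) := by
  refine (injective_iff_map_eq_zero _).2 fun v hv => ?_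
  rw [radialMapDeriv_apply] at hv
  have hi : inner ℝ x v = 0 := by
    rcases eq_or_ne x 0 with rfl | hx
    · simp
    · have hr : ‖x‖ ≠ 0 := norm_ne_zero_iff.2 hx
      have := congrArg (inner ℝ x) hv
      rw [inner_add_right, inner_smul_right, inner_smul_right, real_inner_self_eq_norm_sq,
        inner_zero_right] at this
      have h2 : (h ‖x‖ + deriv h ‖x‖ * ‖x‖) * inner ℝ x v = 0 := by
        rw [← this]; field_simp
      exact (mul_eq_zero.1 h2).resolve_left h1
  rw [hi, mul_zero, zero_smul, add_zero] at hv
  exact (smul_eq_zero.1 hv).resolve_left h0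

lemma inner_radialMapDeriv_single {h : ℝ → ℝ} {x : E n} (hx : x ≠ 0) (i j : Fin n) :
    inner ℝ (radialMapDeriv h x (EuclideanSpace.single i 1))
        (radialMapDeriv h x (EuclideanSpace.single j 1))
      = h ‖x‖ ^ 2 * (1 : Matrix (Fin n) (Fin n) ℝ) i j
        + ((h ‖x‖ + deriv h ‖x‖ * ‖x‖) ^ 2 - h ‖x‖ ^ 2) / ‖x‖ ^ 2 * (x i * x j) := by
  have hr : ‖x‖ ≠ 0 := norm_ne_zero_iff.2 hx
  have e : inner ℝ (EuclideanSpace.single i (1 : ℝ)) (EuclideanSpace.single j (1 : ℝ))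
      = (1 : Matrix (Fin n) (Fin n) ℝ) i j := by
    simp [EuclideanSpace.inner_single_left, Matrix.one_apply]
  rw [radialMapDeriv_apply, radialMapDeriv_apply]
  simp only [inner_add_left, inner_add_right, inner_smul_left, inner_smul_right,
    real_inner_self_eq_norm_sq, e, EuclideanSpace.inner_single_left,
    EuclideanSpace.inner_single_right, map_one, one_mul, RCLike.conj_to_real]
  field_simp
  ring

/-- A `C¹` bijection from an open set whose derivative is injective is a diffeomorphism. -/
lemma exists_openPartialHomeomorph_of_bijOn {F : E n → E n} {S T : Set (E n)} (hS : IsOpen S)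
    (hb : BijOn F S T) (hF : ∀ x ∈ S, ContDiffAt ℝ 1 F x)
    (hinj : ∀ x ∈ S, Function.Injective (fderiv ℝ F x)) :
    ∃ Φ : OpenPartialHomeomorph (E n) (E n), Φ.source = S ∧ Φ.target = T ∧ ⇑Φ = F ∧
      ContDiffOn ℝ 1 Φ.symm T := by
  let L : ∀ x, x ∈ S → (E n ≃L[ℝ] E n) := fun x hx =>
    (LinearEquiv.ofInjectiveEndo (fderiv ℝ F x).toLinearMap (hinj x hx)).toContinuousLinearEquiv
  have hL : ∀ x (hx : x ∈ S), HasStrictFDerivAt F (L x hx : E n →L[ℝ] E n) x := fun x hx =>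
    ((hF x hx).hasStrictFDerivAt (by simp)).congr_fderiv (by ext1 v; rfl)
  -- The inverse function theorem makes `F` open, which gives both openness of the target and
  -- continuity of the inverse.
  have hnhds : ∀ x ∈ S, map F (𝓝 x) = 𝓝 (F x) := fun x hx =>
    (hL x hx).map_nhds_eq_of_equiv
  have hT : IsOpen T := by
    rw [isOpen_iff_mem_nhds]
    intro y hy
    obtain ⟨x, hx, rfl⟩ := hb.surjOn hy
    rw [← hnhds x hx, ← hb.image_eq]
    exact image_mem_map (hS.mem_nhds hx)
  let e : PartialEquiv (E n) (E n) := hb.toPartialEquiv F S T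
  have hopen : IsOpenMap (e.source.domRestrict e) := by
    refine IsOpenMap.of_nhds_le fun x => ?_
    have hx : (x : E n) ∈ S := x.2
    have : map (e.source.domRestrict e) (𝓝 x) = map F (map Subtype.val (𝓝 x)) := by
      rw [map_map]; rfl
    rw [this, map_nhds_subtype_coe_eq_nhds x.2 (hS.mem_nhds hx), hnhds _ hx]
    exact le_rfl
  let Φ : OpenPartialHomeomorph (E n) (E n) :=
    { PartialHomeomorph.ofContinuousOpenRestrict e
        (fun x hx => (hF x hx).continuousAt.continuousWithinAt) hopen with
      open_source := hS
      open_target := hT }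
  refine ⟨Φ, rfl, rfl, rfl, fun y hy => ?_⟩
  have hx : Φ.symm y ∈ S := Φ.map_target hy
  exact (Φ.contDiffAt_symm hy (hL _ hx).hasFDerivAt (hF _ hx)).contDiffWithinAt

end

end SphericalData

/-! ### The isometry with Euclidean space. -/

namespace SphericalData

noncomputable section

variable {n : ℕ} {D : InitialData n} {f u : E n → ℝ} {i j : Fin n} {ρ₀ C m : ℝ}

/-- The ratio of the area radius of the conformal metric and the coordinate radius. -/
def radiusRatio (D : InitialData n) (u : E n → ℝ) (i j : Fin n) (r : ℝ) : ℝ :=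
  axisProfile u i r ^ (2 / ((n : ℝ) - 2)) * D.profileB i j r

lemma areaRadius_eq_radiusRatio_mul (D : InitialData n) (u : E n → ℝ) (i j : Fin n) (r : ℝ) :
    areaRadius n (D.profileRho i j) (axisProfile u i) r = radiusRatio D u i j r * r := by
  rw [areaRadius, InitialData.profileRho, radiusRatio]; ring

lemma InitialData.mem_interior_cases (D : InitialData n) {x : E n} (hx : x ∈ interior D.M) :
    D.r₀ < ‖x‖ ∨ D.r₀ = 0 ∧ x = 0 := by
  rcases D.r₀_nonneg.eq_or_lt with h | h
  · rcases eq_or_ne x 0 with h0 | h0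
    · exact Or.inr ⟨h.symm, h0⟩
    · exact Or.inl (h ▸ norm_pos_iff.2 h0)
  · left
    rwa [InitialData.M, interior_region h] at hx

lemma InitialData.zero_mem_interior (h0 : D.r₀ = 0) : (0 : E n) ∈ interior D.M := by
  rw [InitialData.M, h0, interior_region_zero]; trivial

lemma axisPoint_norm_mem_interior (i : Fin n) {x : E n} (hx : x ∈ interior D.M) :
    axisPoint i ‖x‖ ∈ interior D.M := by
  rcases D.mem_interior_cases hx with h | ⟨h, rfl⟩
  · exact axisPoint_mem_interior D i h
  · rw [norm_zero, ← h]
    exact axisPoint_zero_mem h i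

lemma InitialData.le_abs_norm (D : InitialData n) {x : E n} (hx : x ∈ interior D.M) :
    D.r₀ ≤ |‖x‖| := by
  rw [abs_norm]
  exact (interior_subset hx : x ∈ D.M)

lemma contDiffAt_radiusRatio (hu : IsConformalFactor D f u) (i j : Fin n) {x : E n}
    (hx : x ∈ interior D.M) : ContDiffAt ℝ ∞ (radiusRatio D u i j) ‖x‖ := by
  have hm := axisPoint_norm_mem_interior i hx
  exact ((contDiffAt_axisProfile hu.smooth i hm).rpow_const_of_ne (hu.pos _ hm).ne').mul
    (D.contDiffAt_profileB i j (D.le_abs_norm hx))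

lemma radiusRatio_pos (hu : IsConformalFactor D f u) (i j : Fin n) {x : E n}
    (hx : x ∈ interior D.M) : 0 < radiusRatio D u i j ‖x‖ :=
  mul_pos (Real.rpow_pos_of_pos (hu.pos _ (axisPoint_norm_mem_interior i hx)) _)
    (D.profileB_pos i j (D.le_abs_norm hx))

/-- The left side is the derivative of `σ = h r`, where `h` is the radius ratio. Because `τ = 1`, it
equals the radial length element of the conformal metric; this makes the radial map an isometry in
the radial direction. -/
lemma radiusRatio_add_deriv_mul (hn : 3 ≤ n) (hij : i ≠ j) (hs : D.SphericallySymmetric)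
    (h : D.AsymptoticallyFlatWith ρ₀ C) (hd : D.DominantEnergy)
    (hf : IsJangSolution D f) (hu : IsConformalFactor D f u) {x : E n} (hx : D.r₀ < ‖x‖) :
    radiusRatio D u i j ‖x‖ + deriv (radiusRatio D u i j) ‖x‖ * ‖x‖
      = axisProfile u i ‖x‖ ^ (2 / ((n : ℝ) - 2))
        * jangA (D.profileA i) (axisProfile f i) ‖x‖ := by
  have hJ := jangSystem hn hij hs hd hf hu
  have h1 := hJ.hasDerivAt_areaRadius hx
  rw [areaSlope_eq_one hn hij hs h hd hf hu hx, mul_one,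
    funext (areaRadius_eq_radiusRatio_mul D u i j)] at h1
  have h2 := ((contDiffAt_radiusRatio hu i j (D.mem_interior hx)).differentiableAt
    (by simp)).hasDerivAt.mul (hasDerivAt_id ‖x‖)
  have h3 := h2.unique h1
  have hρ := (hJ.ρ_pos _ hx).ne'
  have e : radiusRatio D u i j ‖x‖ * ‖x‖
      = axisProfile u i ‖x‖ ^ (2 / ((n : ℝ) - 2)) * D.profileRho i j ‖x‖ := by
    rw [← areaRadius_eq_radiusRatio_mul, areaRadius]
  simp only [e, id, mul_one] at h3
  rw [add_comm, h3]
  field_simp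

/-- The map preserves directions and sends the sphere of radius `r` to that of radius `σ(r)`; `σ` is
strictly increasing, tends to zero at `r₀` and to infinity at infinity. -/
lemma bijOn_radialMap {Z φ σ' Z' φ' : ℝ → ℝ} (hu : IsConformalFactor D f u)
    (hdec : DecayProfile n D.r₀ m (areaRadius n (D.profileRho i j) (axisProfile u i))
      Z φ σ' Z' φ') :
    BijOn (radialMap (radiusRatio D u i j)) (interior D.M) (if D.r₀ = 0 then univ else {0}ᶜ) := by
  set σ := areaRadius n (D.profileRho i j) (axisProfile u i) with hσ
  have hnorm : ∀ x ∈ interior D.M, ‖radialMap (radiusRatio D u i j) x‖ = σ ‖x‖ := fun x hx => by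
    rw [radialMap, norm_smul, Real.norm_of_nonneg (radiusRatio_pos hu i j hx).le, hσ,
      areaRadius_eq_radiusRatio_mul]
  have hzero : ∀ x ∈ interior D.M, radialMap (radiusRatio D u i j) x = 0 → x = 0 :=
    fun x hx h0 => (smul_eq_zero.1 h0).resolve_left (radiusRatio_pos hu i j hx).ne'
  refine ⟨fun x hx => ?_, fun x hx y hy hxy => ?_, fun y hy => ?_⟩
  · split_ifs with h0
    · trivial
    · rcases D.mem_interior_cases hx with h | h
      · intro hc
        rw [hzero x hx hc, norm_zero] at h
        exact h.not_ge D.r₀_nonneg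
      · exact absurd h.1 h0
  · rcases D.mem_interior_cases hx with h1 | ⟨h1, rfl⟩
    · rcases D.mem_interior_cases hy with h2 | ⟨h2, rfl⟩
      · have hn : ‖x‖ = ‖y‖ := hdec.σ_strictMono.injOn h1 h2 (by
          rw [← hnorm x hx, ← hnorm y hy, hxy])
        rw [radialMap, radialMap, hn] at hxy
        exact smul_right_injective _ (radiusRatio_pos hu i j hy).ne' hxy
      · exact hzero x hx (by rw [hxy, radialMap, smul_zero])
    · exact (hzero y hy (by rw [← hxy, radialMap, smul_zero])).symm
  · rcases eq_or_ne y 0 with rfl | hy0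
    · have h0 : D.r₀ = 0 := by
        by_contra hc
        simp [hc] at hy
      exact ⟨0, InitialData.zero_mem_interior h0, by rw [radialMap, smul_zero]⟩
    · have hy1 : 0 < ‖y‖ := norm_pos_iff.2 hy0
      have hc : ContinuousOn σ (Ioi D.r₀) := fun r hr =>
        (hdec.hσ r hr).continuousAt.continuousWithinAt
      obtain ⟨a, ha, ha1⟩ := ((hdec.σ_zero.eventually_lt_const hy1).and self_mem_nhdsWithin).exists
      obtain ⟨b, hb, hb1⟩ := ((hdec.σ_top.eventually_gt_atTop ‖y‖).and
        (eventually_gt_atTop D.r₀)).exists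
      obtain ⟨r, hr, hrσ⟩ := isPreconnected_Ioi.intermediate_value ha1 hb1 hc ⟨ha.le, hb.le⟩
      have hr0 : 0 < r := D.r₀_nonneg.trans_lt hr
      have hxn : ‖(r / ‖y‖) • y‖ = r := by
        rw [norm_smul, Real.norm_of_nonneg (by positivity)]; field_simp
      refine ⟨(r / ‖y‖) • y, D.mem_interior (by rw [hxn]; exact hr), ?_⟩
      rw [hσ, areaRadius_eq_radiusRatio_mul] at hrσ
      rw [radialMap, hxn, smul_smul, ← mul_div_assoc, hrσ, div_self hy1.ne', one_smul]

lemma continuousAt_conformalMetric (hf : ContDiffOn ℝ ∞ f (interior D.M))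
    (hu : IsConformalFactor D f u) {x : E n} (hx : x ∈ interior D.M) (a b : Fin n) :
    ContinuousAt (fun y => conformalMetric D.g f u y a b) x := by
  have hm := isOpen_interior.mem_nhds hx
  have cu : ContinuousAt (fun y => u y ^ (4 / ((n : ℝ) - 2))) x :=
    (hu.smooth.contDiffAt hm).continuousAt.rpow_const (Or.inl (hu.pos x hx).ne')
  have cf : ∀ c, ContinuousAt (pd c f) x := fun c =>
    ((hf.contDiffAt hm).continuousAt_fderiv (by simp)).clm_apply continuousAt_const
  exact cu.mul ((D.g_smooth x (interior_subset hx) a b).continuousAt.add ((cf a).mul (cf b)))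

lemma inner_fderiv_radialMap (hn : 3 ≤ n) (hij : i ≠ j) (hs : D.SphericallySymmetric)
    (h : D.AsymptoticallyFlatWith ρ₀ C) (hd : D.DominantEnergy)
    (hf : IsJangSolution D f) (hu : IsConformalFactor D f u) {x : E n} (hx : D.r₀ < ‖x‖)
    (a b : Fin n) :
    inner ℝ (fderiv ℝ (radialMap (radiusRatio D u i j)) x (EuclideanSpace.single a 1))
        (fderiv ℝ (radialMap (radiusRatio D u i j)) x (EuclideanSpace.single b 1))
      = conformalMetric D.g f u x a b := by
  have hr : 0 < ‖x‖ := D.r₀_nonneg.trans_lt hx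
  have hx0 : x ≠ 0 := norm_pos_iff.1 hr
  have hm := D.mem_interior hx
  have hM := (hs.radial hij).1.jangMetric (contDiffOn_axisProfile hf.smooth i)
    fun y hy => hf.radial.eq_axisProfile i hy
  have hU : 0 < axisProfile u i ‖x‖ := hu.pos _ (axisPoint_norm_mem_interior i hm)
  have e4 : u x ^ (4 / ((n : ℝ) - 2)) = (axisProfile u i ‖x‖ ^ (2 / ((n : ℝ) - 2))) ^ 2 := by
    rw [hu.radial.eq_axisProfile i hx, ← Real.rpow_natCast, ← Real.rpow_mul hU.le]
    congr 1
    push_cast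
    ring
  rw [(hasFDerivAt_radialMap ((contDiffAt_radiusRatio hu i j hm).differentiableAt
      (by simp))).fderiv, inner_radialMapDeriv_single hx0,
    radiusRatio_add_deriv_mul hn hij hs h hd hf hu hx, conformalMetric, Matrix.smul_apply,
    smul_eq_mul, e4, hM.eq x hx, radiusRatio, InitialData.profileRho,
    mul_div_cancel_left₀ _ hr.ne']
  ring

/-- The area radius and the angular variables are Euclidean polar coordinates for the conformal
metric. -/
lemma exists_isEuclideanIsometry (hn : 3 ≤ n) (hij : i ≠ j) (hs : D.SphericallySymmetric)
    (h : D.AsymptoticallyFlatWith ρ₀ C) (hd : D.DominantEnergy) (hm : D.HasADMMass m)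
    (hf : IsJangSolution D f) (hu : IsConformalFactor D f u) :
    ∃ Φ : OpenPartialHomeomorph (E n) (E n), IsEuclideanIsometry D f u Φ ∧
      ∀ y : E n, y ≠ 0 → D.r₀ < ‖Φ.symm y‖ ∧
        areaRadius n (D.profileRho i j) (axisProfile u i) ‖Φ.symm y‖ = ‖y‖ := by
  obtain ⟨Z, σ', Z', φ', hdec⟩ := exists_decayProfile hn hij hs h hd hm hf hu
  let F : E n → E n := radialMap (radiusRatio D u i j)
  have hcd : ∀ x ∈ interior D.M, ContDiffAt ℝ 1 F x := fun x hx =>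
    contDiffAt_radialMap ((contDiffAt_radiusRatio hu i j hx).of_le (WithTop.coe_le_coe.2 (le_top : (2 : ℕ∞) ≤ ⊤)))
  have hpos : ∀ x ∈ interior D.M,
      radiusRatio D u i j ‖x‖ + deriv (radiusRatio D u i j) ‖x‖ * ‖x‖ ≠ 0 := fun x hx => by
    rcases D.mem_interior_cases hx with h1 | ⟨h1, h2⟩
    · rw [radiusRatio_add_deriv_mul hn hij hs h hd hf hu h1]
      exact (mul_pos (Real.rpow_pos_of_pos (hu.pos _ (axisPoint_norm_mem_interior i hx)) _)
        ((jangSystem hn hij hs hd hf hu).jangA_pos h1)).ne'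
    · have h3 := (radiusRatio_pos hu i j hx).ne'
      subst h2
      rw [norm_zero] at h3 ⊢
      rwa [mul_zero, add_zero]
  obtain ⟨Φ, hΦs, hΦt, hΦ, hsymm⟩ := exists_openPartialHomeomorph_of_bijOn isOpen_interior
    (bijOn_radialMap hu hdec) hcd fun x hx => by
      rw [(hasFDerivAt_radialMap ((contDiffAt_radiusRatio hu i j hx).differentiableAt
        (by simp))).fderiv]
      exact radialMapDeriv_injective (radiusRatio_pos hu i j hx).ne' (hpos x hx)
  refine ⟨Φ, ⟨hΦs, hΦt, fun _ => ?_, ?_, by rwa [hΦt], ?_⟩, fun y hy => ?_⟩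
  · rw [hΦ, radialMap, smul_zero]
  · rw [hΦs, hΦ]
    exact fun x hx => (hcd x hx).contDiffWithinAt
  · rw [hΦ, hΦs]
    intro x hx a b
    rcases D.mem_interior_cases hx with h1 | ⟨h1, rfl⟩
    · exact inner_fderiv_radialMap hn hij hs h hd hf hu h1 a b
    · have : NeZero n := ⟨by omega⟩
      have cF : ContinuousAt (fderiv ℝ F) 0 := (hcd 0 hx).continuousAt_fderiv (by simp)
      have cL : ContinuousAt (fun y => inner ℝ (fderiv ℝ F y (EuclideanSpace.single a 1))
          (fderiv ℝ F y (EuclideanSpace.single b 1))) 0 :=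
        ContinuousAt.inner (𝕜 := ℝ) (cF.clm_apply continuousAt_const) (cF.clm_apply continuousAt_const)
      -- The polar formula degenerates at the centre, so equality there follows from continuity of
      -- both sides on the punctured neighbourhood.
      refine tendsto_nhds_unique (cL.tendsto.mono_left (nhdsWithin_le_nhds (s := {0}ᶜ)))
        (((continuousAt_conformalMetric hf.smooth hu hx a b).tendsto.mono_left
          nhdsWithin_le_nhds).congr' ?_)
      filter_upwards [self_mem_nhdsWithin] with y hy
      exact (inner_fderiv_radialMap hn hij hs h hd hf hu (h1 ▸ norm_pos_iff.2 hy) a b).symm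
  · have hyt : y ∈ Φ.target := by
      rw [hΦt]
      split_ifs
      · trivial
      · exact hy
    have hxs : Φ.symm y ∈ interior D.M := hΦs ▸ Φ.map_target hyt
    have hxy : radialMap (radiusRatio D u i j) (Φ.symm y) = y := by
      rw [← hΦ]; exact Φ.right_inv hyt
    refine ⟨(D.mem_interior_cases hxs).resolve_right fun hc => hy ?_, ?_⟩
    · rw [← hxy, hc.2, radialMap, smul_zero]
    · rw [areaRadius_eq_radiusRatio_mul]
      conv_rhs => rw [← hxy, radialMap, norm_smul,
        Real.norm_of_nonneg (radiusRatio_pos hu i j hxs).le]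

end

end SphericalData

namespace SphericalData

noncomputable section

variable {n : ℕ} {D : InitialData n} {f u : E n → ℝ} {i j : Fin n} {ρ₀ C m : ℝ}

/-! ### Decay and Hölder estimates -/

/-- The two pointwise estimates for the logarithm of the conformal factor on Euclidean space. -/
structure HasDecay (m : ℝ) (w : E n → ℝ) : Prop where
  nonneg : 0 ≤ m
  sq_le : ∀ y, y ≠ 0 → w y ^ 2 * ‖y‖ ^ (n - 2) ≤ ((n : ℝ) - 2) * m
  sq_sub_le : ∀ y z, y ≠ 0 → z ≠ 0 → ‖y‖ ≤ ‖z‖ →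
    (w z - w y) ^ 2 * ‖y‖ ^ (n - 1) ≤ ((n : ℝ) - 2) ^ 2 * m * (‖z‖ - ‖y‖)

lemma exists_isometry_hasDecay (hn : 3 ≤ n) (hs : D.SphericallySymmetric)
    (h : D.AsymptoticallyFlatWith ρ₀ C) (hd : D.DominantEnergy) (hm : D.HasADMMass m)
    (hf : IsJangSolution D f) (hu : IsConformalFactor D f u) :
    ∃ Φ : OpenPartialHomeomorph (E n) (E n), IsEuclideanIsometry D f u Φ ∧
      (∀ y, y ≠ 0 → 0 < u (Φ.symm y)) ∧ HasDecay m fun y => Real.log (u (Φ.symm y)) := by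
  have hij : (⟨0, by omega⟩ : Fin n) ≠ ⟨1, by omega⟩ := by simp
  obtain ⟨Φ, hΦ, hσ⟩ := exists_isEuclideanIsometry hn hij hs h hd hm hf hu
  obtain ⟨Z, σ', Z', φ', hdec⟩ := exists_decayProfile hn hij hs h hd hm hf hu
  refine ⟨Φ, hΦ, fun y hy => hu.pos _ (D.mem_interior (hσ y hy).1), hdec.e_nonneg,
    fun y hy => ?_, fun y z hy hz hyz => ?_⟩
  · obtain ⟨h1, h2⟩ := hσ y hy
    have := hdec.sq_le h1
    rwa [h2, ← hu.radial.eq_axisProfile _ h1] at this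
  · obtain ⟨h1, h2⟩ := hσ y hy
    obtain ⟨h3, h4⟩ := hσ z hz
    have := hdec.sq_sub_le h1 ((hdec.σ_strictMono.le_iff_le h1 h3).1 (by rwa [h2, h4]))
    rwa [h2, h4, ← hu.radial.eq_axisProfile _ h1, ← hu.radial.eq_axisProfile _ h3] at this

lemma ne_zero_of_le_sphereArea (hn : 3 ≤ n) {A₀ : ℝ} (hA : 0 < A₀) {y : E n}
    (hy : A₀ ≤ sphereArea y) : y ≠ 0 := by
  rintro rfl
  rw [sphereArea, norm_zero, zero_pow (by omega), mul_zero] at hy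
  exact hA.not_ge hy

lemma sqrt_mul_sphereArea_le {A₀ : ℝ} {y : E n}
    (hy : y ∈ annulus n A₀ (ENNReal.ofReal (Real.sqrt m))⁻¹) :
    Real.sqrt m * sphereArea y ≤ 1 := by
  rcases (Real.sqrt_nonneg m).eq_or_lt with h0 | h0
  · rw [← h0, zero_mul]; exact zero_le_one
  · have h1 := hy.2
    rw [← ENNReal.ofReal_inv_of_pos h0,
      ENNReal.ofReal_le_ofReal_iff (inv_nonneg.2 h0.le)] at h1
    calc _ ≤ Real.sqrt m * (Real.sqrt m)⁻¹ := by gcongr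
      _ = 1 := mul_inv_cancel₀ h0.ne'

/-- The constant in the supremum bound. -/
def supConstant (n : ℕ) : ℝ := Real.sqrt (((n : ℝ) - 2) * (unitSphereVolume n + 1))

/-- The constant in the bound of the Hölder seminorm. -/
def holderConstant (n : ℕ) : ℝ := Real.sqrt (((n : ℝ) - 2) ^ 2 * unitSphereVolume n)

lemma sq_quarter_rpow (hm : 0 ≤ m) : (m ^ (1 / 4 : ℝ)) ^ 2 = Real.sqrt m := by
  rw [← Real.rpow_natCast, ← Real.rpow_mul hm, Real.sqrt_eq_rpow]
  norm_num

namespace HasDecay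

variable {w : E n → ℝ} {A₀ : ℝ}

/-- Replacing `A₀` by the larger `ω ‖y‖^{n-1}` in `w² A₀` and using the decay `w² ≤ (n-2) m
‖y‖^{2-n}` leaves a multiple of `m ‖y‖`. One factor `√m` absorbs `‖y‖` through the outer area
`1/√m`; the other survives as the square of `m^{1/4}`. -/
lemma abs_le (h : HasDecay m w) (hn : 3 ≤ n) (hm : m < 1) (hA : 0 < A₀) {y : E n}
    (hy : y ∈ annulus n A₀ (ENNReal.ofReal (Real.sqrt m))⁻¹) :
    |w y| ≤ supConstant n * m ^ (1 / 4 : ℝ) / Real.sqrt A₀ := by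
  have hn2 : (0 : ℝ) < (n : ℝ) - 2 := by
    have : (3 : ℝ) ≤ n := by exact_mod_cast hn
    linarith
  have hω : 0 < unitSphereVolume n := unitSphereVolume_pos (by omega)
  have h0 := ne_zero_of_le_sphereArea hn hA hy.1
  have hm0 := h.nonneg
  have hs : 0 < ‖y‖ := norm_pos_iff.2 h0
  have hq : 0 ≤ Real.sqrt m := Real.sqrt_nonneg m
  have hq1 : Real.sqrt m ≤ 1 := Real.sqrt_le_one.2 hm.le
  have hle := sqrt_mul_sphereArea_le hy
  -- For `‖y‖ ≤ 1` this uses `m < 1`; for `‖y‖ ≥ 1` it uses `‖y‖ ≤ ‖y‖^{n-1}` and the outer area.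
  have hqs : Real.sqrt m * (unitSphereVolume n * ‖y‖) ≤ unitSphereVolume n + 1 := by
    rcases le_total ‖y‖ 1 with h1 | h1
    · have : Real.sqrt m * (unitSphereVolume n * ‖y‖) ≤ 1 * (unitSphereVolume n * 1) := by gcongr
      linarith
    · have : Real.sqrt m * (unitSphereVolume n * ‖y‖) ≤ Real.sqrt m * sphereArea y := by
        rw [sphereArea]
        gcongr
        exact le_self_pow₀ h1 (by omega)
      linarith
  refine abs_le_of_sq_le_sq ?_ (by unfold supConstant; positivity)
  rw [div_pow, mul_pow, supConstant, Real.sq_sqrt (by positivity), sq_quarter_rpow h.nonneg,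
    Real.sq_sqrt hA.le, le_div_iff₀ hA]
  have e : ‖y‖ ^ (n - 1) = ‖y‖ * ‖y‖ ^ (n - 2) := by
    rw [← pow_succ']; congr 1; omega
  calc w y ^ 2 * A₀ ≤ w y ^ 2 * (unitSphereVolume n * ‖y‖ ^ (n - 1)) := by
        gcongr; exact hy.1
    _ = unitSphereVolume n * ‖y‖ * (w y ^ 2 * ‖y‖ ^ (n - 2)) := by rw [e]; ring
    _ ≤ unitSphereVolume n * ‖y‖ * (((n : ℝ) - 2) * m) := by
        exact mul_le_mul_of_nonneg_left (h.sq_le y h0) (by positivity)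
    _ = ((n : ℝ) - 2) * (Real.sqrt m * (unitSphereVolume n * ‖y‖)) * Real.sqrt m := by
        nth_rw 1 [← Real.mul_self_sqrt h.nonneg]; ring
    _ ≤ _ := by gcongr

/-- The outer area plays no role here: `m ≤ √m` alone produces the power `m^{1/4}`. -/
lemma abs_sub_le (h : HasDecay m w) (hn : 3 ≤ n) (hm : m < 1) (hA : 0 < A₀) {y z : E n}
    (hy : A₀ ≤ sphereArea y) (hz : A₀ ≤ sphereArea z) :
    |w y - w z| ≤ holderConstant n * m ^ (1 / 4 : ℝ) / Real.sqrt A₀ * ‖y - z‖ ^ (1 / 2 : ℝ) := by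
  wlog hyz : ‖y‖ ≤ ‖z‖ generalizing y z
  · rw [abs_sub_comm, norm_sub_rev]
    exact this hz hy (le_of_not_ge hyz)
  have hω : 0 < unitSphereVolume n := unitSphereVolume_pos (by omega)
  have h0 := ne_zero_of_le_sphereArea hn hA hy
  have h1 := ne_zero_of_le_sphereArea hn hA hz
  have hm0 := h.nonneg
  have hmm : m ≤ Real.sqrt m := Real.le_sqrt_of_sq_le (by nlinarith [h.nonneg])
  have hd : ‖z‖ - ‖y‖ ≤ ‖y - z‖ := by
    rw [norm_sub_rev]; exact norm_sub_norm_le z y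
  refine abs_le_of_sq_le_sq ?_ (by unfold holderConstant; positivity)
  rw [mul_pow, div_pow, mul_pow, holderConstant, Real.sq_sqrt (by positivity),
    sq_quarter_rpow h.nonneg, Real.sq_sqrt hA.le, ← Real.sqrt_eq_rpow,
    Real.sq_sqrt (norm_nonneg _), div_mul_eq_mul_div, le_div_iff₀ hA]
  calc (w y - w z) ^ 2 * A₀ ≤ (w y - w z) ^ 2 * (unitSphereVolume n * ‖y‖ ^ (n - 1)) := by
        gcongr; exact hy
    _ = unitSphereVolume n * ((w z - w y) ^ 2 * ‖y‖ ^ (n - 1)) := by ring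
    _ ≤ unitSphereVolume n * (((n : ℝ) - 2) ^ 2 * m * (‖z‖ - ‖y‖)) := by
        exact mul_le_mul_of_nonneg_left (h.sq_sub_le y z h0 h1 hyz) hω.le
    _ ≤ unitSphereVolume n * (((n : ℝ) - 2) ^ 2 * Real.sqrt m * ‖y - z‖) := by
        have := sub_nonneg.2 hyz
        gcongr
    _ = _ := by ring

lemma holderHalfNorm_le (h : HasDecay m w) (hn : 3 ≤ n) (hm : m < 1) (hA : 0 < A₀) :
    holderHalfNorm w (annulus n A₀ (ENNReal.ofReal (Real.sqrt m))⁻¹) ≤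
      ENNReal.ofReal ((supConstant n + holderConstant n) * m ^ (1 / 4 : ℝ) / Real.sqrt A₀) := by
  have hm4 : 0 ≤ m ^ (1 / 4 : ℝ) := Real.rpow_nonneg h.nonneg _
  have hS : 0 ≤ supConstant n * m ^ (1 / 4 : ℝ) / Real.sqrt A₀ := by
    unfold supConstant; positivity
  have hH : 0 ≤ holderConstant n * m ^ (1 / 4 : ℝ) / Real.sqrt A₀ := by
    unfold holderConstant; positivity
  rw [add_mul, add_div, ENNReal.ofReal_add hS hH]
  refine add_le_add (iSup_le fun y => ?_) ?_
  · rw [Real.enorm_eq_ofReal_abs]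
    exact ENNReal.ofReal_le_ofReal (h.abs_le hn hm hA y.2)
  · refine HolderWith.eHolderNorm_le (C := Real.toNNReal _) fun y z => ?_
    rw [edist_dist, edist_dist, Real.dist_eq, ENNReal.ofReal_rpow_of_nonneg dist_nonneg (by simp)]
    change _ ≤ ENNReal.ofReal _ * _
    rw [← ENNReal.ofReal_mul hH]
    refine ENNReal.ofReal_le_ofReal ?_
    have := h.abs_sub_le hn hm hA y.2.1 z.2.1
    rw [Subtype.dist_eq, dist_eq_norm]
    exact_mod_cast this

/-- Taking the minimum with `1` gives a lower bound for `‖y‖` without extracting a root: if `‖y‖ ≤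
1`, then `A₀/ω ≤ ‖y‖^{n-1} ≤ ‖y‖`. -/
lemma sq_le_of_le_sphereArea (h : HasDecay m w) (hn : 3 ≤ n) (hA : 0 < A₀) {y : E n}
    (hy : A₀ ≤ sphereArea y) :
    w y ^ 2 ≤ ((n : ℝ) - 2) / min 1 (A₀ / unitSphereVolume n) ^ (n - 2) * m := by
  have hω : 0 < unitSphereVolume n := unitSphereVolume_pos (by omega)
  have h0 := ne_zero_of_le_sphereArea hn hA hy
  have hs : 0 < min 1 (A₀ / unitSphereVolume n) := lt_min one_pos (by positivity)
  have hle : min 1 (A₀ / unitSphereVolume n) ≤ ‖y‖ := by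
    rcases le_total 1 ‖y‖ with h1 | h1
    · exact (min_le_left _ _).trans h1
    · refine (min_le_right _ _).trans ?_
      rw [div_le_iff₀' hω]
      refine hy.trans ?_
      rw [sphereArea]
      gcongr
      exact pow_le_of_le_one (norm_nonneg _) h1 (by omega)
  rw [div_mul_eq_mul_div, le_div_iff₀ (by positivity)]
  refine le_trans ?_ (h.sq_le y h0)
  gcongr

end HasDecay

/-- Functions whose logarithms decay with rates tending to zero tend to one uniformly away from the
origin. -/
lemma tendstoUniformlyOn_one (hn : 3 ≤ n) {v : ℕ → E n → ℝ} {m : ℕ → ℝ}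
    (hv : ∀ j y, y ≠ 0 → 0 < v j y) (h : ∀ j, HasDecay (m j) fun y => Real.log (v j y))
    (hm : Tendsto m atTop (𝓝 0)) {A₀ : ℝ} (hA : 0 < A₀) :
    TendstoUniformlyOn v (fun _ => 1) atTop (annulus n A₀ ⊤) := by
  rw [Metric.tendstoUniformlyOn_iff]
  intro ε hε
  obtain ⟨η, hη, hexp⟩ := Metric.continuousAt_iff.1 (Real.continuous_exp.continuousAt (x := 0)) ε hε
  have hlim := hm.const_mul (((n : ℝ) - 2) / min 1 (A₀ / unitSphereVolume n) ^ (n - 2))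
  rw [mul_zero] at hlim
  filter_upwards [hlim.eventually_lt_const (pow_pos hη 2)] with j hj y hy
  have h1 := ((h j).sq_le_of_le_sphereArea hn hA hy.1).trans_lt hj
  have h2 : |Real.log (v j y)| < η := abs_lt_of_sq_lt_sq h1 hη.le
  have h3 := @hexp (Real.log (v j y)) (by rwa [Real.dist_eq, sub_zero])
  rwa [Real.exp_log (hv j y (ne_zero_of_le_sphereArea hn hA hy.1)), Real.exp_zero, dist_comm] at h3

end

end SphericalData

theorem mainTheorem9 (n : ℕ) (hn : 3 ≤ n) (ρ₀ C₀ : ℝ) (hρ₀ : 0 < ρ₀) :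
    ∃ C > 0, ∃ δ > 0,
      ∀ (D : ℕ → InitialData n) (f u : ℕ → E n → ℝ) (m : ℕ → ℝ),
        (∀ j, (D j).SphericallySymmetric) →
        (∀ j, (D j).AsymptoticallyFlatWith ρ₀ C₀) →
        (∀ j, (D j).DominantEnergy) →
        (∀ j, (D j).NoHorizonOrOutermostBoundary) →
        (∀ j, (D j).HasADMMass (m j)) →
        (∀ j, IsJangSolution (D j) (f j)) →
        (∀ j, IsConformalFactor (D j) (f j) (u j)) →
        ∃ Φ : ℕ → OpenPartialHomeomorph (E n) (E n),
          (∀ j, IsEuclideanIsometry (D j) (f j) (u j) (Φ j)) ∧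
          (∀ A₀ : ℝ, 0 < A₀ → ∀ j, m j < δ → m j < 1 / A₀ ^ 2 →
            holderHalfNorm (fun y => Real.log (u j ((Φ j).symm y)))
                (annulus n A₀ (ENNReal.ofReal (Real.sqrt (m j)))⁻¹)
              ≤ ENNReal.ofReal (C * m j ^ (1 / 4 : ℝ) / Real.sqrt A₀)) ∧
          (Tendsto m atTop (𝓝 0) → ∀ A₀ : ℝ, 0 < A₀ →
            TendstoUniformlyOn (fun j y => u j ((Φ j).symm y)) (fun _ => 1) atTop
              (annulus n A₀ ⊤)) := by
  have hn2 : (0 : ℝ) < (n : ℝ) - 2 := by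
    have : (3 : ℝ) ≤ n := by exact_mod_cast hn
    linarith
  have hω : 0 < unitSphereVolume n := unitSphereVolume_pos (by omega)
  -- The constants come from the two parts of the norm and depend only on `n`; the threshold `1` is
  -- what `√m ≤ 1` and `m ≤ √m` need.
  refine ⟨supConstant n + holderConstant n, ?_, 1, one_pos,
    fun D f u m hs h hd _ hm hf hu => ?_⟩
  · unfold supConstant holderConstant; positivity
  choose Φ hΦ hpos hdec using fun j =>
    exists_isometry_hasDecay hn (hs j) (h j) (hd j) (hm j) (hf j) (hu j)
  exact ⟨Φ, hΦ, fun A₀ hA j hj _ => (hdec j).holderHalfNorm_le hn hj hA,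
    fun hm0 A₀ hA => tendstoUniformlyOn_one hn hpos hdec hm0 hA⟩
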